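/- **Sets of indices.** A set of indices $\mathbb I=(I,\le,\mathcal I)$ is a nonempty preordered set $I$ with a family $\mathcal I$ of nonempty subsets of $I$ such that $I\in\mathcal I$; for all $A,B\in\mathcal I$ there is $C\in\mathcal I$ with $C\subseteq A\cap B$; and whenever $e\le a\in A\in\mathcal I$, the set $A_{\le e}=\{\varepsilon\in A\mid \varepsilon\le e\}$ is nonempty and for all $b,c\in A_{\le e}$ there is $d\in A_{\le e}$ with $d\le b$, $d\ne b$, $d\le c$, $d\neq c$. For $a\in A\in\mathcal I$, "$P(\varepsilon)$ for small $\varepsilon\in A_{\le a}$" means $\exists e\in A_{\le a}\,\forall\varepsilon\in A_{\le e}: P(\varepsilon)$. For $x,y\in\mathbb R^I$: $x>_{\mathbb I}0$ means $\exists A\in\mathcal I\,\forall a\in A$: $x_\varepsilon>0$ for small $\varepsilon\in A_{\le a}$; $x=O(y)$ means $\exists A\in\mathcal I\,\forall a\in A\,\exists H>0$: $|x_\varepsilon|\le H|y_\varepsilon|$ for small $\varepsilon\in A_{\le a}$; $\lim_{\mathbb I}x=+\infty$ means $\exists A\in\mathcal I\,\forall a\in A\,\forall M$: $x_\varepsilon>M$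 for small $\varepsilon\in A_{\le a}$. A morphism $\mathbb I_1\to\mathbb I_2$ is a map $f:I_2\to I_1$ such that for every $A\in\mathcal I_1$ there is $B\in\mathcal I_2$ such that for every $b\in B$ there is $a\in A$ such that, for all $\alpha\in A_{\le a}$, $f(\varepsilon)\in A_{\le\alpha}$ for small $\varepsilon\in B_{\le b}$. **Principal asymptotic gauges.** An asymptotic gauge (AG) on $\mathbb I$ is a set $B\subseteq\mathbb R^I$ such that: some $i\in B$ has $\lim_{\mathbb I}i=+\infty$; for $i,j\in B$ and $r\in\mathbb R$ there are $p,\sigma,s\in B$ with $ij=O(p)$, $ri=O(\sigma)$, $s>_{\mathbb I}0$ and $|i|+|j|=O(s)$. Put $\mathbb R_M(B)=\{x\in\mathbb R^I\mid\exists b\in B:\ x=O(b)\}$. $B$ is principal with generator $b\in B$ if $\mathbb R_M(\{b^m\mid m\in\mathbb N\})=\mathbb R_M(B)$. The category $\mathrm{pAG}$ has as objects the pairs $(b,B)$, $B$ a principal AG on some set of indices and $b$ a generator of $B$; an arrow $(b_1,B_1)\to(b_2,B_2)$ is a morphism $f:\mathbb I_1\to\mathbb I_2$ with $\mathbb R_M(\{c\circ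 f\mid c\in B_1\})=\mathbb R_M(B_2)$ and $b_1\circ f=b_2$; the composite of $f$ with $g:(b_2,B_2)\to(b_3,B_3)$ is $f\circ g$. **Colombeau algebras.** Let $n\ge1$. For $\Omega\subseteq\mathbb R^n$ open let $\mathcal E_M(B,\Omega)$ be the algebra of nets $u\in C^\infty(\Omega)^I$ such that for all compact $K\subseteq\Omega$ and $\alpha\in\mathbb N^n$ there is $c\in B$ with $\sup_K|\partial^\alpha u_\varepsilon|=O(c_\varepsilon)$, let $\mathcal N(B,\Omega)$ be the ideal of those $u$ with $\sup_K|\partial^\alpha u_\varepsilon|=O(z_\varepsilon^{-1})$ for all such $K,\alpha$ and all $z\in B$ with $z>_{\mathbb I}0$, and let $\mathcal G(B,\Omega)=\mathcal E_M(B,\Omega)/\mathcal N(B,\Omega)$, with $\partial^\alpha[u_\varepsilon]=[\partial^\alpha u_\varepsilon]$, restrictions $[u_\varepsilon]|_{\Omega'}=[u_\varepsilon|_{\Omega'}]$, and $C^\infty(\Omega)\subseteq\mathcal G(B,\Omega)$ via $f\mapsto[f]$. **The category $\mathrm{Col}_n$.** An object is a triple $(G,\partial,i)$ where $(G,\partial)$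 is a presheaf on the open subsets of $\mathbb R^n$ of differential algebras (commutative real algebras with $n$ commuting derivations $\partial_1,\dots,\partial_n$; $\partial^\alpha=\partial_1^{\alpha_1}\cdots\partial_n^{\alpha_n}$), $C^\infty(\Omega)$ is a subalgebra of $G(\Omega)$ for every $\Omega$, and $i:\mathcal D'\to G$ is a natural transformation of presheaves of real vector spaces such that for all $\Omega$: $\ker i_\Omega=0$, $i_\Omega(f)=f$ for $f\in C^\infty(\Omega)$, and $i_\Omega\circ D^\alpha=\partial^\alpha\circ i_\Omega$ for all $\alpha\in\mathbb N^n$. An arrow $(G,\partial,i)\to(H,d,j)$ is a natural transformation $\varphi:(G,\partial)\to(H,d)$ of presheaves of differential algebras with $\varphi_\Omega\circ i_\Omega=j_\Omega$ for all $\Omega$. **Theorem.** Let $n\ge1$ and let $\rho\in\mathcal S(\mathbb R^n)$ be a real-valued Colombeau mollifier: $\int\rho=1$ and $\int\rho(x)x^k\,dx=0$ for all $k\in\mathbb N^n$ with $|k|\ge1$. (1) For every $(b,B)\in\mathrm{pAG}$ there is exactly one family $i=i_b^\rho$ of linear maps $i_\Omega:\mathcal D'(\Omega)\to\mathcal G(B,\Omega)$,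 compatible with restrictions, such that $i_\Omega(T)=[(T*\rho_\varepsilon)|_\Omega]$ for every $T\in\mathcal D'(\Omega)$ with compact support in $\Omega$, where $\rho_\varepsilon(x)=|b_\varepsilon|^n\rho(|b_\varepsilon|x)$. (2) For every $(b,B)\in\mathrm{pAG}$, $(\mathcal G(B,-),\partial,i_b^\rho)$ is an object of $\mathrm{Col}_n$. (3) For every arrow $f:(b_1,B_1)\to(b_2,B_2)$ of $\mathrm{pAG}$ the maps $\mathcal G(B_1,\Omega)\to\mathcal G(B_2,\Omega)$, $[u_{\varepsilon}]\mapsto[u_{f(\varepsilon)}]$, are well defined and form an arrow $(\mathcal G(B_1,-),\partial,i_{b_1}^\rho)\to(\mathcal G(B_2,-),\partial,i_{b_2}^\rho)$ of $\mathrm{Col}_n$. (4) The assignments in (2) and (3) form a functor $\mathrm{pAG}\to\mathrm{Col}_n$. -/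

import Mathlib

open CategoryTheory TopologicalSpace MeasureTheory Opposite
open scoped Distributions SchwartzMap ContDiff Topology

universe u

noncomputable section

namespace Colombeau

/-! ### Sets of indices -/

/-- A set of indices `(I, ≤, 𝓘)`: a nonempty preordered set `I` and a family `𝓘` of nonempty
subsets of `I`, containing `I` and filtered by intersection, such that `{ε ∈ A | ε ≤ e}` is nonempty
and downward directed for the strict relation "`≤` and `≠`" whenever `e ≤ a ∈ A ∈ 𝓘`. -/
structure IndexSet where
  I : Type u
  le : I → I → Prop
  nonempty : Nonempty I
  le_refl : ∀ e, le e e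
  le_trans : ∀ a b c, le a b → le b c → le a c
  sets : Set (Set I)
  empty_notMem : ∅ ∉ sets
  univ_mem : Set.univ ∈ sets
  inter : ∀ A ∈ sets, ∀ B ∈ sets, ∃ C ∈ sets, C ⊆ A ∩ B
  directed : ∀ A ∈ sets, ∀ a ∈ A, ∀ e, le e a →
    {ε | ε ∈ A ∧ le ε e}.Nonempty ∧
    ∀ b ∈ {ε | ε ∈ A ∧ le ε e}, ∀ c ∈ {ε | ε ∈ A ∧ le ε e},
      ∃ d ∈ {ε | ε ∈ A ∧ le ε e}, (le d b ∧ d ≠ b) ∧ (le d c ∧ d ≠ c)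

namespace IndexSet

variable (J : IndexSet.{u})

/-- `A_{≤ e}`. -/
def below (A : Set J.I) (e : J.I) : Set J.I := {ε | ε ∈ A ∧ J.le ε e}

/-- `P ε` holds for `ε` sufficiently small in `A_{≤ a}`. -/
def EvAt (A : Set J.I) (a : J.I) (P : J.I → Prop) : Prop :=
  ∃ e ∈ J.below A a, ∀ ε ∈ J.below A e, P ε

/-- `P ε` holds for `ε` sufficiently small in the set of indices. -/
def Ev (P : J.I → Prop) : Prop := ∃ A ∈ J.sets, ∀ a ∈ A, J.EvAt A a P

/-- `x_ε = O_{a,A}(y_ε)`. -/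
def BigOAt (A : Set J.I) (a : J.I) (x y : J.I → ℝ) : Prop :=
  ∃ H : ℝ, 0 < H ∧ ∃ e ∈ J.below A a, ∀ ε ∈ J.below A e, |x ε| ≤ H * |y ε|

/-- `x_ε = O(y_ε)`. -/
def BigO (x y : J.I → ℝ) : Prop := ∃ A ∈ J.sets, ∀ a ∈ A, J.BigOAt A a x y

/-- `x >_𝕀 0`. -/
def Pos (x : J.I → ℝ) : Prop := J.Ev fun ε => 0 < x ε

/-- The limit of the net `x` in the set of indices is `+∞`. -/
def TendsToTop (x : J.I → ℝ) : Prop :=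
  ∃ A ∈ J.sets, ∀ a ∈ A, ∀ M : ℝ, J.EvAt A a fun ε => M < x ε

/-- The set `ℝ_M(B)` of moderate nets generated by `B`. -/
def moderateNets (B : Set (J.I → ℝ)) : Set (J.I → ℝ) := {x | ∃ b ∈ B, J.BigO x b}

/-- `B` is an asymptotic gauge. -/
structure IsAG (B : Set (J.I → ℝ)) : Prop where
  infinite : ∃ i ∈ B, J.TendsToTop i
  mul : ∀ i ∈ B, ∀ j ∈ B, ∃ p ∈ B, J.BigO (i * j) p
  smul : ∀ i ∈ B, ∀ r : ℝ, ∃ s ∈ B, J.BigO (r • i) s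
  add : ∀ i ∈ B, ∀ j ∈ B, ∃ s ∈ B, J.Pos s ∧ J.BigO (|i| + |j|) s

/-- `AG(b) = {b ^ m | m ∈ ℕ}`. -/
def powers (b : J.I → ℝ) : Set (J.I → ℝ) := {x | ∃ m : ℕ, x = b ^ m}

variable {J}

/-- Common form of `Ev` and `BigO`, used only for helper facts. -/
def Loc (P : ℝ → J.I → Prop) : Prop :=
  ∃ A ∈ J.sets, ∀ a ∈ A, ∃ H : ℝ, 0 < H ∧ ∃ e ∈ J.below A a, ∀ ε ∈ J.below A e, P H ε

theorem Loc.and {P Q R : ℝ → J.I → Prop} (hP : Loc P) (hQ : Loc Q)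
    (h : ∀ H₁ H₂ : ℝ, 0 < H₁ → 0 < H₂ →
      ∃ H : ℝ, 0 < H ∧ ∀ ε, P H₁ ε → Q H₂ ε → R H ε) : Loc R := by
  obtain ⟨A, hA, hPA⟩ := hP
  obtain ⟨B, hB, hQB⟩ := hQ
  obtain ⟨C, hC, hCAB⟩ := J.inter A hA B hB
  refine ⟨C, hC, fun c hc => ?_⟩
  obtain ⟨H₁, hH₁, e₁, he₁, h₁⟩ := hPA c (hCAB hc).1
  obtain ⟨H₂, hH₂, e₂, he₂, h₂⟩ := hQB c (hCAB hc).2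
  obtain ⟨H, hH, hR⟩ := h H₁ H₂ hH₁ hH₂
  obtain ⟨⟨d₁, hd₁C, hd₁⟩, -⟩ := J.directed C hC c hc e₁ he₁.2
  obtain ⟨⟨d₂, hd₂C, hd₂⟩, -⟩ := J.directed C hC c hc e₂ he₂.2
  obtain ⟨d, ⟨hdC, hdc⟩, ⟨hdd₁, -⟩, hdd₂, -⟩ := (J.directed C hC c hc c (J.le_refl c)).2
    d₁ ⟨hd₁C, J.le_trans _ _ _ hd₁ he₁.2⟩ d₂ ⟨hd₂C, J.le_trans _ _ _ hd₂ he₂.2⟩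
  refine ⟨H, hH, d, ⟨hdC, hdc⟩, fun ε hε => hR ε (h₁ ε ?_) (h₂ ε ?_)⟩
  · exact ⟨(hCAB hε.1).1, J.le_trans _ _ _ hε.2 (J.le_trans _ _ _ hdd₁ hd₁)⟩
  · exact ⟨(hCAB hε.1).2, J.le_trans _ _ _ hε.2 (J.le_trans _ _ _ hdd₂ hd₂)⟩

theorem Loc.of_forall {P : ℝ → J.I → Prop} (H : ℝ) (hH : 0 < H) (h : ∀ ε, P H ε) : Loc P :=
  ⟨Set.univ, J.univ_mem, fun a _ => ⟨H, hH, a, ⟨trivial, J.le_refl a⟩, fun ε _ => h ε⟩⟩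

theorem Loc.mono {P R : ℝ → J.I → Prop} (hP : Loc P)
    (h : ∀ H₁ : ℝ, 0 < H₁ → ∃ H : ℝ, 0 < H ∧ ∀ ε, P H₁ ε → R H ε) : Loc R :=
  hP.and hP fun H₁ _ h₁ _ => by
    obtain ⟨H, hH, hR⟩ := h H₁ h₁
    exact ⟨H, hH, fun ε hp _ => hR ε hp⟩

theorem Ev.loc {P : J.I → Prop} (h : J.Ev P) : Loc (J := J) fun _ => P := by
  obtain ⟨A, hA, h⟩ := h
  exact ⟨A, hA, fun a ha => ⟨1, one_pos, h a ha⟩⟩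

theorem BigO.loc {x y : J.I → ℝ} (h : J.BigO x y) :
    Loc (J := J) fun H ε => |x ε| ≤ H * |y ε| := h

theorem bigO_refl (x : J.I → ℝ) : J.BigO x x :=
  Loc.of_forall (P := fun H ε => |x ε| ≤ H * |x ε|) 1 one_pos fun _ => by simp

theorem BigO.trans {x y z : J.I → ℝ} (h₁ : J.BigO x y) (h₂ : J.BigO y z) : J.BigO x z :=
  h₁.loc.and h₂.loc fun H₁ H₂ p₁ p₂ => ⟨H₁ * H₂, mul_pos p₁ p₂, fun ε h h' => by
    calc |x ε| ≤ H₁ * |y ε| := h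
      _ ≤ H₁ * (H₂ * |z ε|) := by gcongr
      _ = _ := by ring⟩

theorem BigO.of_le {x y z : J.I → ℝ} (h : ∀ ε, |x ε| ≤ |y ε|) (h₂ : J.BigO y z) : J.BigO x z :=
  h₂.loc.mono fun H hH => ⟨H, hH, fun ε hε => (h ε).trans hε⟩

/-- `f : I₂ → I₁` is infinitesimal as a map `A_{≤ a} → B_{≤ b}`. -/
def Infinitesimal (J₁ J₂ : IndexSet.{u}) (f : J₂.I → J₁.I) (A : Set J₁.I) (a : J₁.I)
    (B : Set J₂.I) (b : J₂.I) : Prop :=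
  ∀ α ∈ J₁.below A a, J₂.EvAt B b fun ε => f ε ∈ J₁.below A α

/-- Morphisms `𝕀₁ → 𝕀₂` of sets of indices, given by maps `I₂ → I₁`. The basepoint `a` is allowed
to depend on `b`, so that identities are morphisms also when `I₁` is not downward directed; the
stronger requirement in which `a` is prescribed first is sufficient, see `IsMor.of_forall`. -/
def IsMor (J₁ J₂ : IndexSet.{u}) (f : J₂.I → J₁.I) : Prop :=
  ∀ A ∈ J₁.sets, ∃ B ∈ J₂.sets, ∀ b ∈ B, ∃ a ∈ A, Infinitesimal J₁ J₂ f A a B b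

theorem IsMor.of_forall {J₁ J₂ : IndexSet.{u}} {f : J₂.I → J₁.I}
    (h : ∀ A ∈ J₁.sets, ∀ a ∈ A, ∃ B ∈ J₂.sets, ∀ b ∈ B, Infinitesimal J₁ J₂ f A a B b) :
    IsMor J₁ J₂ f := by
  intro A hA
  have hne : A.Nonempty := by
    rw [Set.nonempty_iff_ne_empty]
    rintro rfl
    exact J₁.empty_notMem hA
  obtain ⟨a, ha⟩ := hne
  obtain ⟨B, hB, h⟩ := h A hA a ha
  exact ⟨B, hB, fun b hb => ⟨a, ha, h b hb⟩⟩

theorem IsMor.id (J : IndexSet.{u}) : IsMor J J (fun x => x) :=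
  fun A hA => ⟨A, hA, fun b hb => ⟨b, hb, fun α hα => ⟨α, hα, fun _ h => h⟩⟩⟩

theorem IsMor.comp {J₁ J₂ J₃ : IndexSet.{u}} {f : J₂.I → J₁.I} {g : J₃.I → J₂.I}
    (hf : IsMor J₁ J₂ f) (hg : IsMor J₂ J₃ g) : IsMor J₁ J₃ (fun x => f (g x)) := by
  intro A hA
  obtain ⟨B, hB, hf⟩ := hf A hA
  obtain ⟨C, hC, hg⟩ := hg B hB
  refine ⟨C, hC, fun c hc => ?_⟩
  obtain ⟨b, hb, hg⟩ := hg c hc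
  obtain ⟨a, ha, hf⟩ := hf b hb
  refine ⟨a, ha, fun α hα => ?_⟩
  obtain ⟨β, hβ, hf⟩ := hf α hα
  obtain ⟨γ, hγ, hg⟩ := hg β hβ
  exact ⟨γ, hγ, fun ε hε => hf _ (hg ε hε)⟩

theorem BigO.comp {J₁ J₂ : IndexSet.{u}} {f : J₂.I → J₁.I} (hf : IsMor J₁ J₂ f)
    {x y : J₁.I → ℝ} (h : J₁.BigO x y) : J₂.BigO (x ∘ f) (y ∘ f) := by
  obtain ⟨A, hA, h⟩ := h
  obtain ⟨B, hB, hf⟩ := hf A hA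
  refine ⟨B, hB, fun b hb => ?_⟩
  obtain ⟨a, ha, hf⟩ := hf b hb
  obtain ⟨H, hH, e, he, h⟩ := h a ha
  obtain ⟨d, hd, hf⟩ := hf e he
  exact ⟨H, hH, d, hd, fun ε hε => h _ (hf ε hε)⟩

theorem mem_moderateNets_of_mem {B : Set (J.I → ℝ)} {b : J.I → ℝ} (hb : b ∈ B) :
    b ∈ J.moderateNets B := ⟨b, hb, bigO_refl b⟩

end IndexSet

/-! ### The category of principal asymptotic gauges -/

/-- Pairs `(b, B)`, where `B` is a principal asymptotic gauge on some set of indices and `b ∈ B` is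
a generator of `B`. -/
structure PAG where
  J : IndexSet.{u}
  B : Set (J.I → ℝ)
  isAG : J.IsAG B
  b : J.I → ℝ
  mem : b ∈ B
  generates : J.moderateNets (J.powers b) = J.moderateNets B

namespace PAG

/-- Arrows `(b₁, B₁) → (b₂, B₂)`: morphisms `f` of asymptotic gauges, i.e. morphisms of sets of
indices with `ℝ_M(B₁ ∘ f) = ℝ_M(B₂)`, that preserve the generator. -/
@[ext]
structure Hom (X Y : PAG.{u}) where
  f : Y.J.I → X.J.I
  isMor : IndexSet.IsMor X.J Y.J f
  moderate : Y.J.moderateNets {x | ∃ c ∈ X.B, x = c ∘ f} = Y.J.moderateNets Y.B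
  generator : X.b ∘ f = Y.b

theorem comp_moderate {X Y Z : PAG.{u}} (f : Hom X Y) (g : Hom Y Z) :
    Z.J.moderateNets {x | ∃ c ∈ X.B, x = c ∘ fun e => f.f (g.f e)} = Z.J.moderateNets Z.B := by
  rw [← g.moderate]
  ext x
  constructor
  · rintro ⟨_, ⟨c, hc, rfl⟩, hx⟩
    have h : c ∘ f.f ∈ Y.J.moderateNets Y.B := by
      rw [← f.moderate]
      exact IndexSet.mem_moderateNets_of_mem ⟨c, hc, rfl⟩
    obtain ⟨d, hd, h⟩ := h
    exact ⟨d ∘ g.f, ⟨d, hd, rfl⟩, hx.trans (h.comp g.isMor)⟩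
  · rintro ⟨_, ⟨d, hd, rfl⟩, hx⟩
    have h : d ∈ Y.J.moderateNets {x | ∃ c ∈ X.B, x = c ∘ f.f} := by
      rw [f.moderate]
      exact IndexSet.mem_moderateNets_of_mem hd
    obtain ⟨_, ⟨c, hc, rfl⟩, h⟩ := h
    exact ⟨_, ⟨c, hc, rfl⟩, hx.trans (h.comp g.isMor)⟩

instance : Category PAG.{u} where
  Hom := Hom
  id X := ⟨fun e => e, IndexSet.IsMor.id _, by
    congr 1
    ext x
    exact ⟨fun ⟨c, hc, h⟩ => h ▸ hc, fun h => ⟨x, h, rfl⟩⟩, rfl⟩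
  comp {X Y Z} f g := ⟨fun e => f.f (g.f e), f.isMor.comp g.isMor, comp_moderate f g, by
    rw [← g.generator, ← f.generator]; rfl⟩

end PAG

/-! ### Multi-index derivatives and differential algebras -/

/-- `D^α = D_1^{α_1} ⋯ D_n^{α_n}`. -/
def multiDeriv {n : ℕ} {V : Type*} [AddCommGroup V] [Module ℝ V] (D : Fin n → Module.End ℝ V)
    (α : Fin n → ℕ) : Module.End ℝ V :=
  (List.ofFn fun i => D i ^ α i).prod

theorem multiDeriv_zero {n : ℕ} {V : Type*} [AddCommGroup V] [Module ℝ V]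
    (D : Fin n → Module.End ℝ V) : multiDeriv D 0 = 1 := by
  unfold multiDeriv
  apply List.prod_eq_one
  intro x hx
  simp only [Pi.zero_apply, pow_zero, List.mem_ofFn] at hx
  obtain ⟨_, rfl⟩ := hx
  rfl

theorem multiDeriv_add_single {n : ℕ} {V : Type*} [AddCommGroup V] [Module ℝ V]
    (D : Fin n → Module.End ℝ V) (hD : ∀ i j, Commute (D i) (D j)) (α : Fin n → ℕ) (i : Fin n) :
    multiDeriv D (α + Pi.single i 1) = multiDeriv D α * D i := by
  unfold multiDeriv
  rw [List.ofFn_eq_map, List.ofFn_eq_map]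
  have key : ∀ l : List (Fin n), l.Nodup →
      (i ∉ l → (l.map fun j => D j ^ ((α + Pi.single i 1 : Fin n → ℕ) j)).prod
        = (l.map fun j => D j ^ α j).prod) ∧
      (i ∈ l → (l.map fun j => D j ^ ((α + Pi.single i 1 : Fin n → ℕ) j)).prod
        = (l.map fun j => D j ^ α j).prod * D i) := by
    intro l
    induction l with
    | nil => simp
    | cons j l ih =>
      intro hl
      rw [List.nodup_cons] at hl
      obtain ⟨ih₁, ih₂⟩ := ih hl.2
      constructor
      · intro hi
        simp only [List.mem_cons, not_or] at hi
        simp only [List.map_cons, List.prod_cons]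
        rw [ih₁ hi.2]
        rw [Pi.add_apply, Pi.single_eq_of_ne (Ne.symm hi.1), add_zero]
      · intro hi
        simp only [List.map_cons, List.prod_cons]
        by_cases hij : i = j
        · subst hij
          rw [ih₁ hl.1]
          have hc : Commute (D i) (l.map fun j => D j ^ α j).prod := by
            apply Commute.list_prod_right
            intro x hx
            obtain ⟨k, -, rfl⟩ := List.mem_map.1 hx
            exact (hD i k).pow_right _
          simp only [Pi.add_apply, Pi.single_eq_same, pow_succ]
          rw [mul_assoc, hc.eq, mul_assoc]
        · rw [ih₂ (by simpa [hij] using hi), Pi.add_apply, Pi.single_eq_of_ne (Ne.symm hij),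
            add_zero, mul_assoc]
  exact (key _ (List.nodup_finRange n)).2 (List.mem_finRange i)

/-- Differential real algebras: commutative unital real algebras with `n` commuting derivations. -/
structure DAlg (n : ℕ) where
  carrier : Type u
  [ring : CommRing carrier]
  [algebra : Algebra ℝ carrier]
  D : Fin n → Derivation ℝ carrier carrier
  comm : ∀ i j a, D i (D j a) = D j (D i a)

namespace DAlg

variable {n : ℕ}

instance : CoeSort (DAlg.{u} n) (Type u) := ⟨carrier⟩
instance (A : DAlg.{u} n) : CommRing A := A.ring
instance (A : DAlg.{u} n) : Algebra ℝ A := A.algebra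

/-- The derivations as linear maps. -/
def der (A : DAlg.{u} n) (i : Fin n) : Module.End ℝ A := (A.D i).toLinearMap

/-- Morphisms of differential algebras. -/
@[ext]
structure Hom (A B : DAlg.{u} n) where
  φ : A →ₐ[ℝ] B
  map_D : ∀ i a, φ (A.D i a) = B.D i (φ a)

instance : Category (DAlg.{u} n) where
  Hom := Hom
  id A := ⟨AlgHom.id ℝ A, fun _ _ => rfl⟩
  comp f g := ⟨g.φ.comp f.φ, fun i a => by simp [f.map_D, g.map_D]⟩

end DAlg

/-! ### Smooth functions on open sets -/

/-- Euclidean space `ℝⁿ`. -/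
abbrev E (n : ℕ) : Type := EuclideanSpace ℝ (Fin n)

/-- The `i`-th standard basis vector. -/
def basisVec {n : ℕ} (i : Fin n) : E n := EuclideanSpace.single i 1

variable {n : ℕ}

/-- Extension by zero of a function on an open set. -/
def zeroExt {Ω : Opens (E n)} (f : Ω → ℝ) (x : E n) : ℝ :=
  open scoped Classical in if h : x ∈ Ω then f ⟨x, h⟩ else 0

theorem zeroExt_mem {Ω : Opens (E n)} (f : Ω → ℝ) (x : Ω) : zeroExt f x = f x := by
  simp [zeroExt]

/-- The algebra `C^∞(Ω)`. -/
def smoothAlgebra (Ω : Opens (E n)) : Subalgebra ℝ (Ω → ℝ) where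
  carrier := {f | ContDiffOn ℝ ∞ (zeroExt f) Ω}
  mul_mem' {f g} hf hg := (hf.mul hg).congr fun x hx => by
    simp [zeroExt, show x ∈ Ω from hx]
  add_mem' {f g} hf hg := (hf.add hg).congr fun x hx => by
    simp [zeroExt, show x ∈ Ω from hx]
  algebraMap_mem' r := (contDiffOn_const (c := r)).congr fun x hx => by
    simp [zeroExt, show x ∈ Ω from hx]

/-- `C^∞(Ω)` as a type. -/
def Smooth (Ω : Opens (E n)) : Type := ↥(smoothAlgebra Ω)

instance (Ω : Opens (E n)) : CommRing (Smooth Ω) := inferInstanceAs (CommRing ↥(smoothAlgebra Ω))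
instance (Ω : Opens (E n)) : Algebra ℝ (Smooth Ω) := inferInstanceAs (Algebra ℝ ↥(smoothAlgebra Ω))

theorem Smooth.ext {Ω : Opens (E n)} {f g : Smooth Ω} (h : ∀ x, f.1 x = g.1 x) : f = g :=
  Subtype.ext (funext h)

theorem Smooth.add_val {Ω : Opens (E n)} (f g : Smooth Ω) (x : Ω) :
    (f + g).1 x = f.1 x + g.1 x := rfl

theorem Smooth.mul_val {Ω : Opens (E n)} (f g : Smooth Ω) (x : Ω) :
    (f * g).1 x = f.1 x * g.1 x := rfl

theorem Smooth.smul_val {Ω : Opens (E n)} (c : ℝ) (f : Smooth Ω) (x : Ω) :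
    (c • f).1 x = c * f.1 x := rfl

theorem Smooth.zero_val {Ω : Opens (E n)} (x : Ω) : (0 : Smooth Ω).1 x = 0 := rfl

theorem zeroExt_contDiffOn {Ω : Opens (E n)} (f : Smooth Ω) :
    ContDiffOn ℝ ∞ (zeroExt f.1) Ω := f.2

theorem zeroExt_differentiableAt {Ω : Opens (E n)} (f : Smooth Ω) (x : Ω) :
    DifferentiableAt ℝ (zeroExt f.1) x :=
  (f.2.contDiffAt (Ω.isOpen.mem_nhds x.2)).differentiableAt (by simp)

theorem Smooth.continuous {Ω : Opens (E n)} (f : Smooth Ω) : Continuous f.1 := by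
  have h := continuousOn_iff_continuous_domRestrict.1 f.2.continuousOn
  refine h.congr fun x => ?_
  exact zeroExt_mem f.1 x

theorem pderiv_mem {Ω : Opens (E n)} (v : E n) (f : Smooth Ω) :
    (fun x : Ω => fderiv ℝ (zeroExt f.1) x v) ∈ smoothAlgebra Ω := by
  have h := (zeroExt_contDiffOn f).fderiv_of_isOpen (m := ∞) Ω.isOpen (by simp)
  refine (h.clm_apply (contDiffOn_const (c := v))).congr fun x hx => ?_
  simp [zeroExt, show x ∈ Ω from hx]

theorem zeroExt_eventuallyEq {Ω : Opens (E n)} {f : Ω → ℝ} {g : E n → ℝ}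
    (h : ∀ y : Ω, f y = g y) (x : Ω) : zeroExt f =ᶠ[𝓝 (x : E n)] g :=
  Filter.eventually_of_mem (Ω.isOpen.mem_nhds x.2) fun y hy => by
    rw [← h ⟨y, hy⟩]; exact zeroExt_mem f ⟨y, hy⟩

/-- The partial derivative `∂_i` on `C^∞(Ω)`. -/
def pderiv {Ω : Opens (E n)} (i : Fin n) : Derivation ℝ (Smooth Ω) (Smooth Ω) :=
  Derivation.mk'
    { toFun := fun f => ⟨fun x : Ω => fderiv ℝ (zeroExt f.1) x (basisVec i), pderiv_mem _ f⟩
      map_add' := fun f g => by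
        refine Smooth.ext fun x => ?_
        have h : zeroExt (f + g).1 =ᶠ[𝓝 (x : E n)] zeroExt f.1 + zeroExt g.1 :=
          zeroExt_eventuallyEq (fun y => by simp [zeroExt_mem, Smooth.add_val]) x
        change fderiv ℝ _ _ _ = _
        rw [h.fderiv_eq, fderiv_add (zeroExt_differentiableAt f x) (zeroExt_differentiableAt g x)]
        rfl
      map_smul' := fun c f => by
        refine Smooth.ext fun x => ?_
        have h : zeroExt (c • f).1 =ᶠ[𝓝 (x : E n)] c • zeroExt f.1 :=
          zeroExt_eventuallyEq (fun y => by simp [zeroExt_mem, Smooth.smul_val]) x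
        change fderiv ℝ _ _ _ = _
        rw [h.fderiv_eq, fderiv_const_smul (zeroExt_differentiableAt f x)]
        rfl }
    (fun f g => by
      refine Smooth.ext fun x => ?_
      have h : zeroExt (f * g).1 =ᶠ[𝓝 (x : E n)] zeroExt f.1 * zeroExt g.1 :=
        zeroExt_eventuallyEq (fun y => by simp [zeroExt_mem, Smooth.mul_val]) x
      change fderiv ℝ (zeroExt (f * g).1) x (basisVec i) =
        f.1 x * fderiv ℝ (zeroExt g.1) x (basisVec i) +
        g.1 x * fderiv ℝ (zeroExt f.1) x (basisVec i)
      rw [h.fderiv_eq, fderiv_mul (zeroExt_differentiableAt f x) (zeroExt_differentiableAt g x)]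
      simp [zeroExt_mem])

theorem pderiv_apply {Ω : Opens (E n)} (i : Fin n) (f : Smooth Ω) (x : Ω) :
    (pderiv i f).1 x = fderiv ℝ (zeroExt f.1) x (basisVec i) := rfl

theorem pderiv_comm {Ω : Opens (E n)} (i j : Fin n) (f : Smooth Ω) :
    pderiv i (pderiv j f) = pderiv j (pderiv i f) := by
  have key : ∀ (i j : Fin n) (x : Ω), (pderiv i (pderiv j f)).1 x =
      fderiv ℝ (fderiv ℝ (zeroExt f.1)) x (basisVec i) (basisVec j) := by
    intro i j x
    rw [pderiv_apply]
    have h : zeroExt (pderiv j f).1 =ᶠ[𝓝 (x : E n)]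
        fun y => fderiv ℝ (zeroExt f.1) y (basisVec j) :=
      zeroExt_eventuallyEq (fun y => pderiv_apply j f y) x
    have hd : DifferentiableAt ℝ (fderiv ℝ (zeroExt f.1)) x :=
      (((zeroExt_contDiffOn f).fderiv_of_isOpen (m := ∞) Ω.isOpen (by simp)).contDiffAt
        (Ω.isOpen.mem_nhds x.2)).differentiableAt (by simp)
    rw [h.fderiv_eq, fderiv_clm_apply hd (differentiableAt_const _)]
    simp
  refine Smooth.ext fun x => ?_
  rw [key, key]
  have hs : IsSymmSndFDerivAt ℝ (zeroExt f.1) x :=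
    ((zeroExt_contDiffOn f).contDiffAt (Ω.isOpen.mem_nhds x.2)).isSymmSndFDerivAt
      (by rw [minSmoothness_of_isRCLikeNormedField]; exact WithTop.coe_le_coe.2 (le_top : (2 : ℕ∞) ≤ ⊤))
  exact hs _ _

/-- Restriction `C^∞(Ω) → C^∞(Ω')` for `Ω' ⊆ Ω`. -/
def resSmooth {Ω Ω' : Opens (E n)} (h : Ω' ≤ Ω) : Smooth Ω →ₐ[ℝ] Smooth Ω' where
  toFun f := ⟨fun x => f.1 ⟨x, h x.2⟩, (f.2.mono h).congr fun x hx => by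
    simp [zeroExt, show x ∈ Ω' from hx, show x ∈ Ω from h hx]⟩
  map_one' := rfl
  map_mul' _ _ := rfl
  map_zero' := rfl
  map_add' _ _ := rfl
  commutes' _ := rfl

theorem resSmooth_pderiv {Ω Ω' : Opens (E n)} (h : Ω' ≤ Ω) (i : Fin n) (f : Smooth Ω) :
    resSmooth h (pderiv i f) = pderiv i (resSmooth h f) := by
  refine Smooth.ext fun x => ?_
  have h : zeroExt (resSmooth h f).1 =ᶠ[𝓝 (x : E n)] zeroExt f.1 :=
    zeroExt_eventuallyEq (fun y => (zeroExt_mem f.1 ⟨y, h y.2⟩).symm) x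
  rw [pderiv_apply, h.fderiv_eq]
  rfl

/-- `∂^α` on `C^∞(Ω)`. -/
def partialD {Ω : Opens (E n)} (α : Fin n → ℕ) : Module.End ℝ (Smooth Ω) :=
  multiDeriv (fun i => (pderiv i).toLinearMap) α

theorem partialD_zero {Ω : Opens (E n)} (f : Smooth Ω) : partialD 0 f = f := by
  simp [partialD, multiDeriv_zero]

theorem partialD_add_single {Ω : Opens (E n)} (α : Fin n → ℕ) (i : Fin n) (f : Smooth Ω) :
    partialD (α + Pi.single i 1) f = partialD α (pderiv i f) := by
  unfold partialD
  rw [multiDeriv_add_single]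
  · rfl
  · intro i j
    ext1 f
    exact pderiv_comm i j f

theorem multiIndex_induction {P : (Fin n → ℕ) → Prop} (h0 : P 0)
    (hs : ∀ α i, P α → P (α + Pi.single i 1)) (α : Fin n → ℕ) : P α := by
  induction hm : ∑ i, α i generalizing α with
  | zero =>
    have : α = 0 := by
      ext i
      exact (Finset.sum_eq_zero_iff.1 hm) i (Finset.mem_univ i)
    exact this ▸ h0
  | succ m ih =>
    obtain ⟨i, hi⟩ : ∃ i, α i ≠ 0 := by
      by_contra! hc
      simp [hc] at hm
    have hle : Pi.single i 1 ≤ α := by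
      intro j
      by_cases hj : j = i
      · subst hj; simpa using Nat.one_le_iff_ne_zero.2 hi
      · simp [Pi.single_eq_of_ne hj]
    have hα : α - Pi.single i 1 + Pi.single i 1 = α := tsub_add_cancel_of_le hle
    rw [← hα]
    apply hs
    apply ih
    have : ∑ j, (α - Pi.single i 1 + Pi.single i 1 : Fin n → ℕ) j = m + 1 := by rw [hα]; exact hm
    simp only [Pi.add_apply, Finset.sum_add_distrib] at this
    simpa using this

theorem resSmooth_partialD {Ω Ω' : Opens (E n)} (h : Ω' ≤ Ω) (α : Fin n → ℕ) (f : Smooth Ω) :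
    resSmooth h (partialD α f) = partialD α (resSmooth h f) := by
  induction α using multiIndex_induction generalizing f with
  | h0 => simp [partialD_zero]
  | hs α i ih => rw [partialD_add_single, partialD_add_single, ih, resSmooth_pderiv]

/-- `sup_{x ∈ K} |f x|`. -/
def supOn {Ω : Opens (E n)} (K : Set Ω) (f : Smooth Ω) : ℝ := ⨆ x : K, |f.1 x|

section supOn

variable {Ω : Opens (E n)} {K : Set Ω}

theorem supOn_nonneg (f : Smooth Ω) : 0 ≤ supOn K f := Real.iSup_nonneg fun _ => abs_nonneg _

theorem supOn_bdd (hK : IsCompact K) (f : Smooth Ω) : BddAbove (Set.range fun x : K => |f.1 x|) := by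
  have h := hK.bddAbove_image (f := fun x => |f.1 x|) f.continuous.abs.continuousOn
  rwa [Set.image_eq_range] at h

theorem le_supOn (hK : IsCompact K) (f : Smooth Ω) {x : Ω} (hx : x ∈ K) : |f.1 x| ≤ supOn K f :=
  le_ciSup (supOn_bdd hK f) ⟨x, hx⟩

theorem supOn_le {f : Smooth Ω} {C : ℝ} (hC : 0 ≤ C) (h : ∀ x ∈ K, |f.1 x| ≤ C) : supOn K f ≤ C :=
  Real.iSup_le (fun x => h x x.2) hC

theorem supOn_add (hK : IsCompact K) (f g : Smooth Ω) :
    supOn K (f + g) ≤ supOn K f + supOn K g :=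
  supOn_le (add_nonneg (supOn_nonneg f) (supOn_nonneg g)) fun _ hx =>
    (abs_add_le _ _).trans (add_le_add (le_supOn hK f hx) (le_supOn hK g hx))

theorem supOn_mul (hK : IsCompact K) (f g : Smooth Ω) :
    supOn K (f * g) ≤ supOn K f * supOn K g :=
  supOn_le (mul_nonneg (supOn_nonneg f) (supOn_nonneg g)) fun x hx => by
    rw [show (f * g).1 x = f.1 x * g.1 x from rfl, abs_mul]
    exact mul_le_mul (le_supOn hK f hx) (le_supOn hK g hx) (abs_nonneg _) (supOn_nonneg f)

theorem supOn_zero : supOn K (0 : Smooth Ω) = 0 :=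
  le_antisymm (supOn_le le_rfl fun x _ => by rw [Smooth.zero_val, abs_zero]) (supOn_nonneg _)

end supOn

/-! ### Moderate and negligible nets, Colombeau algebras -/

section Nets

variable {J : IndexSet.{u}} (B : Set (J.I → ℝ)) (Ω : Opens (E n))

/-- `u ∈ C^∞(Ω)^I` is `B`-moderate. -/
def IsModerate (u : J.I → Smooth Ω) : Prop :=
  ∀ K : Set Ω, IsCompact K → ∀ α : Fin n → ℕ,
    ∃ b ∈ B, J.BigO (fun ε => supOn K (partialD α (u ε))) b

/-- `u ∈ C^∞(Ω)^I` is `B`-negligible. -/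
def IsNegligible (u : J.I → Smooth Ω) : Prop :=
  ∀ K : Set Ω, IsCompact K → ∀ α : Fin n → ℕ, ∀ z ∈ B, J.Pos z →
    J.BigO (fun ε => supOn K (partialD α (u ε))) (fun ε => (z ε)⁻¹)

variable {B Ω}

theorem IsModerate.deriv {u : J.I → Smooth Ω} (h : IsModerate B Ω u) (i : Fin n) :
    IsModerate B Ω fun ε => pderiv i (u ε) := fun K hK α => by
  have h' := h K hK (α + Pi.single i 1)
  simp only [partialD_add_single] at h'
  exact h'

theorem IsNegligible.deriv {u : J.I → Smooth Ω} (h : IsNegligible B Ω u) (i : Fin n) :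
    IsNegligible B Ω fun ε => pderiv i (u ε) := fun K hK α z hz hz' => by
  have h' := h K hK (α + Pi.single i 1) z hz hz'
  simp only [partialD_add_single] at h'
  exact h'

theorem bigO_add_of_isAG (hB : J.IsAG B) {K : Set Ω} (hK : IsCompact K) {u v : J.I → Smooth Ω}
    (hu : ∃ b ∈ B, J.BigO (fun ε => supOn K (u ε)) b)
    (hv : ∃ b ∈ B, J.BigO (fun ε => supOn K (v ε)) b) :
    ∃ b ∈ B, J.BigO (fun ε => supOn K (u ε + v ε)) b := by
  obtain ⟨b, hb, hu⟩ := hu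
  obtain ⟨c, hc, hv⟩ := hv
  obtain ⟨s, hs, -, h⟩ := hB.add b hb c hc
  refine ⟨s, hs, IndexSet.BigO.trans (y := |b| + |c|) ?_ h⟩
  refine hu.loc.and hv.loc fun H₁ H₂ p₁ p₂ => ⟨H₁ + H₂, add_pos p₁ p₂, fun ε h₁ h₂ => ?_⟩
  rw [abs_of_nonneg (supOn_nonneg _)] at h₁ h₂ ⊢
  have e : |(|b| + |c|) ε| = |b ε| + |c ε| :=
    abs_of_nonneg (add_nonneg (abs_nonneg (b ε)) (abs_nonneg (c ε)))
  rw [e]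
  have := supOn_add hK (u ε) (v ε)
  nlinarith [abs_nonneg (b ε), abs_nonneg (c ε)]

theorem bigO_add {K : Set Ω} (hK : IsCompact K) {u v : J.I → Smooth Ω} {y : J.I → ℝ}
    (hu : J.BigO (fun ε => supOn K (u ε)) y) (hv : J.BigO (fun ε => supOn K (v ε)) y) :
    J.BigO (fun ε => supOn K (u ε + v ε)) y := by
  refine hu.loc.and hv.loc fun H₁ H₂ p₁ p₂ => ⟨H₁ + H₂, add_pos p₁ p₂, fun ε h₁ h₂ => ?_⟩
  rw [abs_of_nonneg (supOn_nonneg _)] at h₁ h₂ ⊢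
  have := supOn_add hK (u ε) (v ε)
  linarith [add_mul H₁ H₂ |y ε|]

theorem IsModerate.add (hB : J.IsAG B) {u v : J.I → Smooth Ω} (hu : IsModerate B Ω u)
    (hv : IsModerate B Ω v) : IsModerate B Ω (u + v) := fun K hK α => by
  simpa only [Pi.add_apply, map_add] using bigO_add_of_isAG hB hK (hu K hK α) (hv K hK α)

theorem IsNegligible.add {u v : J.I → Smooth Ω} (hu : IsNegligible B Ω u)
    (hv : IsNegligible B Ω v) : IsNegligible B Ω (u + v) := fun K hK α z hz hz' => by
  simpa only [Pi.add_apply, map_add] using bigO_add hK (hu K hK α z hz hz') (hv K hK α z hz hz')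

theorem IsModerate.mul (hB : J.IsAG B) {u v : J.I → Smooth Ω} (hu : IsModerate B Ω u)
    (hv : IsModerate B Ω v) : IsModerate B Ω (u * v) := fun K hK α => by
  induction α using multiIndex_induction generalizing u v with
  | h0 =>
    obtain ⟨b, hb, hu⟩ := hu K hK 0
    obtain ⟨c, hc, hv⟩ := hv K hK 0
    obtain ⟨p, hp, h⟩ := hB.mul b hb c hc
    refine ⟨p, hp, IndexSet.BigO.trans (y := b * c) ?_ h⟩
    refine hu.loc.and hv.loc fun H₁ H₂ p₁ p₂ => ⟨H₁ * H₂, mul_pos p₁ p₂, fun ε h₁ h₂ => ?_⟩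
    simp only [partialD_zero] at h₁ h₂ ⊢
    rw [abs_of_nonneg (supOn_nonneg _)] at h₁ h₂ ⊢
    rw [Pi.mul_apply, Pi.mul_apply, abs_mul]
    calc _ ≤ supOn K (u ε) * supOn K (v ε) := supOn_mul hK _ _
      _ ≤ (H₁ * |b ε|) * (H₂ * |c ε|) := mul_le_mul h₁ h₂ (supOn_nonneg _) (by positivity)
      _ = _ := by ring
  | hs α i ih =>
    have h := bigO_add_of_isAG hB hK (ih hu (hv.deriv i)) (ih hv (hu.deriv i))
    simpa only [partialD_add_single, Pi.mul_apply, Derivation.leibniz, smul_eq_mul, map_add] using h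

theorem IsNegligible.mul (hB : J.IsAG B) {u v : J.I → Smooth Ω} (hu : IsModerate B Ω u)
    (hv : IsNegligible B Ω v) : IsNegligible B Ω (u * v) := fun K hK α z hz hz' => by
  induction α using multiIndex_induction generalizing u v with
  | h0 =>
    obtain ⟨b, hb, hu⟩ := hu K hK 0
    obtain ⟨p, hp, hbz⟩ := hB.mul b hb z hz
    obtain ⟨s, hs, hs', hps⟩ := hB.add p hp p hp
    have hps' : J.BigO p s := IndexSet.BigO.of_le (fun ε => by
      rw [Pi.add_apply, Pi.abs_apply]
      exact (le_add_of_nonneg_left (abs_nonneg _)).trans (le_abs_self _)) hps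
    have hbs := hbz.trans hps'
    have hv := hv K hK 0 s hs hs'
    have h₁ : IndexSet.Loc (J := J) fun H ε =>
        supOn K (u ε) * |z ε| ≤ H * |s ε| := by
      refine hu.loc.and hbs.loc fun H₁ H₂ p₁ p₂ => ⟨H₁ * H₂, mul_pos p₁ p₂, fun ε h₁ h₂ => ?_⟩
      simp only [partialD_zero] at h₁
      rw [abs_of_nonneg (supOn_nonneg _)] at h₁
      rw [Pi.mul_apply, abs_mul] at h₂
      calc supOn K (u ε) * |z ε| ≤ (H₁ * |b ε|) * |z ε| := by gcongr
        _ = H₁ * (|b ε| * |z ε|) := by ring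
        _ ≤ H₁ * (H₂ * |s ε|) := by gcongr
        _ = _ := by ring
    have h₂ : IndexSet.Loc (J := J) fun H ε => supOn K (v ε) * |s ε| ≤ H := by
      refine hv.loc.mono fun H hH => ⟨H, hH, fun ε h => ?_⟩
      simp only [partialD_zero] at h
      rw [abs_of_nonneg (supOn_nonneg _), abs_inv] at h
      by_cases hs0 : |s ε| = 0
      · rw [hs0, mul_zero]; exact hH.le
      · have hpos : 0 < |s ε| := lt_of_le_of_ne (abs_nonneg _) (Ne.symm hs0)
        calc _ ≤ H * |s ε|⁻¹ * |s ε| := by gcongr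
          _ = H := by field_simp
    have h₃ : IndexSet.Loc (J := J) fun H ε =>
        supOn K (u ε) * |z ε| ≤ H * |s ε| ∧ 0 < |s ε| ∧ 0 < |z ε| := by
      have h₀ := hs'.loc.and hz'.loc (R := fun _ ε => 0 < |s ε| ∧ 0 < |z ε|)
        fun _ _ _ _ => ⟨1, one_pos, fun ε h h' => ⟨abs_pos.2 h.ne', abs_pos.2 h'.ne'⟩⟩
      exact h₁.and h₀ fun H _ hH _ => ⟨H, hH, fun ε h h' => ⟨h, h'⟩⟩
    refine h₃.and h₂ fun H₁ H₂ p₁ p₂ => ⟨H₁ * H₂, mul_pos p₁ p₂, fun ε h₁ h₂ => ?_⟩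
    obtain ⟨h₁, hs0, hz0⟩ := h₁
    simp only [partialD_zero]
    rw [abs_of_nonneg (supOn_nonneg _), Pi.mul_apply, abs_inv, ← div_eq_mul_inv, le_div_iff₀ hz0]
    have hU := supOn_nonneg (K := K) (u ε)
    have hV := supOn_nonneg (K := K) (v ε)
    calc supOn K (u ε * v ε) * |z ε| ≤ supOn K (u ε) * supOn K (v ε) * |z ε| := by
          gcongr; exact supOn_mul hK _ _
      _ = (supOn K (u ε) * |z ε|) * supOn K (v ε) := by ring
      _ ≤ (H₁ * |s ε|) * supOn K (v ε) := by gcongr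
      _ = H₁ * (supOn K (v ε) * |s ε|) := by ring
      _ ≤ H₁ * H₂ := by gcongr
  | hs α i ih =>
    have h := bigO_add hK (ih hu (hv.deriv i)) (ih (hu.deriv i) hv)
    have e : ∀ ε, partialD (α + Pi.single i 1) ((u * v) ε) =
        partialD α ((u * fun ε => Colombeau.pderiv i (v ε)) ε) +
          partialD α (((fun ε => Colombeau.pderiv i (u ε)) * v) ε) := fun ε => by
      simp only [partialD_add_single, Pi.mul_apply, Derivation.leibniz, smul_eq_mul, map_add,
        mul_comm (v ε)]
    simpa only [e] using h

/-- A net which does not depend on the index is moderate. -/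
theorem isModerate_const (hB : J.IsAG B) (f : Smooth Ω) : IsModerate B Ω fun _ => f := by
  intro K hK α
  obtain ⟨i, hi, A, hA, h⟩ := hB.infinite
  refine ⟨i, hi, A, hA, fun a ha => ?_⟩
  obtain ⟨e, he, h⟩ := h a ha 1
  refine ⟨supOn K (partialD α f) + 1, by linarith [supOn_nonneg (K := K) (partialD α f)], e, he,
    fun ε hε => ?_⟩
  have h1 := h ε hε
  rw [abs_of_nonneg (supOn_nonneg _), abs_of_pos (by linarith)]
  nlinarith [supOn_nonneg (K := K) (partialD α f)]

theorem isNegligible_zero : IsNegligible B Ω (0 : J.I → Smooth Ω) := fun K _ α z _ _ =>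
  IndexSet.Loc.of_forall
    (P := fun H ε => |supOn K (partialD α ((0 : J.I → Smooth Ω) ε))| ≤ H * |(z ε)⁻¹|) 1 one_pos
    fun ε => by simp [supOn_zero]

theorem IsModerate.res {Ω' : Opens (E n)} (h : Ω' ≤ Ω) {u : J.I → Smooth Ω}
    (hu : IsModerate B Ω u) : IsModerate B Ω' fun ε => resSmooth h (u ε) := by
  intro K hK α
  have hK' : IsCompact (Set.inclusion h '' K) := hK.image (continuous_inclusion h)
  obtain ⟨b, hb, hu⟩ := hu _ hK' α
  refine ⟨b, hb, IndexSet.BigO.of_le (fun ε => ?_) hu⟩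
  rw [abs_of_nonneg (supOn_nonneg _), abs_of_nonneg (supOn_nonneg _), ← resSmooth_partialD]
  exact supOn_le (supOn_nonneg _) fun x hx => le_supOn hK' _ (Set.mem_image_of_mem _ hx)

theorem IsNegligible.res {Ω' : Opens (E n)} (h : Ω' ≤ Ω) {u : J.I → Smooth Ω}
    (hu : IsNegligible B Ω u) : IsNegligible B Ω' fun ε => resSmooth h (u ε) := by
  intro K hK α z hz hz'
  have hK' : IsCompact (Set.inclusion h '' K) := hK.image (continuous_inclusion h)
  refine IndexSet.BigO.of_le (fun ε => ?_) (hu _ hK' α z hz hz')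
  rw [abs_of_nonneg (supOn_nonneg _), abs_of_nonneg (supOn_nonneg _), ← resSmooth_partialD]
  exact supOn_le (supOn_nonneg _) fun x hx => le_supOn hK' _ (Set.mem_image_of_mem _ hx)

end Nets

variable (X : PAG.{u}) (Ω : Opens (E n))

/-- The algebra `𝓔_M(B, Ω)` of moderate nets. -/
def EM : Subalgebra ℝ (X.J.I → Smooth Ω) where
  carrier := {u | IsModerate X.B Ω u}
  mul_mem' hu hv := hu.mul X.isAG hv
  add_mem' hu hv := hu.add X.isAG hv
  algebraMap_mem' r := isModerate_const X.isAG (algebraMap ℝ (Smooth Ω) r)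

/-- `𝓔_M(B, Ω)` as a type. -/
def Moderate : Type u := ↥(EM X Ω)

instance : CommRing (Moderate X Ω) := inferInstanceAs (CommRing ↥(EM X Ω))
instance : Algebra ℝ (Moderate X Ω) := inferInstanceAs (Algebra ℝ ↥(EM X Ω))

/-- The ideal `𝓝(B, Ω)` of negligible nets. -/
def negl : Ideal (Moderate X Ω) where
  carrier := {u | IsNegligible X.B Ω u.1}
  add_mem' hu hv := IsNegligible.add hu hv
  zero_mem' := isNegligible_zero
  smul_mem' u _ hv := IsNegligible.mul X.isAG u.2 hv

/-- The Colombeau algebra `𝓖(B, Ω) = 𝓔_M(B, Ω) / 𝓝(B, Ω)`. -/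
def GAlg : Type u := Moderate X Ω ⧸ negl X Ω

instance : CommRing (GAlg X Ω) := inferInstanceAs (CommRing (Moderate X Ω ⧸ negl X Ω))
instance : Algebra ℝ (GAlg X Ω) := inferInstanceAs (Algebra ℝ (Moderate X Ω ⧸ negl X Ω))

variable {X Ω}

/-- The class `[u_ε]` of a moderate net. -/
def cls (u : X.J.I → Smooth Ω) (hu : IsModerate X.B Ω u) : GAlg X Ω :=
  Ideal.Quotient.mk (negl X Ω) ⟨u, hu⟩

theorem cls_surjective (U : GAlg X Ω) : ∃ u hu, cls u hu = U := by
  obtain ⟨u, rfl⟩ := Ideal.Quotient.mk_surjective U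
  exact ⟨u.1, u.2, rfl⟩

theorem cls_eq {u v : X.J.I → Smooth Ω} {hu : IsModerate X.B Ω u} {hv : IsModerate X.B Ω v} :
    cls u hu = cls v hv ↔ IsNegligible X.B Ω (u - v) := Ideal.Quotient.eq

/-- The map `[u_ε] ↦ [∂_i u_ε]` of `𝓖(B, Ω)`. -/
def derivFun (i : Fin n) (U : GAlg X Ω) : GAlg X Ω :=
  Quotient.liftOn' U (fun u => cls (fun ε => pderiv i (u.1 ε)) (u.2.deriv i)) fun u v h => by
    rw [cls_eq]
    have h' : IsNegligible X.B Ω (u.1 - v.1) :=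
      (Ideal.Quotient.eq (I := negl X Ω)).1 (Quotient.sound' h)
    have e : (fun ε => pderiv i (u.1 ε)) - (fun ε => pderiv i (v.1 ε)) =
        fun ε => pderiv i ((u.1 - v.1) ε) :=
      funext fun ε => (map_sub (pderiv i) (u.1 ε) (v.1 ε)).symm
    rw [e]
    exact h'.deriv i

theorem derivFun_cls (i : Fin n) (u : X.J.I → Smooth Ω) (hu : IsModerate X.B Ω u) :
    derivFun i (cls u hu) = cls (fun ε => pderiv i (u ε)) (hu.deriv i) := rfl

theorem cls_add {u v : X.J.I → Smooth Ω} (hu : IsModerate X.B Ω u) (hv : IsModerate X.B Ω v) :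
    cls u hu + cls v hv = cls (u + v) (hu.add X.isAG hv) := rfl

theorem cls_mul {u v : X.J.I → Smooth Ω} (hu : IsModerate X.B Ω u) (hv : IsModerate X.B Ω v) :
    cls u hu * cls v hv = cls (u * v) (hu.mul X.isAG hv) := rfl

theorem cls_smul (c : ℝ) {u : X.J.I → Smooth Ω} (hu : IsModerate X.B Ω u) :
    c • cls u hu = cls (c • u) ((EM X Ω).smul_mem hu c) := rfl

theorem cls_congr {u v : X.J.I → Smooth Ω} {hu : IsModerate X.B Ω u} {hv : IsModerate X.B Ω v}
    (h : ∀ ε, u ε = v ε) : cls u hu = cls v hv := by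
  obtain rfl : u = v := funext h
  rfl

/-- The derivation `[u_ε] ↦ [∂_i u_ε]` of `𝓖(B, Ω)`. -/
def derivG (i : Fin n) : Derivation ℝ (GAlg X Ω) (GAlg X Ω) :=
  Derivation.mk'
    { toFun := derivFun i
      map_add' := fun U V => by
        obtain ⟨u, hu, rfl⟩ := cls_surjective U
        obtain ⟨v, hv, rfl⟩ := cls_surjective V
        simp only [cls_add, derivFun_cls]
        exact cls_congr fun ε => map_add (pderiv i) (u ε) (v ε)
      map_smul' := fun c U => by
        obtain ⟨u, hu, rfl⟩ := cls_surjective U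
        simp only [cls_smul, derivFun_cls, RingHom.id_apply]
        exact cls_congr fun ε => (pderiv i).map_smul c (u ε) }
    (fun U V => by
      obtain ⟨u, hu, rfl⟩ := cls_surjective U
      obtain ⟨v, hv, rfl⟩ := cls_surjective V
      change derivFun i (cls u hu * cls v hv) =
        cls u hu * derivFun i (cls v hv) + cls v hv * derivFun i (cls u hu)
      simp only [cls_mul, derivFun_cls, cls_add]
      exact cls_congr fun ε => (pderiv i).leibniz (u ε) (v ε))

theorem derivG_cls (i : Fin n) (u : X.J.I → Smooth Ω) (hu : IsModerate X.B Ω u) :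
    derivG i (cls u hu) = cls (fun ε => pderiv i (u ε)) (hu.deriv i) := rfl

variable (X)

/-- The restriction `[u_ε] ↦ [u_ε|_{Ω'}]`. -/
def resG {Ω Ω' : Opens (E n)} (h : Ω' ≤ Ω) : GAlg X Ω →ₐ[ℝ] GAlg X Ω' :=
  Ideal.quotientMapₐ (negl X Ω')
    { toFun := fun u : Moderate X Ω => (⟨fun ε => resSmooth h (u.1 ε), u.2.res h⟩ : Moderate X Ω')
      map_one' := rfl
      map_mul' := fun _ _ => rfl
      map_zero' := rfl
      map_add' := fun _ _ => rfl
      commutes' := fun _ => rfl }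
    (fun u (hu : IsNegligible X.B Ω u.1) => hu.res h)

theorem resG_cls {Ω Ω' : Opens (E n)} (h : Ω' ≤ Ω) (u : X.J.I → Smooth Ω)
    (hu : IsModerate X.B Ω u) :
    resG X h (cls u hu) = cls (fun ε => resSmooth h (u ε)) (hu.res h) := rfl

/-- The differential algebra `(𝓖(B, Ω), ∂)`. -/
def colombeauDAlg (Ω : Opens (E n)) : DAlg.{u} n where
  carrier := GAlg X Ω
  D := derivG
  comm i j U := by
    obtain ⟨u, hu, rfl⟩ := cls_surjective U
    simp only [derivG_cls, pderiv_comm i j]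

/-- Restriction as a morphism of differential algebras. -/
def resDAlg {Ω Ω' : Opens (E n)} (h : Ω' ≤ Ω) :
    DAlg.Hom (colombeauDAlg X Ω) (colombeauDAlg X Ω') where
  φ := resG X h
  map_D i U := by
    obtain ⟨u, hu, rfl⟩ := cls_surjective (X := X) (Ω := Ω) U
    change resG X h (derivG i (cls u hu)) = derivG i (resG X h (cls u hu))
    simp only [derivG_cls, resG_cls, resSmooth_pderiv]

/-- The presheaf of differential algebras `(𝓖(B, -), ∂)`. -/
def colombeauPresheaf (n : ℕ) : (Opens (E n))ᵒᵖ ⥤ DAlg.{u} n where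
  obj Ω := colombeauDAlg X Ω.unop
  map h := resDAlg X h.unop.le
  map_id Ω := by
    refine DAlg.Hom.ext (AlgHom.ext fun U => ?_)
    obtain ⟨u, hu, rfl⟩ := cls_surjective (X := X) (Ω := Ω.unop) U
    rfl
  map_comp {Ω _ _} f g := by
    refine DAlg.Hom.ext (AlgHom.ext fun U => ?_)
    obtain ⟨u, hu, rfl⟩ := cls_surjective (X := X) (Ω := Ω.unop) U
    rfl

/-- The embedding `f ↦ [f]` of `C^∞(Ω)` as constant nets. -/
def constEmb (Ω : Opens (E n)) : Smooth Ω →ₐ[ℝ] (colombeauPresheaf X n).obj (op Ω) where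
  toFun f := cls (fun _ => f) (isModerate_const X.isAG f)
  map_one' := rfl
  map_mul' _ _ := rfl
  map_zero' := rfl
  map_add' _ _ := rfl
  commutes' _ := rfl

/-! ### Distributions -/

/-- The distribution `φ ↦ ∫ φ f` defined by a smooth function. -/
def toDistr {Ω : Opens (E n)} (f : Smooth Ω) : 𝓓'(Ω, ℝ) :=
  TestFunction.integralAgainstBilinCLM (ContinuousLinearMap.mul ℝ ℝ) volume (zeroExt f.1)

theorem toDistr_apply {Ω : Opens (E n)} (f : Smooth Ω) (φ : 𝓓(Ω, ℝ)) :
    toDistr f φ = ∫ x, φ x * zeroExt f.1 x :=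
  TestFunction.integralAgainstBilinCLM_eq_integral (B := ContinuousLinearMap.mul ℝ ℝ)
    (f.2.continuousOn.locallyIntegrableOn Ω.isOpen.measurableSet)

/-- Restriction of distributions to a smaller open set. -/
def resDistr {Ω Ω' : Opens (E n)} (_ : Ω' ≤ Ω) : 𝓓'(Ω, ℝ) →ₗ[ℝ] 𝓓'(Ω', ℝ) :=
  ((TestFunction.monoCLM ℝ : 𝓓(Ω', ℝ) →L[ℝ] 𝓓(Ω, ℝ)).precompCompactConvergenceCLM
    ℝ).toLinearMap

theorem resDistr_apply {Ω Ω' : Opens (E n)} (h : Ω' ≤ Ω) (T : 𝓓'(Ω, ℝ)) (φ : 𝓓(Ω', ℝ)) :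
    resDistr h T φ = T ⟨φ, φ.contDiff, φ.hasCompactSupport, φ.tsupport_subset.trans h⟩ := by
  change T (TestFunction.monoCLM ℝ φ) = _
  congr 1
  ext x
  simp [h]

/-- The `i`-th partial derivative of distributions. -/
def derivDistr {Ω : Opens (E n)} (i : Fin n) : Module.End ℝ 𝓓'(Ω, ℝ) :=
  (Distribution.lineDerivCLM (basisVec i) : 𝓓'(Ω, ℝ) →L[ℝ] 𝓓'(Ω, ℝ)).toLinearMap

/-! ### The category `Col_n` -/

/-- The conditions on a presheaf `G` of differential algebras with inclusions
`incl : C^∞(Ω) → G(Ω)` and a family `i : 𝓓'(Ω) → G(Ω)` to be an object of `Col_n`. -/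
structure IsCol (G : (Opens (E n))ᵒᵖ ⥤ DAlg.{u} n)
    (incl : ∀ Ω : Opens (E n), Smooth Ω →ₐ[ℝ] G.obj (op Ω))
    (i : ∀ Ω : Opens (E n), 𝓓'(Ω, ℝ) →ₗ[ℝ] G.obj (op Ω)) : Prop where
  natural : ∀ (Ω Ω' : Opens (E n)) (h : Ω' ≤ Ω) (T : 𝓓'(Ω, ℝ)),
    (G.map (homOfLE h).op).φ (i Ω T) = i Ω' (resDistr h T)
  ker_eq_bot : ∀ Ω : Opens (E n), LinearMap.ker (i Ω) = ⊥
  incl_injective : ∀ Ω : Opens (E n), Function.Injective (incl Ω)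
  smooth : ∀ (Ω : Opens (E n)) (f : Smooth Ω), i Ω (toDistr f) = incl Ω f
  deriv : ∀ (Ω : Opens (E n)) (α : Fin n → ℕ) (T : 𝓓'(Ω, ℝ)),
    i Ω (multiDeriv derivDistr α T) = multiDeriv (G.obj (op Ω)).der α (i Ω T)

/-- Objects of `Col_n`. -/
structure Col (n : ℕ) where
  G : (Opens (E n))ᵒᵖ ⥤ DAlg.{u} n
  incl : ∀ Ω : Opens (E n), Smooth Ω →ₐ[ℝ] G.obj (op Ω)
  i : ∀ Ω : Opens (E n), 𝓓'(Ω, ℝ) →ₗ[ℝ] G.obj (op Ω)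
  isCol : IsCol G incl i

namespace Col

/-- Arrows of `Col_n`: natural transformations of presheaves of differential algebras commuting
with the embeddings of distributions. -/
@[ext]
structure Hom (S T : Col.{u} n) where
  φ : S.G ⟶ T.G
  comm : ∀ (Ω : Opens (E n)) (t : 𝓓'(Ω, ℝ)), (φ.app (op Ω)).φ (S.i Ω t) = T.i Ω t

instance : Category (Col.{u} n) where
  Hom := Hom
  id S := ⟨𝟙 S.G, fun _ _ => rfl⟩
  comp f g := ⟨f.φ ≫ g.φ, fun Ω t =>
    (congrArg (g.φ.app (op Ω)).φ (f.comm Ω t)).trans (g.comm Ω t)⟩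

end Col

/-! ### The embedding of distributions by means of a mollifier -/

/-- Colombeau mollifiers: Schwartz functions of integral one all of whose higher moments vanish. -/
structure IsColombeauMollifier (ρ : 𝓢(E n, ℝ)) : Prop where
  integral_eq_one : ∫ x, ρ x = 1
  moments : ∀ k : Fin n → ℕ, 1 ≤ ∑ j, k j → ∫ x : E n, ρ x * ∏ j, x j ^ k j = 0

/-- `(1/r) ⊙ ρ`, i.e. `x ↦ r ^ n ρ (r x)`. -/
def scaled (ρ : 𝓢(E n, ℝ)) (r : ℝ) (x : E n) : ℝ := r ^ n * ρ (r • x)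

theorem scaled_contDiff (ρ : 𝓢(E n, ℝ)) (r : ℝ) : ContDiff ℝ ∞ (scaled ρ r) :=
  contDiff_const.mul ((ρ.smooth ⊤).comp (contDiff_id.const_smul r))

/-- The test function `y ↦ χ y * ψ (x - y)`. -/
def cutTranslate {Ω : Opens (E n)} (χ : 𝓓(Ω, ℝ)) (ψ : E n → ℝ) (hψ : ContDiff ℝ ∞ ψ) (x : E n) :
    𝓓(Ω, ℝ) where
  toFun y := χ y * ψ (x - y)
  contDiff' := χ.contDiff.mul (hψ.comp (contDiff_const.sub contDiff_id))
  hasCompactSupport' := χ.hasCompactSupport.mul_right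
  tsupport_subset' := (tsupport_mul_subset_left).trans χ.tsupport_subset

/-- `i : 𝓓' → 𝓖(B, -)` is the embedding by means of the generator `b` and the mollifier `ρ`: the
linear sheaf morphism which sends every compactly supported `T ∈ 𝓓'(Ω)` to the class of the net
`(T * ρ_ε)|_Ω`, where `ρ_ε x = |b_ε| ^ n ρ (|b_ε| x)`. Here `(T * ρ_ε) x = ⟨T, χ ρ_ε(x - ·)⟩` for any
test function `χ` on `Ω` equal to `1` on a neighbourhood of the support of `T`; such `χ` exist
exactly if the support of `T` is a compact subset of `Ω`. -/
structure IsMollifierEmbedding (ρ : 𝓢(E n, ℝ)) (X : PAG.{u})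
    (i : ∀ Ω : Opens (E n), 𝓓'(Ω, ℝ) →ₗ[ℝ] (colombeauPresheaf X n).obj (op Ω)) : Prop where
  natural : ∀ (Ω Ω' : Opens (E n)) (h : Ω' ≤ Ω) (T : 𝓓'(Ω, ℝ)),
    resG X h (i Ω T) = i Ω' (resDistr h T)
  compact : ∀ (Ω : Opens (E n)) (T : 𝓓'(Ω, ℝ)) (χ : 𝓓(Ω, ℝ)),
    (∀ᶠ y in 𝓝ˢ (Distribution.dsupport T), χ y = 1) →
    ∃ (u : X.J.I → Smooth Ω) (hu : IsModerate X.B Ω u),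
      (∀ (ε : X.J.I) (x : Ω),
        (u ε).1 x = T (cutTranslate χ (scaled ρ |X.b ε|) (scaled_contDiff ρ _) x)) ∧
      i Ω T = cls u hu

/-- The embedding `i_b^ρ`: the family characterized by `IsMollifierEmbedding`. -/
def mollifierEmbedding (ρ : 𝓢(E n, ℝ)) (X : PAG.{u}) :
    ∀ Ω : Opens (E n), 𝓓'(Ω, ℝ) →ₗ[ℝ] (colombeauPresheaf X n).obj (op Ω) :=
  Classical.epsilon (IsMollifierEmbedding ρ X)

end Colombeau

end

open Colombeau

/-! A distribution is regularized after a cut-off: for a test function `χ` and `r = |b_ε|` one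
considers `x ↦ ⟨T, χ ρ_r(x - ·)⟩`. On the support of `χ` the distribution is controlled by finitely
many derivatives, and each derivative of `ρ_r` costs one power of `r`, so the net is bounded by
powers of `|b|` together with all its derivatives. Since `b` generates the gauge, its powers are
cofinal in it and `|b|` is eventually large. Polynomial growth in `|b|` therefore gives
moderateness, and decay faster than every power of `|b|` gives negligibility.

The cut-off is harmless: where `χ` vanishes, the rapid decay of `ρ` makes the regularization
negligible (`regG_eq_zero`). The class on an open set `V` thus depends only on `χ` restricted to
`V`, and `IsRegularization`, which asks an element to be given on each `V` by any cut-off equal to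
`1` there, is a consistent local condition. It has at most one solution by separation
(`IsRegularization.eq`) and at least one by gluing along an exhaustion (`exists_glue`,
`exists_isRegularization`). An embedding as in (1) must satisfy it, because `T` agrees near each
compact set with a compactly supported `χ T`.

The remaining identities follow from uniqueness: linearity, naturality and compatibility with
derivatives hold because both sides are regularizations of the same distribution. For smooth `f`,
Taylor's formula and the vanishing moments make the error smaller than every power of `1 / r`
(`norm_mollify_sub_le`), so `f` itself is a regularization. The kernel is trivial because
regularizations converge weakly to `T` (`exists_abs_integral_mul_regul_sub_le`), while a negligible
net becomes small on compact sets. An arrow of `pAG` preserves `O` and the generator, so reindexing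
carries the regularizing net for `b₁` to the one for `b₂`. -/

noncomputable section

namespace Colombeau

/-! ### Smooth functions with bounded derivatives -/

section BddSmooth

variable {V F G : Type} [NormedAddCommGroup V] [NormedSpace ℝ V] [NormedAddCommGroup F]
  [NormedSpace ℝ F] [NormedAddCommGroup G] [NormedSpace ℝ G]

/-- Smooth functions all of whose derivatives are bounded. -/
structure BddSmooth (g : V → F) : Prop where
  contDiff : ContDiff ℝ ∞ g
  bdd : ∀ i : ℕ, ∃ C : ℝ, 0 ≤ C ∧ ∀ x, ‖iteratedFDeriv ℝ i g x‖ ≤ C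

namespace BddSmooth

theorem of_hasCompactSupport {g : V → F} (hg : ContDiff ℝ ∞ g) (hc : HasCompactSupport g) :
    BddSmooth g := by
  refine ⟨hg, fun i => ?_⟩
  have hi : Continuous (iteratedFDeriv ℝ i g) :=
    hg.continuous_iteratedFDeriv (by exact_mod_cast le_top)
  obtain ⟨C, hC⟩ := hi.bounded_above_of_compact_support (hc.iteratedFDeriv i)
  exact ⟨C, (norm_nonneg _).trans (hC 0), hC⟩

theorem schwartz (ρ : 𝓢(V, F)) : BddSmooth ρ := by
  refine ⟨ρ.smooth ⊤, fun i => ?_⟩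
  obtain ⟨C, hC, h⟩ := ρ.decay 0 i
  exact ⟨C, hC.le, fun x => by simpa using h x⟩

theorem norm_le {g : V → F} (hg : BddSmooth g) : ∃ C : ℝ, 0 ≤ C ∧ ∀ x, ‖g x‖ ≤ C := by
  obtain ⟨C, hC, h⟩ := hg.bdd 0
  exact ⟨C, hC, fun x => by simpa using h x⟩

theorem fderiv {g : V → F} (hg : BddSmooth g) : BddSmooth (fderiv ℝ g) := by
  refine ⟨hg.contDiff.fderiv_right (by simp), fun i => ?_⟩
  obtain ⟨C, hC, h⟩ := hg.bdd (i + 1)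
  exact ⟨C, hC, fun x => by rw [norm_iteratedFDeriv_fderiv]; exact h x⟩

theorem clm_comp {g : V → F} (hg : BddSmooth g) (L : F →L[ℝ] G) : BddSmooth (fun x => L (g x)) := by
  refine ⟨L.contDiff.comp hg.contDiff, fun i => ?_⟩
  obtain ⟨C, hC, h⟩ := hg.bdd i
  refine ⟨‖L‖ * C, by positivity, fun x => ?_⟩
  refine (L.norm_iteratedFDeriv_comp_left (f := g) (N := ∞) hg.contDiff.contDiffAt
    (by exact_mod_cast le_top)).trans ?_
  gcongr
  exact h x

theorem fderiv_apply {g : V → F} (hg : BddSmooth g) (v : V) :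
    BddSmooth (fun x => _root_.fderiv ℝ g x v) :=
  hg.fderiv.clm_comp (ContinuousLinearMap.apply ℝ F v)

theorem iteratedFDeriv {g : V → F} (hg : BddSmooth g) (i : ℕ) :
    BddSmooth (iteratedFDeriv ℝ i g) := by
  induction i with
  | zero =>
    rw [iteratedFDeriv_zero_eq_comp]
    exact hg.clm_comp
      (continuousMultilinearCurryFin0 ℝ V F).symm.toContinuousLinearEquiv.toContinuousLinearMap
  | succ i ih =>
    rw [iteratedFDeriv_succ_eq_comp_left]
    exact ih.fderiv.clm_comp (continuousMultilinearCurryLeftEquiv ℝ (fun _ => V)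
      F).symm.toContinuousLinearEquiv.toContinuousLinearMap

theorem differentiable {g : V → F} (hg : BddSmooth g) : Differentiable ℝ g :=
  hg.contDiff.differentiable (by simp)

/-- Taylor's formula with a uniform bound of the remainder. -/
theorem taylor (m : ℕ) : ∀ {F : Type} [NormedAddCommGroup F] [NormedSpace ℝ F] {g : V → F},
    BddSmooth g → ∃ C : ℝ, 0 ≤ C ∧ ∀ x v : V,
      ‖g (x + v) - ∑ k ∈ Finset.range m,
        ((k.factorial : ℝ)⁻¹) • _root_.iteratedFDeriv ℝ k g x (fun _ => v)‖ ≤ C * ‖v‖ ^ m := by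
  induction m with
  | zero =>
    intro F _ _ g hg
    obtain ⟨C, hC, h⟩ := hg.norm_le
    exact ⟨C, hC, fun x v => by simpa using h (x + v)⟩
  | succ m ih =>
    intro F _ _ g hg
    obtain ⟨C, hC, h⟩ := ih hg.fderiv
    refine ⟨C, hC, fun x v => ?_⟩
    -- The remainder along the segment from `x` to `x + v`. Its derivative `f'` is the remainder of
    -- order `m` of `fderiv ℝ g`, applied to `v`; hence the induction runs over all target spaces,
    -- and the mean value inequality on `[0, 1]` closes the step.
    let f : ℝ → F := fun t => g (x + t • v) - ∑ k ∈ Finset.range (m + 1),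
      (t ^ k * (k.factorial : ℝ)⁻¹) • _root_.iteratedFDeriv ℝ k g x (fun _ => v)
    let f' : ℝ → F := fun t => (_root_.fderiv ℝ g (x + t • v) - ∑ k ∈ Finset.range m,
      ((k.factorial : ℝ)⁻¹) • _root_.iteratedFDeriv ℝ k (_root_.fderiv ℝ g) x (fun _ => t • v)) v
    have hf : ∀ t, HasDerivAt f (f' t) t := by
      intro t
      have h1 : HasDerivAt (fun t : ℝ => g (x + t • v)) (_root_.fderiv ℝ g (x + t • v) v) t := by
        have hl : HasDerivAt (fun t : ℝ => x + t • v) v t := by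
          simpa using ((hasDerivAt_id t).smul_const v).const_add x
        exact (hg.differentiable (x + t • v)).hasFDerivAt.comp_hasDerivAt t hl
      have h2 : HasDerivAt (fun t : ℝ => ∑ k ∈ Finset.range (m + 1),
          (t ^ k * (k.factorial : ℝ)⁻¹) • _root_.iteratedFDeriv ℝ k g x (fun _ => v))
          (∑ k ∈ Finset.range (m + 1), ((k * t ^ (k - 1)) * (k.factorial : ℝ)⁻¹) •
            _root_.iteratedFDeriv ℝ k g x (fun _ => v)) t :=
        HasDerivAt.fun_sum fun k _ => ((hasDerivAt_pow k t).mul_const _).smul_const _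
      refine (h1.sub h2).congr_deriv ?_
      simp only [f', sub_apply, sum_apply, smul_apply, Finset.sum_range_succ' _ m, Nat.cast_zero,
        zero_mul, zero_smul, add_zero]
      congr 1
      refine Finset.sum_congr rfl fun k _ => ?_
      rw [iteratedFDeriv_succ_apply_right,
        ContinuousMultilinearMap.map_smul_univ _ (fun _ => t) (fun _ => v)]
      simp only [Finset.prod_const, Finset.card_univ, Fintype.card_fin, Nat.add_sub_cancel,
        smul_apply, smul_smul, Nat.factorial_succ]
      congr 1
      push_cast
      field_simp
    have hb := norm_image_sub_le_of_norm_deriv_le_segment_01' (f := f) (f' := f')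
      (C := C * ‖v‖ ^ (m + 1)) (fun t _ => (hf t).hasDerivWithinAt) (fun t ht => by
        calc ‖f' t‖ ≤ (C * ‖t • v‖ ^ m) * ‖v‖ := ContinuousLinearMap.le_of_opNorm_le _ (h x _) _
          _ ≤ (C * ‖v‖ ^ m) * ‖v‖ := by
            gcongr
            rw [norm_smul, Real.norm_eq_abs, abs_of_nonneg ht.1]
            exact mul_le_of_le_one_left (norm_nonneg _) ht.2.le
          _ = _ := by ring)
    have h0 : f 0 = 0 := by
      simp [f, Finset.sum_range_succ' _ m]
    rw [h0, sub_zero] at hb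
    simpa [f] using hb

end BddSmooth

end BddSmooth

/-! ### Mollification -/

section Mollify

variable {n : ℕ} {F : Type} [NormedAddCommGroup F] [NormedSpace ℝ F]

/-- The weighted mean `∫ k z • g (x + s z) dz`. -/
def mollify (k : E n → ℝ) (s : ℝ) (g : E n → F) (x : E n) : F := ∫ z, k z • g (x + s • z)

theorem BddSmooth.integrable_smul {k : E n → ℝ} (hk : Integrable k) {g : E n → F}
    (hg : BddSmooth g) (s : ℝ) (x : E n) : Integrable fun z => k z • g (x + s • z) := by
  obtain ⟨C, -, h⟩ := hg.norm_le
  exact hk.smul_bdd C (hg.contDiff.continuous.comp (by fun_prop)).aestronglyMeasurable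
    (Filter.Eventually.of_forall fun z => h _)

/-- Differentiation under the integral sign: a bound `C` of the derivative of `g` gives the
dominating function `‖k‖ C`. The kernel only has to be integrable. -/
theorem hasFDerivAt_mollify {k : E n → ℝ} (hk : Integrable k) (s : ℝ) {g : E n → F}
    (hg : BddSmooth g) (x : E n) :
    HasFDerivAt (mollify k s g) (mollify k s (fderiv ℝ g) x) x := by
  obtain ⟨C, hC, h⟩ := hg.fderiv.norm_le
  refine hasFDerivAt_integral_of_dominated_of_fderiv_le (s := Set.univ)
    (bound := fun z => ‖k z‖ * C)
    (F := fun x z => k z • g (x + s • z)) (F' := fun x z => k z • fderiv ℝ g (x + s • z))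
    Filter.univ_mem
    (Filter.Eventually.of_forall fun y => (hg.integrable_smul hk s y).aestronglyMeasurable)
    (hg.integrable_smul hk s x) (hg.fderiv.integrable_smul hk s x).aestronglyMeasurable
    (Filter.Eventually.of_forall fun z y _ => ?_) (hk.norm.mul_const C)
    (Filter.Eventually.of_forall fun z y _ => ?_)
  · rw [norm_smul]
    gcongr
    exact h _
  · have h1 := (hg.differentiable (y + s • z)).hasFDerivAt
    exact ((hasFDerivAt_comp_add_right (s • z)).2 h1).const_smul (k z)

theorem fderiv_mollify {k : E n → ℝ} (hk : Integrable k) (s : ℝ) {g : E n → F}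
    (hg : BddSmooth g) : fderiv ℝ (mollify k s g) = mollify k s (fderiv ℝ g) :=
  funext fun x => (hasFDerivAt_mollify hk s hg x).fderiv

theorem mollify_clm {k : E n → ℝ} (hk : Integrable k) (s : ℝ) {g : E n → F} (hg : BddSmooth g)
    {G : Type} [NormedAddCommGroup G] [NormedSpace ℝ G] [CompleteSpace F] [CompleteSpace G]
    (L : F →L[ℝ] G) (x : E n) :
    L (mollify k s g x) = mollify k s (fun y => L (g y)) x := by
  unfold mollify
  rw [← L.integral_comp_comm (hg.integrable_smul hk s x)]
  simp

theorem contDiff_mollify {k : E n → ℝ} (hk : Integrable k) (s : ℝ) {g : E n → F}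
    (hg : BddSmooth g) : ContDiff ℝ ∞ (mollify k s g) := by
  rw [contDiff_infty]
  intro m
  induction m generalizing F with
  | zero =>
    exact contDiff_zero.2 (continuous_iff_continuousAt.2 fun x =>
      (hasFDerivAt_mollify hk s hg x).continuousAt)
  | succ m ih =>
    push_cast
    refine contDiff_succ_iff_fderiv.2 ⟨fun x => (hasFDerivAt_mollify hk s hg x).differentiableAt,
      by simp, ?_⟩
    rw [fderiv_mollify hk s hg]
    exact ih hg.fderiv

theorem iteratedFDeriv_mollify [CompleteSpace F] {k : E n → ℝ} (hk : Integrable k) (s : ℝ)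
    {g : E n → F} (hg : BddSmooth g) (i : ℕ) :
    iteratedFDeriv ℝ i (mollify k s g) = mollify k s (iteratedFDeriv ℝ i g) := by
  induction i with
  | zero =>
    ext1 x
    rw [iteratedFDeriv_zero_eq_comp, iteratedFDeriv_zero_eq_comp]
    exact mollify_clm hk s hg
      (continuousMultilinearCurryFin0 ℝ (E n)
        F).symm.toContinuousLinearEquiv.toContinuousLinearMap x
  | succ i ih =>
    ext1 x
    rw [iteratedFDeriv_succ_eq_comp_left, iteratedFDeriv_succ_eq_comp_left, ih,
      fderiv_mollify hk s (hg.iteratedFDeriv i)]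
    exact mollify_clm hk s (hg.iteratedFDeriv i).fderiv
      (continuousMultilinearCurryLeftEquiv ℝ (fun _ => E n)
        F).symm.toContinuousLinearEquiv.toContinuousLinearMap x

theorem integrable_schwartz_mul_multilinear (ρ : 𝓢(E n, ℝ)) {k : ℕ}
    (M : (E n) [×k]→L[ℝ] F) : Integrable fun z => ρ z • M fun _ => z := by
  refine Integrable.mono' ((ρ.integrable_pow_mul volume k).const_mul ‖M‖)
    (ρ.continuous.smul (M.cont.comp (by fun_prop))).aestronglyMeasurable
    (Filter.Eventually.of_forall fun z => ?_)
  rw [norm_smul]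
  calc ‖ρ z‖ * ‖M fun _ => z‖ ≤ ‖ρ z‖ * (‖M‖ * ∏ _i : Fin k, ‖z‖) := by
        gcongr; exact M.le_opNorm _
    _ = _ := by simp; ring

/-- Expanding `z` in the standard basis turns `M (z, …, z)` into a combination of monomials of
degree `k ≥ 1`, and the moments of `ρ` on these vanish. -/
theorem integral_mollifier_multilinear [CompleteSpace F] {ρ : 𝓢(E n, ℝ)}
    (hρ : IsColombeauMollifier ρ) {k : ℕ} (hk : 1 ≤ k) (M : (E n) [×k]→L[ℝ] F) :
    ∫ z, ρ z • M (fun _ => z) = 0 := by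
  have e : ∀ z : E n, ρ z • M (fun _ => z) = ∑ j : Fin k → Fin n,
      (ρ z * ∏ l, z (j l)) • M fun l => basisVec (j l) := by
    intro z
    have hz : z = ∑ i, z i • (basisVec i : E n) := by
      simpa [basisVec] using (EuclideanSpace.basisFun (Fin n) ℝ).sum_repr z |>.symm
    conv_lhs => rw [show (fun _ : Fin k => z) = fun _ => ∑ i, z i • (basisVec i : E n) from
      funext fun _ => hz]
    rw [← ContinuousMultilinearMap.coe_coe, MultilinearMap.map_sum, Finset.smul_sum]
    refine Finset.sum_congr rfl fun j _ => ?_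
    rw [MultilinearMap.map_smul_univ, smul_smul]
  -- The exponent of `z i` is the number of slots to which `j` assigns `i`; these exponents add up
  -- to `k`.
  have hp : ∀ (j : Fin k → Fin n) (z : E n), ∏ l, z (j l) =
      ∏ i, z i ^ (Finset.univ.filter fun l => j l = i).card := by
    intro j z
    rw [← Finset.prod_fiberwise Finset.univ j]
    refine Finset.prod_congr rfl fun i _ => ?_
    rw [Finset.prod_congr rfl (g := fun _ => z i), Finset.prod_const]
    intro l hl
    rw [(Finset.mem_filter.1 hl).2]
  simp only [e]
  have hint : ∀ j : Fin k → Fin n, Integrable fun z : E n => ρ z * ∏ l, z (j l) := by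
    intro j
    have := integrable_schwartz_mul_multilinear ρ (k := k)
      ((ContinuousMultilinearMap.mkPiAlgebra ℝ (Fin k) ℝ).compContinuousLinearMap
        fun l => (EuclideanSpace.proj (j l) : E n →L[ℝ] ℝ))
    simpa using this
  rw [integral_finsetSum _ fun j _ => (hint j).smul_const _]
  refine Finset.sum_eq_zero fun j _ => ?_
  rw [integral_smul_const]
  simp only [hp]
  rw [hρ.moments _ ?_, zero_smul]
  have : ∑ i, (Finset.univ.filter fun l => j l = i).card = k := by
    rw [← Finset.card_eq_sum_card_fiberwise (fun _ _ => Finset.mem_univ _)]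
    simp
  omega

/-- Mollification by a Colombeau mollifier approximates to arbitrary order. -/
theorem norm_mollify_sub_le [CompleteSpace F] {ρ : 𝓢(E n, ℝ)} (hρ : IsColombeauMollifier ρ)
    {g : E n → F} (hg : BddSmooth g) (m : ℕ) :
    ∃ C : ℝ, 0 ≤ C ∧ ∀ s x, ‖mollify ρ s g x - g x‖ ≤ C * |s| ^ (m + 1) := by
  obtain ⟨C, hC, h⟩ := hg.taylor (m + 1)
  refine ⟨C * ∫ z, ‖z‖ ^ (m + 1) * ‖ρ z‖, by positivity, fun s x => ?_⟩
  have hint : ∀ k, Integrable fun z => ρ z • ((k.factorial : ℝ)⁻¹ •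
      iteratedFDeriv ℝ k g x fun _ => s • z) := by
    intro k
    have := ((integrable_schwartz_mul_multilinear ρ (iteratedFDeriv ℝ k g x)).smul
      ((k.factorial : ℝ)⁻¹ * s ^ k))
    refine this.congr (Filter.Eventually.of_forall fun z => ?_)
    simp only [Pi.smul_apply]
    rw [ContinuousMultilinearMap.map_smul_univ _ (fun _ => s) (fun _ => z)]
    simp only [Finset.prod_const, Finset.card_univ, Fintype.card_fin, smul_smul]
    congr 1
    ring
  -- Only the constant term of the Taylor polynomial survives integration against `ρ`, and it
  -- contributes `g x` because `∫ ρ = 1`.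
  have hsum : ∫ z, ρ z • ∑ k ∈ Finset.range (m + 1), ((k.factorial : ℝ)⁻¹ •
      iteratedFDeriv ℝ k g x fun _ => s • z) = g x := by
    simp only [Finset.smul_sum]
    rw [integral_finsetSum _ fun k _ => hint k, Finset.sum_range_succ', Finset.sum_eq_zero]
    · simp [integral_smul_const, hρ.integral_eq_one]
    · intro k _
      have : ∀ z : E n, ρ z • (((k + 1).factorial : ℝ)⁻¹ •
          iteratedFDeriv ℝ (k + 1) g x fun _ => s • z) =
          (((k + 1).factorial : ℝ)⁻¹ * s ^ (k + 1)) •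
            (ρ z • iteratedFDeriv ℝ (k + 1) g x fun _ => z) := by
        intro z
        rw [ContinuousMultilinearMap.map_smul_univ _ (fun _ => s) (fun _ => z)]
        simp only [Finset.prod_const, Finset.card_univ, Fintype.card_fin, smul_smul]
        congr 1
        ring
      simp only [this]
      rw [integral_smul, integral_mollifier_multilinear hρ (by omega), smul_zero]
  have hint' : Integrable fun z => ρ z • ∑ k ∈ Finset.range (m + 1), ((k.factorial : ℝ)⁻¹ •
      iteratedFDeriv ℝ k g x fun _ => s • z) := by
    simp only [Finset.smul_sum]
    exact integrable_finsetSum _ fun k _ => hint k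
  conv_lhs => rw [← hsum]
  rw [mollify, ← integral_sub (hg.integrable_smul ρ.integrable s x) hint',
    mul_assoc, mul_comm _ (|s| ^ (m + 1)), ← mul_assoc, ← integral_const_mul]
  refine norm_integral_le_of_norm_le ((ρ.integrable_pow_mul volume (m + 1)).const_mul _)
    (Filter.Eventually.of_forall fun z => ?_)
  rw [← smul_sub, norm_smul]
  calc ‖ρ z‖ * _ ≤ ‖ρ z‖ * (C * ‖s • z‖ ^ (m + 1)) := by gcongr; exact h x (s • z)
    _ = _ := by rw [norm_smul, Real.norm_eq_abs s]; ring

end Mollify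

/-! ### The pairing of a cut-off distribution with smooth functions -/

section Pairing

variable {n : ℕ}

/-- The space `C^∞(ℝⁿ)`. -/
def CInf (n : ℕ) : Submodule ℝ (E n → ℝ) where
  carrier := {ψ | ContDiff ℝ ∞ ψ}
  add_mem' {f g} (hf : ContDiff ℝ ∞ f) (hg : ContDiff ℝ ∞ g) := hf.add hg
  zero_mem' := (contDiff_const : ContDiff ℝ ∞ fun _ : E n => (0 : ℝ))
  smul_mem' c f (hf : ContDiff ℝ ∞ f) := (contDiff_const (c := c)).smul hf

theorem CInf.contDiff {n : ℕ} (ψ : CInf n) : ContDiff ℝ ∞ ψ.1 := ψ.2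

variable {Ω : Opens (E n)}

/-- The product of a test function with a smooth function. -/
def mulTest (χ : 𝓓(Ω, ℝ)) (ψ : CInf n) : 𝓓(Ω, ℝ) where
  toFun y := χ y * ψ.1 y
  contDiff' := χ.contDiff.mul (CInf.contDiff ψ)
  hasCompactSupport' := χ.hasCompactSupport.mul_right
  tsupport_subset' := tsupport_mul_subset_left.trans χ.tsupport_subset

theorem mulTest_apply (χ : 𝓓(Ω, ℝ)) (ψ : CInf n) (y : E n) : mulTest χ ψ y = χ y * ψ.1 y := rfl

/-- The linear form `ψ ↦ ⟨T, χ ψ⟩` on `C^∞(ℝⁿ)`. -/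
def pairL (T : 𝓓'(Ω, ℝ)) (χ : 𝓓(Ω, ℝ)) : CInf n →ₗ[ℝ] ℝ where
  toFun ψ := T (mulTest χ ψ)
  map_add' f g := by
    rw [← map_add]
    congr 1
    ext y
    simp [mulTest_apply, mul_add]
  map_smul' c f := by
    rw [RingHom.id_apply, ← map_smul]
    congr 1
    ext y
    simp [mulTest_apply]
    ring

theorem pairL_apply (T : 𝓓'(Ω, ℝ)) (χ : 𝓓(Ω, ℝ)) (ψ : CInf n) :
    pairL T χ ψ = T (mulTest χ ψ) := rfl

/-- By the Leibniz rule. The bound is pointwise in `y`, so that later `ψ` has to be controlled on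
the support of `χ` only. Summing over all orders up to `N` gives one constant for all of them. -/
theorem exists_norm_iteratedFDeriv_mulTest_le (χ : 𝓓(Ω, ℝ)) (N : ℕ) :
    ∃ A : ℝ, 0 ≤ A ∧ ∀ (ψ : CInf n) (M : ℝ) (y : E n),
      (∀ i ≤ N, ‖iteratedFDeriv ℝ i ψ.1 y‖ ≤ M) →
      ∀ i ≤ N, ‖iteratedFDeriv ℝ i (mulTest χ ψ) y‖ ≤ A * M := by
  have hχ : BddSmooth χ := BddSmooth.of_hasCompactSupport χ.contDiff χ.hasCompactSupport
  choose B hB h using hχ.bdd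
  refine ⟨∑ i ∈ Finset.range (N + 1), ∑ j ∈ Finset.range (i + 1), (i.choose j) * B j,
    Finset.sum_nonneg fun i _ => Finset.sum_nonneg fun j _ => mul_nonneg (by positivity) (hB j),
    fun ψ M y hM i hi => ?_⟩
  have hM0 : 0 ≤ M := (norm_nonneg _).trans (hM 0 (Nat.zero_le _))
  calc ‖iteratedFDeriv ℝ i (fun y => χ y * ψ.1 y) y‖
      ≤ ∑ j ∈ Finset.range (i + 1), (i.choose j : ℝ) * ‖iteratedFDeriv ℝ j χ y‖ *
          ‖iteratedFDeriv ℝ (i - j) ψ.1 y‖ :=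
        norm_iteratedFDeriv_mul_le (N := ∞) χ.contDiff (CInf.contDiff ψ) y
          (by exact_mod_cast le_top)
    _ ≤ ∑ j ∈ Finset.range (i + 1), (i.choose j : ℝ) * B j * M := by
        gcongr with j hj
        · exact mul_nonneg (by positivity) (hB j)
        · exact h j y
        · exact hM _ (by omega)
    _ = (∑ j ∈ Finset.range (i + 1), (i.choose j : ℝ) * B j) * M := by rw [Finset.sum_mul]
    _ ≤ _ := by
        gcongr
        exact Finset.single_le_sum
          (f := fun i => ∑ j ∈ Finset.range (i + 1), ((i.choose j : ℕ) : ℝ) * B j)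
          (fun i _ => Finset.sum_nonneg fun j _ => mul_nonneg (by positivity) (hB j))
          (Finset.mem_range.2 (Nat.lt_succ_of_le hi))

/-- Continuity of `T` in terms of finitely many derivatives. -/
theorem exists_abs_pairL_le (T : 𝓓'(Ω, ℝ)) (χ : 𝓓(Ω, ℝ)) :
    ∃ (C : ℝ) (N : ℕ), 0 ≤ C ∧ ∀ (ψ : CInf n) (M : ℝ), 0 ≤ M →
      (∀ i ≤ N, ∀ y ∈ tsupport χ, ‖iteratedFDeriv ℝ i ψ.1 y‖ ≤ M) → |pairL T χ ψ| ≤ C * M := by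
  -- On test functions supported in the fixed compact set `tsupport χ`, continuity of `T` is an
  -- estimate by finitely many seminorms.
  let K : Compacts (E n) := ⟨tsupport χ, χ.hasCompactSupport⟩
  have hK : (K : Set (E n)) ⊆ Ω := χ.tsupport_subset
  let L : 𝓓_{K}(E n, ℝ) →ₗ[ℝ] ℝ :=
    { toFun := fun f => T (TestFunction.ofSupportedIn hK f)
      map_add' := fun f g =>
        map_add T (TestFunction.ofSupportedIn hK f) (TestFunction.ofSupportedIn hK g)
      map_smul' := fun c f => map_smul T c (TestFunction.ofSupportedIn hK f) }
  have hL : Continuous L :=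
    T.continuous.comp (TestFunction.continuous_ofSupportedIn hK)
  obtain ⟨s, C, -, hC⟩ := Seminorm.bound_of_continuous
    (ContDiffMapSupportedIn.withSeminorms ℝ (E n) ℝ ⊤ K) ((normSeminorm ℝ ℝ).comp L)
    (continuous_norm.comp hL)
  -- `s.sup id` is the highest order of derivative among these seminorms.
  obtain ⟨A, hA, hχ⟩ := exists_norm_iteratedFDeriv_mulTest_le χ (s.sup id)
  refine ⟨C * A, s.sup id, by positivity, fun ψ M hM h => ?_⟩
  let f : 𝓓_{K}(E n, ℝ) := .of_support_subset (f := mulTest χ ψ) (mulTest χ ψ).contDiff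
    (fun y hy => subset_tsupport _ (left_ne_zero_of_mul hy))
  have hf : pairL T χ ψ = L f := rfl
  have h1 := hC f
  rw [hf]
  calc |L f| ≤ C * (s.sup (ContDiffMapSupportedIn.seminorm ℝ (E n) ℝ ⊤ K)) f := h1
    _ ≤ C * (A * M) := by
      gcongr
      refine Seminorm.finset_sup_apply_le (by positivity) fun i hi => ?_
      rw [ContDiffMapSupportedIn.seminorm_top_le_iff ℝ (by positivity)]
      intro y hy
      exact hχ ψ M y (fun j hj => h j hj y hy) i (Finset.le_sup (f := id) hi)
    _ = _ := by ring

/-! ### Regularization of distributions -/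

/-- The function `y ↦ ψ (x - y)`. -/
def tr (ψ : CInf n) (x : E n) : CInf n :=
  ⟨fun y => ψ.1 (x - y), (CInf.contDiff ψ).comp (contDiff_const.sub contDiff_id)⟩

/-- The directional derivative on `C^∞(ℝⁿ)`. -/
def dirD (v : E n) (ψ : CInf n) : CInf n :=
  ⟨fun y => fderiv ℝ ψ.1 y v,
    ((CInf.contDiff ψ).fderiv_right (m := ∞) (n := ∞) (by simp)).clm_apply contDiff_const⟩

theorem norm_iteratedFDeriv_comp_const_sub {F : Type} [NormedAddCommGroup F] [NormedSpace ℝ F]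
    (g : E n → F) (x y : E n) (i : ℕ) :
    ‖iteratedFDeriv ℝ i (fun y => g (x - y)) y‖ = ‖iteratedFDeriv ℝ i g (x - y)‖ := by
  have h := (LinearIsometryEquiv.neg ℝ (E := E n)).norm_iteratedFDeriv_comp_right
    (fun z => g (z + x)) y i
  have e : (fun z => g (z + x)) ∘ (LinearIsometryEquiv.neg ℝ (E := E n)) =
      fun y => g (x - y) := by
    ext z
    simp [neg_add_eq_sub]
  rw [e, iteratedFDeriv_comp_add_right] at h
  rw [h]
  simp [neg_add_eq_sub]

/-- The first order Taylor remainder of `x ↦ g (x - ·)`. -/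
def trRem {F : Type} [NormedAddCommGroup F] [NormedSpace ℝ F] (g : E n → F) (x h y : E n) : F :=
  g (x + h - y) - g (x - y) - fderiv ℝ g (x - y) h

/-- Differentiation in `y` commutes with taking the remainder up to the sign of the inner
derivative, so derivatives of remainders are again remainders. -/
theorem fderiv_trRem {F : Type} [NormedAddCommGroup F] [NormedSpace ℝ F] {g : E n → F}
    (hg : BddSmooth g) (x h : E n) :
    fderiv ℝ (trRem g x h) = - trRem (fderiv ℝ g) x h := by
  ext1 y
  have hs : ∀ x y : E n, HasFDerivAt (fun y => x - y) (-ContinuousLinearMap.id ℝ (E n)) y :=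
    fun x y => (hasFDerivAt_id y).const_sub x
  have h1 : ∀ x : E n, HasFDerivAt (fun y => g (x - y)) (- fderiv ℝ g (x - y)) y := fun x => by
    have := (hg.differentiable (x - y)).hasFDerivAt.comp y (hs x y)
    refine this.congr_fderiv ?_
    ext; simp
  have h2 : HasFDerivAt (fun y => fderiv ℝ g (x - y) h)
      (- fderiv ℝ (fderiv ℝ g) (x - y) h) y := by
    have := ((hg.fderiv.differentiable (x - y)).hasFDerivAt.comp y (hs x y)).clm_apply
      (hasFDerivAt_const h y)
    refine this.congr_fderiv ?_
    -- The last term yields the second derivative with `h` and the direction of differentiation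
    -- interchanged; symmetry puts them back in order.
    have hsym : IsSymmSndFDerivAt ℝ g (x - y) :=
      hg.contDiff.contDiffAt.isSymmSndFDerivAt (by
        rw [minSmoothness_of_isRCLikeNormedField]
        exact WithTop.coe_le_coe.2 (le_top : (2 : ℕ∞) ≤ ⊤))
    ext w
    simp [hsym w h]
  rw [show trRem g x h = ((fun y => g (x + h - y)) - fun y => g (x - y)) -
    fun y => fderiv ℝ g (x - y) h from rfl, (((h1 (x + h)).sub (h1 x)).sub h2).fderiv]
  ext w
  simp [trRem]
  abel

/-- Order zero is Taylor's formula with two terms; higher orders reduce to it by `fderiv_trRem`.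
Uniformity in `x` and `y` is what allows `T` to be applied to the remainder. -/
theorem exists_norm_iteratedFDeriv_trRem_le (i : ℕ) :
    ∀ {F : Type} [NormedAddCommGroup F] [NormedSpace ℝ F] {g : E n → F}, BddSmooth g →
      ∃ C : ℝ, 0 ≤ C ∧ ∀ x h y, ‖iteratedFDeriv ℝ i (trRem g x h) y‖ ≤ C * ‖h‖ ^ 2 := by
  induction i with
  | zero =>
    intro F _ _ g hg
    obtain ⟨C, hC, H⟩ := hg.taylor 2
    refine ⟨C, hC, fun x h y => ?_⟩
    have := H (x - y) h
    simpa [Finset.sum_range_succ, trRem, sub_add_eq_add_sub, sub_sub] using this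
  | succ i ih =>
    intro F _ _ g hg
    obtain ⟨C, hC, H⟩ := ih hg.fderiv
    refine ⟨C, hC, fun x h y => ?_⟩
    rw [← norm_iteratedFDeriv_fderiv, fderiv_trRem hg, iteratedFDeriv_neg_apply, norm_neg]
    exact H x h y

/-- By linearity the error of the linear approximation is the pairing of `T` with the Taylor
remainder of the translates. The derivatives of that remainder up to the order `N` of `T` are `O(‖h‖
^ 2)`, hence so is the error. -/
theorem hasFDerivAt_pairL_tr (T : 𝓓'(Ω, ℝ)) (χ : 𝓓(Ω, ℝ)) {ψ : CInf n} (hψ : BddSmooth ψ.1)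
    (x : E n) :
    ∃ D : E n →L[ℝ] ℝ, (∀ v, D v = pairL T χ (tr (dirD v ψ) x)) ∧
      HasFDerivAt (fun x => pairL T χ (tr ψ x)) D x := by
  let D : E n →ₗ[ℝ] ℝ :=
    { toFun := fun v => pairL T χ (tr (dirD v ψ) x)
      map_add' := fun v w => by
        rw [← map_add]
        congr 1
        ext y
        simp [tr, dirD]
      map_smul' := fun c v => by
        rw [RingHom.id_apply, ← map_smul]
        congr 1
        ext y
        simp [tr, dirD] }
  refine ⟨LinearMap.toContinuousLinearMap D, fun v => rfl, ?_⟩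
  obtain ⟨C, N, hC, hL⟩ := exists_abs_pairL_le T χ
  choose B hB hR using fun i => exists_norm_iteratedFDeriv_trRem_le i hψ
  have hb : ∀ h : E n, ‖pairL T χ (tr ψ (x + h)) - pairL T χ (tr ψ x) - D h‖ ≤
      (C * ∑ i ∈ Finset.range (N + 1), B i) * ‖‖h‖ ^ 2‖ := by
    intro h
    change |pairL T χ (tr ψ (x + h)) - pairL T χ (tr ψ x) - pairL T χ (tr (dirD h ψ) x)| ≤ _
    rw [← map_sub, ← map_sub, mul_assoc]
    refine hL _ _ (mul_nonneg (Finset.sum_nonneg fun i _ => hB i) (norm_nonneg _))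
      fun i hi y _ => ?_
    refine le_trans (b := B i * ‖h‖ ^ 2) (hR i x h y) ?_
    rw [norm_pow, norm_norm]
    gcongr
    exact Finset.single_le_sum (fun i _ => hB i) (Finset.mem_range.2 (Nat.lt_succ_of_le hi))
  rw [hasFDerivAt_iff_isLittleO_nhds_zero]
  refine (Asymptotics.IsBigO.of_bound _ (Filter.Eventually.of_forall hb)).trans_isLittleO ?_
  simpa using (Asymptotics.isLittleO_norm_pow_id (E' := E n) one_lt_two)

theorem fderiv_pairL_tr (T : 𝓓'(Ω, ℝ)) (χ : 𝓓(Ω, ℝ)) {ψ : CInf n} (hψ : BddSmooth ψ.1)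
    (x v : E n) :
    fderiv ℝ (fun x => pairL T χ (tr ψ x)) x v = pairL T χ (tr (dirD v ψ) x) := by
  obtain ⟨D, hD, h⟩ := hasFDerivAt_pairL_tr T χ hψ x
  rw [h.fderiv, hD]

theorem contDiff_pairL_tr (T : 𝓓'(Ω, ℝ)) (χ : 𝓓(Ω, ℝ)) {ψ : CInf n} (hψ : BddSmooth ψ.1) :
    ContDiff ℝ ∞ fun x => pairL T χ (tr ψ x) := by
  have hd : ∀ {ψ : CInf n}, BddSmooth ψ.1 → Differentiable ℝ fun x => pairL T χ (tr ψ x) :=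
    fun hψ x => by
      obtain ⟨D, -, h⟩ := hasFDerivAt_pairL_tr T χ hψ x
      exact h.differentiableAt
  rw [contDiff_infty]
  intro m
  induction m generalizing ψ with
  | zero => exact contDiff_zero.2 (hd hψ).continuous
  | succ m ih =>
    push_cast
    refine contDiff_succ_iff_fderiv_apply.2 ⟨hd hψ, by simp, fun v => ?_⟩
    simp only [fderiv_pairL_tr T χ hψ]
    -- The directional derivative is a function of the same kind, with `ψ` replaced by its
    -- derivative.
    exact ih (ψ := dirD v ψ) (hψ.fderiv_apply v)

/-! ### Integrals of regularizations -/

/-- The bound makes `L` vanish on the kernel of `p`, so `L` descends to a continuous form on the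
range of `p`; the Hahn–Banach theorem extends it. -/
theorem exists_dual_factorization {V Z : Type*} [AddCommGroup V] [Module ℝ V]
    [NormedAddCommGroup Z] [NormedSpace ℝ Z] (p : V →ₗ[ℝ] Z) (L : V →ₗ[ℝ] ℝ) {C : ℝ}
    (h : ∀ v, |L v| ≤ C * ‖p v‖) : ∃ Λ : Z →L[ℝ] ℝ, ∀ v, Λ (p v) = L v := by
  obtain ⟨s, hs⟩ := p.rangeRestrict.exists_rightInverse_of_surjective
    (LinearMap.range_eq_top.2 p.surjective_rangeRestrict)
  have hs' : ∀ z, p (s z) = z := fun z => congrArg Subtype.val (LinearMap.congr_fun hs z)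
  let f : LinearMap.range p →L[ℝ] ℝ := (L ∘ₗ s).mkContinuous C fun z => by
    have := h (s z)
    rwa [hs'] at this
  obtain ⟨Λ, hΛ, -⟩ := exists_extension_norm_eq (LinearMap.range p) f
  refine ⟨Λ, fun v => ?_⟩
  have h1 := hΛ ⟨p v, v, rfl⟩
  rw [h1]
  have h2 := h (s ⟨p v, v, rfl⟩ - v)
  rw [map_sub p, hs', sub_self, norm_zero, mul_zero, abs_nonpos_iff, map_sub, sub_eq_zero] at h2
  exact h2

/-- A linear form on `V`, continuous for finitely many uniform seminorms on a compact set `K`,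
commutes with weak integrals. -/
theorem integral_mul_eq_of_bound {V ι : Type} [AddCommGroup V] [Module ℝ V] [Fintype ι]
    {F : ι → Type} [∀ i, NormedAddCommGroup (F i)] [∀ i, NormedSpace ℝ (F i)]
    [∀ i, CompleteSpace (F i)] {K : Set (E n)} (hK : IsCompact K) (p : ∀ i, V →ₗ[ℝ] (E n → F i))
    (hp : ∀ i v, Continuous (p i v)) (L : V →ₗ[ℝ] ℝ) {C : ℝ}
    (hL : ∀ (v : V) (M : ℝ), 0 ≤ M → (∀ i, ∀ y ∈ K, ‖p i v y‖ ≤ M) → |L v| ≤ C * M)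
    {φ : E n → ℝ} (hφ : Continuous φ) (hc : HasCompactSupport φ) (c : E n → V)
    (hcont : ∀ i, Continuous fun z : E n × E n => p i (c z.1) z.2) (v : V)
    (hv : ∀ i y, p i v y = ∫ x, φ x • p i (c x) y) :
    ∫ x, φ x * L (c x) = L v := by
  have : CompactSpace K := isCompact_iff_compactSpace.1 hK
  -- The seminorms together embed the problem into a Banach space of continuous functions on `K`.
  -- There `x ↦ φ x • P (c x)` is Bochner integrable, and the form extended by Hahn–Banach commutes
  -- with its integral.
  let P : V →ₗ[ℝ] (∀ i, C(K, F i)) :=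
    { toFun := fun w i => ⟨fun y => p i w y, (hp i w).comp continuous_subtype_val⟩
      map_add' := fun f g => by
        ext i y
        simp
      map_smul' := fun r f => by
        ext i y
        simp }
  obtain ⟨Λ, hΛ⟩ := exists_dual_factorization P L (C := C) fun w => by
    refine hL w _ (norm_nonneg _) fun i y hy => ?_
    exact ((P w i).norm_coe_le_norm ⟨y, hy⟩).trans (norm_le_pi_norm (P w) i)
  have hPc : Continuous fun x => P (c x) := by
    refine continuous_pi fun i => ContinuousMap.continuous_of_continuous_uncurry _ ?_
    exact (hcont i).comp (continuous_fst.prodMk (continuous_subtype_val.comp continuous_snd))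
  have hint : Integrable fun x => φ x • P (c x) :=
    Continuous.integrable_of_hasCompactSupport (f := fun x => φ x • P (c x)) (hφ.smul hPc)
      hc.smul_right
  -- Evaluation at a point of `K` commutes with the integral, so this can be checked pointwise,
  -- where it is the hypothesis `hv`.
  have hkey : ∫ x, φ x • P (c x) = P v := by
    ext i y
    have h1 := (ContinuousLinearMap.proj (R := ℝ) (φ := fun i => C(K, F i)) i).integral_comp_comm
      hint
    simp only [ContinuousLinearMap.proj_apply] at h1
    rw [← h1, ContinuousMap.integral_apply]
    · exact (hv i y).symm
    · exact (ContinuousLinearMap.proj (R := ℝ) (φ := fun i => C(K, F i)) i).integrable_comp hint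
  rw [← hΛ v, ← hkey, ← Λ.integral_comp_comm hint]
  simp [hΛ]

theorem BddSmooth.comp_neg {ψ : E n → ℝ} (hψ : BddSmooth ψ) : BddSmooth fun y => ψ (-y) := by
  refine ⟨hψ.contDiff.comp contDiff_neg, fun i => ?_⟩
  obtain ⟨B, hB, h⟩ := hψ.bdd i
  refine ⟨B, hB, fun y => ?_⟩
  have := norm_iteratedFDeriv_comp_const_sub ψ 0 y i
  simp only [zero_sub] at this
  exact this.le.trans (h _)

/-- The interchange of `T` with the integral over `x`. The seminorms are the derivatives of order at
most `N` on `tsupport χ`, where `N` is the order of `T` there. -/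
theorem integral_mul_pairL_tr (T : 𝓓'(Ω, ℝ)) (χ : 𝓓(Ω, ℝ)) {ψ : CInf n} (hψ : BddSmooth ψ.1)
    {φ : E n → ℝ} (hφ : Continuous φ) (hc : HasCompactSupport φ) (v : CInf n)
    (hv : ∀ y, v.1 y = ∫ x, φ x * ψ.1 (x - y)) :
    ∫ x, φ x * pairL T χ (tr ψ x) = pairL T χ v := by
  obtain ⟨C, N, hC, hL⟩ := exists_abs_pairL_le T χ
  have hθ := hψ.comp_neg
  -- The functions `y ↦ ψ (x - y)` are translates of the reflection `y ↦ ψ (-y)`, so their average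
  -- over `x` with weight `φ` is a mollification of that reflection with scale `-1`, and derivatives
  -- pass through it.
  have hp : ∀ x (i : ℕ) (y : E n), iteratedFDeriv ℝ i (tr ψ x).1 y =
      iteratedFDeriv ℝ i (fun y => ψ.1 (-y)) (y + (-1 : ℝ) • x) := by
    intro x i y
    have e : (tr ψ x).1 = fun y => (fun y => ψ.1 (-y)) (y - x) := by
      ext y
      simp [tr]
    rw [e, neg_one_smul, ← sub_eq_add_neg]
    exact iteratedFDeriv_comp_sub (f := fun y => ψ.1 (-y)) i x y
  refine integral_mul_eq_of_bound (ι := Fin (N + 1))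
    (F := fun i => (E n) [×(i : ℕ)]→L[ℝ] ℝ) χ.hasCompactSupport
    (fun i =>
      { toFun := fun ψ => iteratedFDeriv ℝ i ψ.1
        map_add' := fun f g => funext fun y =>
          iteratedFDeriv_add_apply ((CInf.contDiff f).of_le (by exact_mod_cast le_top)).contDiffAt
            ((CInf.contDiff g).of_le (by exact_mod_cast le_top)).contDiffAt
        map_smul' := fun c f => funext fun y => iteratedFDeriv_const_smul_apply
          ((CInf.contDiff f).of_le (by exact_mod_cast le_top)).contDiffAt })
    (fun i ψ => (CInf.contDiff ψ).continuous_iteratedFDeriv (by exact_mod_cast le_top))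
    (pairL T χ) (fun w M hM h => hL w M hM fun i hi => h ⟨i, Nat.lt_succ_of_le hi⟩)
    hφ hc (tr ψ) (fun i => ?_) v fun i y => ?_
  · simp only [LinearMap.coe_mk, AddHom.coe_mk, hp]
    exact (hθ.iteratedFDeriv i).contDiff.continuous.comp (by fun_prop)
  · have hv' : v.1 = mollify φ (-1) fun y => ψ.1 (-y) := by
      ext y
      simp [hv, mollify, sub_eq_add_neg]
    simp only [LinearMap.coe_mk, AddHom.coe_mk, hp]
    rw [hv', iteratedFDeriv_mollify (hφ.integrable_of_hasCompactSupport hc) _ hθ, mollify]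

end Pairing

/-! ### Regularization by scaled Schwartz functions -/

section Scaled

open LineDeriv

variable {n : ℕ} {Ω : Opens (E n)}

/-- The function `x ↦ r ^ n ρ (r x)` as an element of `C^∞(ℝⁿ)`. -/
def scaledC (ρ : 𝓢(E n, ℝ)) (r : ℝ) : CInf n := ⟨scaled ρ r, scaled_contDiff ρ r⟩

theorem norm_iteratedFDeriv_scaled (ρ : 𝓢(E n, ℝ)) {r : ℝ} (hr : 0 ≤ r) (i : ℕ) (x : E n) :
    ‖iteratedFDeriv ℝ i (scaled ρ r) x‖ = r ^ (n + i) * ‖iteratedFDeriv ℝ i ρ (r • x)‖ := by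
  have hs : ContDiff ℝ i ρ := ρ.smooth i
  have e : scaled ρ r = r ^ n • fun x => ρ (r • x) := rfl
  have h2 : ContDiff ℝ i fun x => ρ (r • x) := hs.comp (contDiff_id.const_smul r)
  rw [e, iteratedFDeriv_const_smul_apply h2.contDiffAt, iteratedFDeriv_comp_const_smul r hs,
    norm_smul, norm_smul, norm_pow, norm_pow, Real.norm_of_nonneg hr, pow_add, mul_assoc]

theorem bddSmooth_scaledC (ρ : 𝓢(E n, ℝ)) (r : ℝ) : BddSmooth (scaledC ρ r).1 := by
  have h : BddSmooth (fun x => ρ (r • x)) := by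
    refine ⟨(ρ.smooth ⊤).comp (contDiff_id.const_smul r), fun i => ?_⟩
    obtain ⟨C, hC, h⟩ := (BddSmooth.schwartz ρ).bdd i
    refine ⟨|r| ^ i * C, by positivity, fun x => ?_⟩
    rw [iteratedFDeriv_comp_const_smul r (ρ.smooth i), norm_smul, norm_pow, Real.norm_eq_abs]
    gcongr
    exact h _
  exact h.clm_comp (r ^ n • ContinuousLinearMap.id ℝ ℝ)

/-- Each derivative costs one factor `r` and replaces `ρ` by another Schwartz function. The growth
and decay estimates of regularizations are therefore stated for all Schwartz functions, so that
induction on the derivative applies. -/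
theorem dirD_scaledC (v : E n) (ρ : 𝓢(E n, ℝ)) (r : ℝ) :
    dirD v (scaledC ρ r) = r • scaledC (∂_{v} ρ) r := by
  ext x
  have h1 : HasFDerivAt (fun x : E n => r • x) (r • ContinuousLinearMap.id ℝ (E n)) x :=
    (hasFDerivAt_id x).const_smul r
  have h2 := ((ρ.differentiable (r • x)).hasFDerivAt.comp x h1).const_mul (r ^ n)
  change fderiv ℝ (scaled ρ r) x v = r * scaled (∂_{v} ρ) r x
  rw [show scaled ρ r = fun x => r ^ n * (ρ ∘ fun x => r • x) x from rfl, h2.fderiv]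
  simp [scaled, SchwartzMap.lineDerivOp_apply_eq_fderiv]
  ring

/-- The regularization `x ↦ ⟨T, χ ρ_r(x - ·)⟩`, where `ρ_r x = r ^ n ρ (r x)`. -/
def regul (T : 𝓓'(Ω, ℝ)) (χ : 𝓓(Ω, ℝ)) (ρ : 𝓢(E n, ℝ)) (r : ℝ) : CInf n :=
  ⟨fun x => pairL T χ (tr (scaledC ρ r) x), contDiff_pairL_tr T χ (bddSmooth_scaledC ρ r)⟩

theorem regul_apply (T : 𝓓'(Ω, ℝ)) (χ : 𝓓(Ω, ℝ)) (ρ : 𝓢(E n, ℝ)) (r : ℝ) (x : E n) :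
    (regul T χ ρ r).1 x = pairL T χ (tr (scaledC ρ r) x) := rfl

theorem dirD_regul (T : 𝓓'(Ω, ℝ)) (χ : 𝓓(Ω, ℝ)) (ρ : 𝓢(E n, ℝ)) (r : ℝ) (v : E n) :
    dirD v (regul T χ ρ r) = r • regul T χ (∂_{v} ρ) r := by
  ext x
  change fderiv ℝ (fun x => pairL T χ (tr (scaledC ρ r) x)) x v =
    r • pairL T χ (tr (scaledC (∂_{v} ρ) r) x)
  rw [fderiv_pairL_tr T χ (bddSmooth_scaledC ρ r), dirD_scaledC, ← map_smul]
  rfl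

theorem norm_iteratedFDeriv_tr_scaledC (ρ : 𝓢(E n, ℝ)) {r : ℝ} (hr : 0 ≤ r) (i : ℕ) (x y : E n) :
    ‖iteratedFDeriv ℝ i (tr (scaledC ρ r) x).1 y‖ =
      r ^ (n + i) * ‖iteratedFDeriv ℝ i ρ (r • (x - y))‖ := by
  rw [← norm_iteratedFDeriv_scaled ρ hr]
  exact norm_iteratedFDeriv_comp_const_sub (scaled ρ r) x y i

/-- The exponent `n + N` consists of the normalization `r ^ n` and the at most `N` derivatives that
`T` sees. -/
theorem exists_abs_regul_le (T : 𝓓'(Ω, ℝ)) (χ : 𝓓(Ω, ℝ)) (ρ : 𝓢(E n, ℝ)) :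
    ∃ (C : ℝ) (m : ℕ), 0 ≤ C ∧ ∀ r : ℝ, 1 ≤ r → ∀ x, |(regul T χ ρ r).1 x| ≤ C * r ^ m := by
  obtain ⟨C, N, hC, hL⟩ := exists_abs_pairL_le T χ
  choose B hB h using (BddSmooth.schwartz ρ).bdd
  have hs : 0 ≤ ∑ i ∈ Finset.range (N + 1), B i := Finset.sum_nonneg fun i _ => hB i
  refine ⟨C * ∑ i ∈ Finset.range (N + 1), B i, n + N, by positivity, fun r hr x => ?_⟩
  have hr0 : 0 ≤ r := zero_le_one.trans hr
  rw [mul_assoc]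
  refine hL _ _ (by positivity) fun i hi y _ => ?_
  rw [norm_iteratedFDeriv_tr_scaledC ρ hr0, mul_comm]
  gcongr
  · exact (h i _).trans (Finset.single_le_sum (fun i _ => hB i)
      (Finset.mem_range.2 (Nat.lt_succ_of_le hi)))

/-- For `x ∈ K` and `y` in the support of `χ` the distance is at least some `δ > 0`, so `ρ` and its
derivatives are evaluated at distance at least `r δ` from the origin, where they decay faster than
any power. -/
theorem exists_abs_regul_le_of_eq_zero (T : 𝓓'(Ω, ℝ)) (χ : 𝓓(Ω, ℝ)) (ρ : 𝓢(E n, ℝ))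
    {V K : Set (E n)} (hV : IsOpen V) (hχ : ∀ y ∈ V, χ y = 0) (hK : IsCompact K) (hKV : K ⊆ V)
    (m : ℕ) :
    ∃ C : ℝ, 0 ≤ C ∧ ∀ r : ℝ, 1 ≤ r → ∀ x ∈ K, |(regul T χ ρ r).1 x| ≤ C * (r ^ m)⁻¹ := by
  obtain ⟨C, N, hC, hL⟩ := exists_abs_pairL_le T χ
  obtain ⟨δ, hδ, hδK⟩ := hK.exists_thickening_subset_open hV hKV
  -- Of this decay, `n + N` powers compensate the growth caused by scaling and differentiation, and
  -- `m` remain.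
  choose B hB h using fun i => ρ.decay (n + N + m) i
  have hs : 0 ≤ ∑ i ∈ Finset.range (N + 1), B i := Finset.sum_nonneg fun i _ => (hB i).le
  refine ⟨C * ((∑ i ∈ Finset.range (N + 1), B i) * (δ ^ (n + N + m))⁻¹), by positivity,
    fun r hr x hx => ?_⟩
  have hr0 : 0 < r := zero_lt_one.trans_le hr
  rw [mul_assoc]
  refine hL _ _ (by positivity) fun i hi y hy => ?_
  have hd : δ ≤ ‖x - y‖ := by
    by_contra! hlt
    have hyV : y ∈ V := hδK (Metric.mem_thickening_iff.2 ⟨x, hx, by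
      rwa [dist_comm, dist_eq_norm]⟩)
    have : Disjoint V (tsupport χ) := (Set.disjoint_left.2 fun z hz hz' => hz' (hχ z hz) :
      Disjoint V (Function.support χ)).closure_right hV
    exact Set.disjoint_left.1 this hyV hy
  rw [norm_iteratedFDeriv_tr_scaledC ρ hr0.le]
  have h1 : (r * δ) ^ (n + N + m) * ‖iteratedFDeriv ℝ i ρ (r • (x - y))‖ ≤ B i := by
    refine le_trans ?_ (h i (r • (x - y)))
    gcongr
    rw [norm_smul, Real.norm_of_nonneg hr0.le]
    gcongr
  have h2 : B i ≤ ∑ i ∈ Finset.range (N + 1), B i :=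
    Finset.single_le_sum (fun i _ => (hB i).le) (Finset.mem_range.2 (Nat.lt_succ_of_le hi))
  have h3 : r ^ (n + i) ≤ r ^ (n + N) := pow_le_pow_right₀ hr (by omega)
  rw [mul_assoc, ← mul_inv, ← div_eq_mul_inv, le_div_iff₀ (by positivity)]
  calc r ^ (n + i) * ‖iteratedFDeriv ℝ i ρ (r • (x - y))‖ * (δ ^ (n + N + m) * r ^ m)
      ≤ r ^ (n + N) * ‖iteratedFDeriv ℝ i ρ (r • (x - y))‖ * (δ ^ (n + N + m) * r ^ m) := by
        gcongr
    _ = (r * δ) ^ (n + N + m) * ‖iteratedFDeriv ℝ i ρ (r • (x - y))‖ := by ring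
    _ ≤ _ := h1.trans h2

theorem integral_scaled_mul (ρ : 𝓢(E n, ℝ)) {r : ℝ} (hr : 0 < r) (h : E n → ℝ) :
    ∫ z, scaled ρ r z * h z = ∫ z, ρ z * h (r⁻¹ • z) := by
  have h1 := Measure.integral_comp_smul volume (fun z : E n => ρ z * h (r⁻¹ • z)) r
  simp only [smul_smul, inv_mul_cancel₀ hr.ne', one_smul, finrank_euclideanSpace_fin,
    smul_eq_mul] at h1
  rw [abs_of_pos (by positivity)] at h1
  calc ∫ z, scaled ρ r z * h z = ∫ z, r ^ n * (ρ (r • z) * h z) := by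
        simp only [scaled, mul_assoc]
    _ = _ := by rw [integral_const_mul, h1, mul_inv_cancel_left₀ (by positivity)]

/-- Interchanging `T` with the integral moves the mollification from `T` to `φ`, and `φ` mollified
at scale `1 / r` tends to `φ` with all derivatives. First order approximation, the case `m = 0` of
`norm_mollify_sub_le`, is enough. -/
theorem exists_abs_integral_mul_regul_sub_le (T : 𝓓'(Ω, ℝ)) (χ : 𝓓(Ω, ℝ)) {ρ : 𝓢(E n, ℝ)}
    (hρ : IsColombeauMollifier ρ) (φ : CInf n) (hc : HasCompactSupport φ.1) :
    ∃ C : ℝ, ∀ r : ℝ, 1 ≤ r → |(∫ x, φ.1 x * (regul T χ ρ r).1 x) - pairL T χ φ| ≤ C * r⁻¹ := by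
  have hφ : BddSmooth φ.1 := BddSmooth.of_hasCompactSupport (CInf.contDiff φ) hc
  obtain ⟨C, N, hC, hL⟩ := exists_abs_pairL_le T χ
  choose B hB h using fun i => norm_mollify_sub_le hρ (hφ.iteratedFDeriv i) 0
  refine ⟨C * ∑ i ∈ Finset.range (N + 1), B i, fun r hr => ?_⟩
  have hr0 : 0 < r := zero_lt_one.trans_le hr
  let v : CInf n := ⟨mollify ρ r⁻¹ φ.1, contDiff_mollify ρ.integrable _ hφ⟩
  have hv : ∀ y, v.1 y = ∫ x, φ.1 x * (scaledC ρ r).1 (x - y) := by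
    intro y
    rw [← integral_add_right_eq_self (fun x => φ.1 x * (scaledC ρ r).1 (x - y)) y]
    simp only [add_sub_cancel_right, mul_comm (φ.1 _)]
    refine Eq.trans ?_ (integral_scaled_mul ρ hr0 _).symm
    simp [v, mollify, add_comm y]
  simp only [regul_apply]
  rw [integral_mul_pairL_tr T χ (bddSmooth_scaledC ρ r) (CInf.contDiff φ).continuous hc v hv,
    ← map_sub, mul_assoc]
  have hs : 0 ≤ ∑ i ∈ Finset.range (N + 1), B i := Finset.sum_nonneg fun i _ => hB i
  refine hL _ _ (by positivity) fun i hi y _ => ?_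
  have e : iteratedFDeriv ℝ i (v - φ).1 y =
      mollify ρ r⁻¹ (iteratedFDeriv ℝ i φ.1) y - iteratedFDeriv ℝ i φ.1 y := by
    rw [← iteratedFDeriv_mollify ρ.integrable _ hφ]
    exact iteratedFDeriv_sub_apply ((CInf.contDiff v).of_le (by exact_mod_cast le_top)).contDiffAt
      ((CInf.contDiff φ).of_le (by exact_mod_cast le_top)).contDiffAt
  rw [e]
  refine (h i r⁻¹ y).trans ?_
  rw [zero_add, pow_one, abs_of_pos (by positivity)]
  gcongr
  exact Finset.single_le_sum (fun i _ => hB i) (Finset.mem_range.2 (Nat.lt_succ_of_le hi))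

theorem contDiff_testFunction_mul_zeroExt (χ : 𝓓(Ω, ℝ)) (f : Smooth Ω) :
    ContDiff ℝ ∞ fun y => χ y * zeroExt f.1 y := by
  refine contDiff_iff_contDiffAt.2 fun y => ?_
  by_cases hy : y ∈ tsupport χ
  swap
  · refine (contDiffAt_const (c := (0 : ℝ))).congr_of_eventuallyEq ?_
    filter_upwards [(isClosed_tsupport χ).isOpen_compl.mem_nhds hy] with z hz
    rw [image_eq_zero_of_notMem_tsupport hz, zero_mul]
  have hyΩ : y ∈ Ω := χ.tsupport_subset hy
  exact χ.contDiff.contDiffAt.mul (f.2.contDiffAt (Ω.isOpen.mem_nhds hyΩ))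

/-- Substitute `y = x - z` and rescale; the kernel `ρ_r (x - y)` accounts for the negative scale
`-r⁻¹`. -/
theorem regul_toDistr (χ : 𝓓(Ω, ℝ)) (f : Smooth Ω) (ρ : 𝓢(E n, ℝ)) {r : ℝ} (hr : 0 < r)
    (x : E n) :
    (regul (toDistr f) χ ρ r).1 x = mollify ρ (-r⁻¹) (fun y => χ y * zeroExt f.1 y) x := by
  rw [regul_apply, pairL_apply, toDistr_apply]
  rw [← integral_sub_left_eq_self _ volume x]
  refine Eq.trans ?_ ((integral_scaled_mul ρ hr
    fun z => χ (x - z) * zeroExt f.1 (x - z)).trans ?_)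
  · refine integral_congr_ae (Filter.Eventually.of_forall fun z => ?_)
    simp [mulTest_apply, tr, scaledC]
    ring
  · simp [mollify, sub_eq_add_neg]

end Scaled

/-! ### Estimates of derivatives on open sets -/

section Res

open LineDeriv

variable {n : ℕ} {Ω : Opens (E n)}

/-- Restriction `C^∞(ℝⁿ) → C^∞(Ω)`. -/
def resC (Ω : Opens (E n)) : CInf n →ₗ[ℝ] Smooth Ω where
  toFun ψ := ⟨fun x => ψ.1 x, (CInf.contDiff ψ).contDiffOn.congr fun x hx => by
    simp [zeroExt, show x ∈ Ω from hx]⟩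
  map_add' _ _ := rfl
  map_smul' _ _ := rfl

theorem resC_val (ψ : CInf n) (x : Ω) : (resC Ω ψ).1 x = ψ.1 x := rfl

theorem pderiv_resC (i : Fin n) (ψ : CInf n) :
    pderiv i (resC Ω ψ) = resC Ω (dirD (basisVec i) ψ) := by
  refine Smooth.ext fun x => ?_
  have h : zeroExt (resC Ω ψ).1 =ᶠ[𝓝 (x : E n)] ψ.1 := zeroExt_eventuallyEq (fun y => rfl) x
  rw [pderiv_apply, h.fderiv_eq]
  rfl

theorem supOn_smul {K : Set Ω} (c : ℝ) (f : Smooth Ω) : supOn K (c • f) = |c| * supOn K f := by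
  unfold supOn
  simp only [Smooth.smul_val, abs_mul]
  rw [Real.mul_iSup_of_nonneg (abs_nonneg c)]

variable {Ω₀ : Opens (E n)}

/-- Induction on `α`, with `ρ` quantified after `α` because `∂_i` turns the regularization by `ρ`
into `r` times the one by `∂_i ρ`. -/
theorem exists_supOn_partialD_regul_le (T : 𝓓'(Ω₀, ℝ)) (χ : 𝓓(Ω₀, ℝ)) (α : Fin n → ℕ) :
    ∀ ρ : 𝓢(E n, ℝ), ∃ (C : ℝ) (m : ℕ), 0 ≤ C ∧ ∀ r : ℝ, 1 ≤ r → ∀ K : Set Ω,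
      supOn K (partialD α (resC Ω (regul T χ ρ r))) ≤ C * r ^ m := by
  induction α using multiIndex_induction with
  | h0 =>
    intro ρ
    obtain ⟨C, m, hC, h⟩ := exists_abs_regul_le T χ ρ
    refine ⟨C, m, hC, fun r hr K => ?_⟩
    rw [partialD_zero]
    exact supOn_le (by positivity) fun x _ => h r hr x
  | hs α i ih =>
    intro ρ
    obtain ⟨C, m, hC, h⟩ := ih (∂_{(basisVec i : E n)} ρ)
    refine ⟨C, m + 1, hC, fun r hr K => ?_⟩
    rw [partialD_add_single, pderiv_resC, dirD_regul, map_smul, map_smul, supOn_smul,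
      abs_of_nonneg (zero_le_one.trans hr)]
    calc _ ≤ r * (C * r ^ m) := by gcongr; exact h r hr K
      _ = _ := by ring

theorem exists_supOn_partialD_regul_le_of_eq_zero (T : 𝓓'(Ω₀, ℝ)) (χ : 𝓓(Ω₀, ℝ))
    (hχ : ∀ y ∈ Ω, χ y = 0) {K : Set Ω} (hK : IsCompact K) (α : Fin n → ℕ) :
    ∀ (ρ : 𝓢(E n, ℝ)) (m : ℕ), ∃ C : ℝ, 0 ≤ C ∧ ∀ r : ℝ, 1 ≤ r →
      supOn K (partialD α (resC Ω (regul T χ ρ r))) ≤ C * (r ^ m)⁻¹ := by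
  induction α using multiIndex_induction with
  | h0 =>
    intro ρ m
    obtain ⟨C, hC, h⟩ := exists_abs_regul_le_of_eq_zero T χ ρ Ω.isOpen hχ
      (hK.image continuous_subtype_val) (by rintro _ ⟨x, -, rfl⟩; exact x.2) m
    refine ⟨C, hC, fun r hr => ?_⟩
    rw [partialD_zero]
    exact supOn_le (by positivity) fun x hx => h r hr x (Set.mem_image_of_mem _ hx)
  | hs α i ih =>
    intro ρ m
    -- One extra power of decay absorbs the factor `r` produced by the derivative.
    obtain ⟨C, hC, h⟩ := ih (∂_{(basisVec i : E n)} ρ) (m + 1)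
    refine ⟨C, hC, fun r hr => ?_⟩
    have hr0 : 0 < r := zero_lt_one.trans_le hr
    rw [partialD_add_single, pderiv_resC, dirD_regul, map_smul, map_smul, supOn_smul,
      abs_of_pos hr0]
    calc _ ≤ r * (C * (r ^ (m + 1))⁻¹) := by gcongr; exact h r hr
      _ = _ := by field_simp; ring

/-- Mollification as an element of `C^∞(ℝⁿ)`. -/
def mollifyC (ρ : 𝓢(E n, ℝ)) (s : ℝ) (g : CInf n) (hg : BddSmooth g.1) : CInf n :=
  ⟨mollify ρ s g.1, contDiff_mollify ρ.integrable s hg⟩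

theorem dirD_mollifyC (ρ : 𝓢(E n, ℝ)) (s : ℝ) (g : CInf n) (hg : BddSmooth g.1) (v : E n) :
    dirD v (mollifyC ρ s g hg) = mollifyC ρ s (dirD v g) (hg.fderiv_apply v) := by
  ext x
  change fderiv ℝ (mollify ρ s g.1) x v = mollify ρ s (fun x => fderiv ℝ g.1 x v) x
  rw [fderiv_mollify ρ.integrable s hg]
  exact mollify_clm ρ.integrable s hg.fderiv (ContinuousLinearMap.apply ℝ ℝ v) x

theorem dirD_sub (v : E n) (f g : CInf n) : dirD v (f - g) = dirD v f - dirD v g := by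
  ext x
  change fderiv ℝ (f.1 - g.1) x v = _
  rw [fderiv_sub ((CInf.contDiff f).differentiable (by simp) x)
    ((CInf.contDiff g).differentiable (by simp) x)]
  rfl

/-- Here the derivatives fall on `g`, so the mollifier stays fixed and its moment conditions remain
available in the induction. -/
theorem exists_supOn_partialD_mollifyC_sub_le {ρ : 𝓢(E n, ℝ)} (hρ : IsColombeauMollifier ρ)
    (α : Fin n → ℕ) (m : ℕ) : ∀ (g : CInf n) (hg : BddSmooth g.1), ∃ C : ℝ, 0 ≤ C ∧
      ∀ r : ℝ, 1 ≤ r → ∀ K : Set Ω,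
        supOn K (partialD α (resC Ω (mollifyC ρ (-r⁻¹) g hg - g))) ≤ C * (r ^ m)⁻¹ := by
  induction α using multiIndex_induction with
  | h0 =>
    intro g hg
    obtain ⟨C, hC, h⟩ := norm_mollify_sub_le hρ hg m
    refine ⟨C, hC, fun r hr K => ?_⟩
    have hr0 : 0 < r := zero_lt_one.trans_le hr
    rw [partialD_zero]
    refine supOn_le (by positivity) fun x _ => (h _ x).trans ?_
    rw [abs_neg, abs_of_pos (by positivity), inv_pow]
    gcongr
    omega
  | hs α i ih =>
    intro g hg
    obtain ⟨C, hC, h⟩ := ih (dirD (basisVec i) g) (hg.fderiv_apply _)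
    refine ⟨C, hC, fun r hr K => ?_⟩
    rw [partialD_add_single, pderiv_resC, dirD_sub, dirD_mollifyC]
    exact h r hr K

end Res

/-! ### Asymptotic estimates for principal gauges -/

section Gauge

namespace IndexSet

variable {J : IndexSet.{u}}

/-- The threshold `f H` may depend on the constant `H`: both are chosen after the basepoint, and
divergence to `+∞` allows any threshold there. -/
theorem Loc.and_tendsToTop {P : ℝ → J.I → Prop} (hP : Loc P) {x : J.I → ℝ} (hx : J.TendsToTop x)
    (f : ℝ → ℝ) : Loc fun H ε => P H ε ∧ f H < x ε := by
  obtain ⟨A, hA, hP⟩ := hP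
  obtain ⟨B, hB, hx⟩ := hx
  obtain ⟨C, hC, hCAB⟩ := J.inter A hA B hB
  refine ⟨C, hC, fun c hc => ?_⟩
  obtain ⟨H, hH, e₁, he₁, h₁⟩ := hP c (hCAB hc).1
  obtain ⟨e₂, he₂, h₂⟩ := hx c (hCAB hc).2 (f H)
  obtain ⟨⟨d₁, hd₁C, hd₁⟩, -⟩ := J.directed C hC c hc e₁ he₁.2
  obtain ⟨⟨d₂, hd₂C, hd₂⟩, -⟩ := J.directed C hC c hc e₂ he₂.2
  obtain ⟨d, hd, ⟨hdd₁, -⟩, hdd₂, -⟩ := (J.directed C hC c hc c (J.le_refl c)).2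
    d₁ ⟨hd₁C, J.le_trans _ _ _ hd₁ he₁.2⟩ d₂ ⟨hd₂C, J.le_trans _ _ _ hd₂ he₂.2⟩
  refine ⟨H, hH, d, hd, fun ε hε => ⟨h₁ ε ?_, h₂ ε ?_⟩⟩
  · exact ⟨(hCAB hε.1).1, J.le_trans _ _ _ hε.2 (J.le_trans _ _ _ hdd₁ hd₁)⟩
  · exact ⟨(hCAB hε.1).2, J.le_trans _ _ _ hε.2 (J.le_trans _ _ _ hdd₂ hd₂)⟩

theorem Loc.exists {P : ℝ → J.I → Prop} (hP : Loc P) : ∃ H : ℝ, 0 < H ∧ ∃ ε, P H ε := by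
  obtain ⟨A, hA, hP⟩ := hP
  have hne : A.Nonempty := by
    rw [Set.nonempty_iff_ne_empty]
    rintro rfl
    exact J.empty_notMem hA
  obtain ⟨a, ha⟩ := hne
  obtain ⟨H, hH, e, he, h⟩ := hP a ha
  exact ⟨H, hH, e, h e ⟨he.1, J.le_refl e⟩⟩

theorem Loc.ev {P : J.I → Prop} (hP : Loc fun _ => P) : J.Ev P := by
  obtain ⟨A, hA, hP⟩ := hP
  exact ⟨A, hA, fun a ha => (hP a ha).choose_spec.2⟩

end IndexSet

open IndexSet

namespace PAG

variable (X : PAG.{u})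

theorem exists_bigO_pow {z : X.J.I → ℝ} (hz : z ∈ X.B) : ∃ m : ℕ, X.J.BigO z (X.b ^ m) := by
  have h : z ∈ X.J.moderateNets (X.J.powers X.b) := by
    rw [X.generates]
    exact mem_moderateNets_of_mem hz
  obtain ⟨_, ⟨m, rfl⟩, h⟩ := h
  exact ⟨m, h⟩

theorem exists_pow_bigO (m : ℕ) : ∃ c ∈ X.B, X.J.BigO (X.b ^ m) c := by
  have h : X.b ^ m ∈ X.J.moderateNets X.B := by
    rw [← X.generates]
    exact mem_moderateNets_of_mem ⟨m, rfl⟩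
  exact h

/-- The gauge contains a net tending to `+∞`, which is dominated by a power of `b`; at an index with
`|b| ≤ M` that net would be at most `H * |M| ^ m`. -/
theorem ev_lt_abs_generator (M : ℝ) : X.J.Ev fun ε => M < |X.b ε| := by
  obtain ⟨i, hi, htop⟩ := X.isAG.infinite
  obtain ⟨m, hm⟩ := X.exists_bigO_pow hi
  refine Loc.ev ((hm.loc.and_tendsToTop htop fun H => H * |M| ^ m).mono fun H hH =>
    ⟨1, one_pos, fun ε h => ?_⟩)
  obtain ⟨h₁, h₂⟩ := h
  by_contra! hle
  have : |X.b ε| ^ m ≤ |M| ^ m :=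
    pow_le_pow_left₀ (abs_nonneg _) (hle.trans (le_abs_self M)) m
  rw [Pi.pow_apply, abs_pow] at h₁
  nlinarith [le_abs_self (i ε)]

end PAG

variable {n : ℕ} {X : PAG.{u}} {Ω : Opens (E n)}

/-- Powers of `b` are dominated by elements of the gauge, and indices with `|b| < 1` may be ignored
because `|b|` is eventually greater than `1`. -/
theorem isModerate_of_pow_le {u : X.J.I → Smooth Ω}
    (h : ∀ K : Set Ω, IsCompact K → ∀ α, ∃ (C : ℝ) (m : ℕ), 0 ≤ C ∧
      ∀ ε, 1 ≤ |X.b ε| → supOn K (partialD α (u ε)) ≤ C * |X.b ε| ^ m) :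
    IsModerate X.B Ω u := by
  intro K hK α
  obtain ⟨C, m, hC, h⟩ := h K hK α
  obtain ⟨c, hc, hO⟩ := X.exists_pow_bigO m
  refine ⟨c, hc, BigO.trans (y := X.b ^ m) ?_ hO⟩
  refine (X.ev_lt_abs_generator 1).loc.mono fun _ _ => ⟨C + 1, by positivity, fun ε hε => ?_⟩
  rw [abs_of_nonneg (supOn_nonneg _), Pi.pow_apply, abs_pow]
  refine (h ε hε.le).trans ?_
  gcongr
  linarith

/-- A positive `z` in the gauge satisfies `z ≤ H |b| ^ m` for some `m`, hence `|b| ^ (-m) ≤ H / z`;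
it suffices to beat every power of `|b|`. -/
theorem isNegligible_of_le_pow_inv {u : X.J.I → Smooth Ω}
    (h : ∀ K : Set Ω, IsCompact K → ∀ α, ∀ m : ℕ, ∃ C : ℝ, 0 ≤ C ∧
      ∀ ε, 1 ≤ |X.b ε| → supOn K (partialD α (u ε)) ≤ C * (|X.b ε| ^ m)⁻¹) :
    IsNegligible X.B Ω u := by
  intro K hK α z hz hpos
  obtain ⟨m, hm⟩ := X.exists_bigO_pow hz
  obtain ⟨C, hC, h⟩ := h K hK α m
  have h₁ : Loc (J := X.J) fun H ε => |z ε| ≤ H * |(X.b ^ m) ε| ∧ 0 < z ε :=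
    hm.loc.and hpos.loc fun H _ hH _ => ⟨H, hH, fun ε h h' => ⟨h, h'⟩⟩
  refine h₁.and (X.ev_lt_abs_generator 1).loc fun H _ hH _ =>
    ⟨(C + 1) * H, by positivity, fun ε hε hb => ?_⟩
  obtain ⟨hzb, hz0⟩ := hε
  have hb0 : 0 < |X.b ε| ^ m := pow_pos (zero_lt_one.trans hb) m
  have hz0' : 0 < |z ε| := abs_pos.2 hz0.ne'
  rw [Pi.pow_apply, abs_pow] at hzb
  rw [abs_of_nonneg (supOn_nonneg _), abs_inv]
  calc supOn K (partialD α (u ε)) ≤ C * (|X.b ε| ^ m)⁻¹ := h ε hb.le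
    _ ≤ (C + 1) * (H * |z ε|⁻¹) := by
      gcongr
      · linarith
      · rw [inv_le_iff_one_le_mul₀ hb0, mul_right_comm, ← div_eq_mul_inv, le_div_iff₀ hz0', one_mul]
        exact hzb
    _ = _ := by ring

/-- Take a net `i` of the gauge tending to `+∞` and a positive `s` dominating it. Negligibility
against `s` bounds `supOn K u * |i|` by some `H`, and `i` exceeds `H / δ`. A single such index
suffices for the injectivity arguments. -/
theorem IsNegligible.exists_supOn_le {u : X.J.I → Smooth Ω} (hu : IsNegligible X.B Ω u)
    {K : Set Ω} (hK : IsCompact K) (M : ℝ) {δ : ℝ} (hδ : 0 < δ) :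
    ∃ ε, M < |X.b ε| ∧ supOn K (u ε) ≤ δ := by
  obtain ⟨i, hi, htop⟩ := X.isAG.infinite
  obtain ⟨s, hs, hpos, hO⟩ := X.isAG.add i hi i hi
  have h := hu K hK 0 s hs hpos
  have h₁ : Loc (J := X.J) fun H ε => supOn K (u ε) * |i ε| ≤ H := by
    refine h.loc.and hO.loc fun H₁ H₂ p₁ p₂ => ⟨H₁ * H₂, by positivity, fun ε h₁ h₂ => ?_⟩
    rw [partialD_zero, abs_of_nonneg (supOn_nonneg _), abs_inv] at h₁
    have h₃ : |i ε| ≤ H₂ * |s ε| := by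
      refine le_trans ?_ h₂
      rw [Pi.add_apply, Pi.abs_apply]
      exact (le_add_of_nonneg_left (abs_nonneg _)).trans (le_abs_self _)
    rcases (abs_nonneg (s ε)).eq_or_lt with h0 | h0
    · rw [← h0, mul_zero] at h₃
      rw [le_antisymm h₃ (abs_nonneg _), mul_zero]
      positivity
    · calc _ ≤ (H₁ * |s ε|⁻¹) * (H₂ * |s ε|) := by gcongr
        _ = _ := by field_simp
  have h₂ := (h₁.and (X.ev_lt_abs_generator M).loc
    (R := fun H ε => supOn K (u ε) * |i ε| ≤ H ∧ M < |X.b ε|)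
    fun H _ hH _ => ⟨H, hH, fun ε h h' => ⟨h, h'⟩⟩).and_tendsToTop htop fun H => H / δ
  obtain ⟨H, hH, ε, ⟨h₃, hM⟩, h₄⟩ := h₂.exists
  refine ⟨ε, hM, ?_⟩
  rw [div_lt_iff₀ hδ] at h₄
  have hi0 : 0 < i ε := by
    by_contra! hle
    nlinarith
  rw [abs_of_pos hi0] at h₃
  have : supOn K (u ε) * i ε ≤ δ * i ε := by linarith
  exact le_of_mul_le_mul_right this hi0

/-! ### Localization -/

theorem supOn_resSmooth {Ω' : Opens (E n)} (h : Ω' ≤ Ω) {K : Set Ω} {K' : Set Ω'}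
    (hK : IsCompact K') (f : Smooth Ω)
    (hf : ∀ x ∈ K, f.1 x ≠ 0 → ∃ y ∈ K', Set.inclusion h y = x) :
    supOn K f ≤ supOn K' (resSmooth h f) := by
  refine supOn_le (supOn_nonneg _) fun x hx => ?_
  by_cases h0 : f.1 x = 0
  · rw [h0, abs_zero]
    exact supOn_nonneg _
  · obtain ⟨y, hy, rfl⟩ := hf x hx h0
    exact le_supOn hK (resSmooth h f) hy

/-- The preimage in `Ω'` of a compact set of `Ω` which is contained in `Ω'`. -/
theorem isCompact_preimage_inclusion {Ω' : Opens (E n)} (h : Ω' ≤ Ω) {K : Set Ω} (hK : IsCompact K)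
    (hKΩ : ∀ x ∈ K, (x : E n) ∈ Ω') : IsCompact (Set.inclusion h ⁻¹' K) := by
  rw [Subtype.isCompact_iff]
  convert hK.image continuous_subtype_val using 1
  ext x
  constructor
  · rintro ⟨y, hy, rfl⟩
    exact ⟨_, hy, rfl⟩
  · rintro ⟨y, hy, rfl⟩
    exact ⟨⟨y, hKΩ y hy⟩, hy, rfl⟩

theorem isModerate_of_local {u : X.J.I → Smooth Ω}
    (h : ∀ K : Set Ω, IsCompact K → ∃ (V : Opens (E n)) (hV : V ≤ Ω),
      (∀ x ∈ K, (x : E n) ∈ V) ∧ IsModerate X.B V fun ε => resSmooth hV (u ε)) :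
    IsModerate X.B Ω u := by
  intro K hK α
  obtain ⟨V, hV, hKV, h⟩ := h K hK
  have hK' := isCompact_preimage_inclusion hV hK hKV
  obtain ⟨b, hb, h⟩ := h _ hK' α
  refine ⟨b, hb, BigO.of_le (fun ε => ?_) h⟩
  rw [abs_of_nonneg (supOn_nonneg _), abs_of_nonneg (supOn_nonneg _), ← resSmooth_partialD]
  exact supOn_resSmooth hV hK' _ fun x hx _ => ⟨⟨x, hKV x hx⟩, hx, rfl⟩

theorem isNegligible_of_local {u : X.J.I → Smooth Ω}
    (h : ∀ K : Set Ω, IsCompact K → ∃ (V : Opens (E n)) (hV : V ≤ Ω),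
      (∀ x ∈ K, (x : E n) ∈ V) ∧ IsNegligible X.B V fun ε => resSmooth hV (u ε)) :
    IsNegligible X.B Ω u := by
  intro K hK α z hz hpos
  obtain ⟨V, hV, hKV, h⟩ := h K hK
  have hK' := isCompact_preimage_inclusion hV hK hKV
  refine BigO.of_le (fun ε => ?_) (h _ hK' α z hz hpos)
  rw [abs_of_nonneg (supOn_nonneg _), abs_of_nonneg (supOn_nonneg _), ← resSmooth_partialD]
  exact supOn_resSmooth hV hK' _ fun x hx _ => ⟨⟨x, hKV x hx⟩, hx, rfl⟩

theorem partialD_eq_zero_of_eq_zero {f : Smooth Ω} {W : Set (E n)} (hW : IsOpen W)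
    (hf : ∀ x : Ω, (x : E n) ∈ W → f.1 x = 0) (α : Fin n → ℕ) (x : Ω) (hx : (x : E n) ∈ W) :
    (partialD α f).1 x = 0 := by
  let V : Opens (E n) := ⟨W, hW⟩ ⊓ Ω
  have hV : V ≤ Ω := inf_le_right
  have h0 : resSmooth hV f = 0 := Smooth.ext fun y => hf ⟨y, hV y.2⟩ y.2.1
  have h := resSmooth_partialD hV α f
  rw [h0, map_zero] at h
  exact congrArg (fun g : Smooth V => g.1 ⟨x, hx, x.2⟩) h

/-- The product and its derivatives vanish off `S`, so a compact `K` may be replaced by `K ∩ S`,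
which lies in `V`, where `d` is negligible and `η` is moderate. -/
theorem IsNegligible.mul_of_support {V : Opens (E n)} (hV : V ≤ Ω) {S : Set (E n)}
    (hS : IsClosed S) (hSV : S ⊆ V) {η : Smooth Ω} (hη : ∀ x : Ω, (x : E n) ∉ S → η.1 x = 0)
    {d : X.J.I → Smooth Ω} (hd : IsNegligible X.B V fun ε => resSmooth hV (d ε)) :
    IsNegligible X.B Ω fun ε => η * d ε := by
  have hm : IsNegligible X.B V ((fun _ => resSmooth hV η) * fun ε => resSmooth hV (d ε)) :=
    IsNegligible.mul X.isAG (isModerate_const X.isAG _) hd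
  intro K hK α z hz hpos
  have hK₁ : IsCompact (K ∩ {x : Ω | (x : E n) ∈ S}) :=
    hK.inter_right (hS.preimage continuous_subtype_val)
  have hK' := isCompact_preimage_inclusion hV hK₁ fun x hx => hSV hx.2
  refine BigO.of_le (fun ε => ?_) (hm _ hK' α z hz hpos)
  rw [abs_of_nonneg (supOn_nonneg _), abs_of_nonneg (supOn_nonneg _), Pi.mul_apply, ← map_mul,
    ← resSmooth_partialD]
  refine supOn_resSmooth hV hK' _ fun x hx hne => ?_
  have hxS : (x : E n) ∈ S := by
    by_contra hxS
    refine hne (partialD_eq_zero_of_eq_zero hS.isOpen_compl (fun y hy => ?_) α x hxS)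
    rw [Smooth.mul_val, hη y hy, zero_mul]
  exact ⟨⟨x, hSV hxS⟩, ⟨hx, hxS⟩, rfl⟩

end Gauge

/-! ### Cutoff functions and exhaustions -/

section Cutoff

open scoped Manifold

variable {n : ℕ}

theorem exists_testFunction_one_nhds {Ω W : Opens (E n)} (hW : W ≤ Ω) {K : Set (E n)}
    (hK : IsCompact K) (hKW : K ⊆ W) :
    ∃ (χ : 𝓓(Ω, ℝ)) (V : Opens (E n)), K ⊆ V ∧ V ≤ W ∧ tsupport χ ⊆ W ∧ ∀ y ∈ V, χ y = 1 := by
  obtain ⟨L, hL, hKL, hLW⟩ := exists_compact_between hK W.isOpen hKW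
  obtain ⟨f, hf1, hf0, -⟩ := exists_contMDiffMap_one_nhds_of_subset_interior (n := ⊤)
    𝓘(ℝ, E n) hK.isClosed hKL
  have hsupp : tsupport f ⊆ L := closure_minimal (fun x hx => by
    by_contra hxL
    exact hx (hf0 x hxL)) hL.isClosed
  obtain ⟨U, hU, hKU, hU1⟩ := mem_nhdsSet_iff_exists.1 hf1
  refine ⟨⟨f, f.contMDiff.contDiff, hL.of_isClosed_subset (isClosed_tsupport _) hsupp,
    hsupp.trans (hLW.trans hW)⟩, ⟨U, hU⟩ ⊓ W, fun x hx => ⟨hKU hx, hKW hx⟩, inf_le_right,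
    hsupp.trans hLW, fun y hy => hU1 hy.1⟩

/-- The sets `V k` are the interiors of a compact exhaustion; a cut-off equal to `1` near the `k`-th
compact set fits into `V (k + 1)`. -/
theorem exists_exhaustion (Ω : Opens (E n)) :
    ∃ (V : ℕ → Opens (E n)) (χ : ℕ → 𝓓(Ω, ℝ)), Monotone V ∧ (∀ k, V k ≤ Ω) ∧
      (∀ K : Set Ω, IsCompact K → ∃ k, ∀ x ∈ K, (x : E n) ∈ V k) ∧
      (∀ k, ∀ y ∈ V k, χ k y = 1) ∧ ∀ k, tsupport (χ k) ⊆ V (k + 1) := by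
  have : LocallyCompactSpace Ω := Ω.isOpen.locallyCompactSpace
  let K : CompactExhaustion Ω := default
  let V : ℕ → Opens (E n) := fun k =>
    ⟨Subtype.val '' interior (K k), Ω.isOpen.isOpenMap_subtype_val _ isOpen_interior⟩
  have hVΩ : ∀ k, V k ≤ Ω := by
    rintro k _ ⟨x, -, rfl⟩
    exact x.2
  have hKV : ∀ k, Subtype.val '' K k ⊆ (V (k + 1) : Set (E n)) := fun k =>
    Set.image_mono (K.subset_interior_succ k)
  have hχ : ∀ k, ∃ χ : 𝓓(Ω, ℝ), (∀ y ∈ V k, χ y = 1) ∧ tsupport χ ⊆ V (k + 1) := by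
    intro k
    obtain ⟨χ, U, hKU, -, hs, h1⟩ := exists_testFunction_one_nhds (hVΩ (k + 1))
      ((K.isCompact k).image continuous_subtype_val) (hKV k)
    exact ⟨χ, fun y hy => h1 y (hKU (Set.image_mono interior_subset hy)), hs⟩
  choose χ hχ1 hχs using hχ
  refine ⟨V, χ, monotone_nat_of_le_succ fun k => ?_, hVΩ, fun L hL => ?_, hχ1, hχs⟩
  · exact (Set.image_mono interior_subset).trans (hKV k)
  · obtain ⟨k, hk⟩ := hL.elim_directed_cover (fun k => interior (K k)) (fun _ => isOpen_interior)
      (fun x _ => by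
        obtain ⟨k, hk⟩ := K.exists_mem x
        exact Set.mem_iUnion.2 ⟨k + 1, K.subset_interior_succ k hk⟩)
      (Monotone.directed_le fun i j hij => interior_mono (K.subset hij))
    exact ⟨k, fun x hx => ⟨x, hk hx, rfl⟩⟩

/-- A test function as an element of `C^∞(ℝⁿ)`. -/
def testC {Ω : Opens (E n)} (χ : 𝓓(Ω, ℝ)) : CInf n := ⟨χ, χ.contDiff⟩

/-- A distribution vanishes on test functions supported away from its support. -/
theorem apply_eq_zero_of_disjoint_dsupport {Ω : Opens (E n)} (T : 𝓓'(Ω, ℝ)) (φ : 𝓓(Ω, ℝ))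
    (h : Disjoint (tsupport φ) (Distribution.dsupport T)) : T φ = 0 := by
  have hloc : ∀ x : tsupport φ, ∃ s : Set (E n), Distribution.IsVanishingOn T s ∧ IsOpen s ∧
      (x : E n) ∈ s := fun x =>
    (Distribution.notMem_dsupport_iff _).1 (Set.disjoint_left.1 h x.2)
  choose s hs hso hxs using hloc
  -- A partition of unity subordinate to open sets on which `T` vanishes splits `φ` into finitely
  -- many pieces, each of which `T` annihilates.
  obtain ⟨f, hf⟩ := SmoothPartitionOfUnity.exists_isSubordinate 𝓘(ℝ, E n)
    (isClosed_tsupport φ) s hso fun x hx => Set.mem_iUnion.2 ⟨⟨x, hx⟩, hxs _⟩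
  have hfin : {i | (Function.support (f i) ∩ tsupport φ).Nonempty}.Finite :=
    f.locallyFinite.finite_nonempty_inter_compact φ.hasCompactSupport
  have hsum : φ = ∑ i ∈ hfin.toFinset, mulTest φ ⟨f i, (f i).contMDiff.contDiff⟩ := by
    ext y
    have e : (∑ i ∈ hfin.toFinset, mulTest φ ⟨f i, (f i).contMDiff.contDiff⟩) y =
        ∑ i ∈ hfin.toFinset, φ y * f i y := by
      rw [FunLike.coe_sum, Finset.sum_apply]
      rfl
    rw [e, ← Finset.mul_sum]
    by_cases hy : y ∈ tsupport φ
    · have h1 := f.sum_eq_one hy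
      rw [finsum_eq_sum_of_support_subset (s := hfin.toFinset)] at h1
      · rw [h1, mul_one]
      · intro i hi
        rw [Set.Finite.coe_toFinset]
        exact ⟨y, hi, hy⟩
    · rw [image_eq_zero_of_notMem_tsupport hy, zero_mul]
  rw [hsum, map_sum]
  refine Finset.sum_eq_zero fun i _ => hs i _ ?_
  exact (tsupport_mul_subset_right (f := φ) (g := f i)).trans (hf i)

end Cutoff

/-! ### Separation and gluing in Colombeau algebras -/

section Gluing

variable {n : ℕ} {X : PAG.{u}} {Ω : Opens (E n)}

theorem cls_eq_zero {u : X.J.I → Smooth Ω} {hu : IsModerate X.B Ω u} :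
    cls u hu = 0 ↔ IsNegligible X.B Ω u :=
  Ideal.Quotient.eq_zero_iff_mem

theorem GAlg.eq_of_local {U U' : GAlg X Ω} (h : ∀ K : Set Ω, IsCompact K →
    ∃ (V : Opens (E n)) (hV : V ≤ Ω), (∀ x ∈ K, (x : E n) ∈ V) ∧ resG X hV U = resG X hV U') :
    U = U' := by
  obtain ⟨u, hu, rfl⟩ := cls_surjective U
  obtain ⟨v, hv, rfl⟩ := cls_surjective U'
  refine cls_eq.2 (isNegligible_of_local fun K hK => ?_)
  obtain ⟨V, hV, hKV, h⟩ := h K hK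
  rw [resG_cls, resG_cls, cls_eq] at h
  refine ⟨V, hV, hKV, ?_⟩
  convert h using 2
  exact map_sub (resSmooth hV) _ _

theorem constEmb_mul_eq_zero {V : Opens (E n)} (hV : V ≤ Ω) {S : Set (E n)}
    (hS : IsClosed S) (hSV : S ⊆ V) {η : Smooth Ω} (hη : ∀ x : Ω, (x : E n) ∉ S → η.1 x = 0)
    {D : GAlg X Ω} (hD : resG X hV D = 0) :
    cls (fun _ => η) (isModerate_const X.isAG η) * D = 0 := by
  obtain ⟨d, hd, rfl⟩ := cls_surjective D
  rw [resG_cls, cls_eq_zero] at hD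
  rw [cls_mul, cls_eq_zero]
  exact hD.mul_of_support hV hS hSV hη

theorem Smooth.sum_val {ι : Type*} (s : Finset ι) (f : ι → Smooth Ω) (x : Ω) :
    (∑ i ∈ s, f i).1 x = ∑ i ∈ s, (f i).1 x := by
  classical
  induction s using Finset.induction_on with
  | empty => simp [Smooth.zero_val]
  | insert a s ha ih => rw [Finset.sum_insert ha, Finset.sum_insert ha, Smooth.add_val, ih]

/-- A function which agrees locally with smooth functions is smooth. -/
theorem exists_smooth_of_local {V : ℕ → Opens (E n)} (hV : ∀ k, V k ≤ Ω)
    (hcov : ∀ x : Ω, ∃ k, (x : E n) ∈ V k) (s : ℕ → Smooth Ω)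
    (hs : ∀ k l, k ≤ l → ∀ x : Ω, (x : E n) ∈ V k → (s l).1 x = (s k).1 x) :
    ∃ w : Smooth Ω, ∀ k, resSmooth (hV k) w = resSmooth (hV k) (s k) := by
  choose m hm using hcov
  let w : Ω → ℝ := fun x => (s (m x)).1 x
  have hw : ∀ k (x : Ω), (x : E n) ∈ V k → w x = (s k).1 x := by
    intro k x hx
    rcases le_total (m x) k with h | h
    · exact (hs _ _ h x (hm x)).symm
    · exact hs _ _ h x hx
  have hsm : ContDiffOn ℝ ∞ (zeroExt w) Ω := by
    intro x hx
    have hxV := hm ⟨x, hx⟩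
    have h1 : zeroExt w =ᶠ[𝓝 x] zeroExt (s (m ⟨x, hx⟩)).1 := by
      filter_upwards [(V (m ⟨x, hx⟩)).isOpen.mem_nhds hxV] with y hy
      rw [zeroExt_mem w ⟨y, hV _ hy⟩, zeroExt_mem _ ⟨y, hV _ hy⟩]
      exact hw _ ⟨y, hV _ hy⟩ hy
    exact (((s _).2.contDiffAt (Ω.isOpen.mem_nhds hx)).congr_of_eventuallyEq h1).contDiffWithinAt
  exact ⟨⟨w, hsm⟩, fun k => Smooth.ext fun x => hw k ⟨x, hV k x.2⟩ x.2⟩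

/-- Gluing along an exhaustion. -/
theorem exists_glue {V : ℕ → Opens (E n)} (χ : ℕ → 𝓓(Ω, ℝ)) (hmono : Monotone V)
    (hV : ∀ k, V k ≤ Ω) (hcov : ∀ K : Set Ω, IsCompact K → ∃ k, ∀ x ∈ K, (x : E n) ∈ V k)
    (hχ1 : ∀ k, ∀ y ∈ V k, χ k y = 1) (hχs : ∀ k, tsupport (χ k) ⊆ V (k + 1))
    (U : ℕ → GAlg X Ω)
    (hU : ∀ k, resG X (hV (k + 1)) (U (k + 1)) = resG X (hV (k + 1)) (U k)) :
    ∃ W : GAlg X Ω, ∀ k, resG X (hV k) W = resG X (hV k) (U k) := by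
  choose u hu hcls using fun k => cls_surjective (U k)
  let η : ℕ → Smooth Ω := fun k => resC Ω (testC (χ k))
  -- The representatives `u k` agree on overlaps only up to negligible nets. The telescoping sums `s
  -- M` repair this: `1 - η k` vanishes on `V k`, so `s M` no longer changes on `V k` for `M ≥ k`.
  let t : ℕ → X.J.I → Smooth Ω := fun k ε => (1 - η k) * (u (k + 1) ε - u k ε)
  let s : ℕ → X.J.I → Smooth Ω := fun M ε => u 0 ε + ∑ k ∈ Finset.range M, t k ε
  have hη : ∀ k (x : Ω), (x : E n) ∈ V k → (1 - η k).1 x = 0 := fun k x hx => by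
    change (1 : ℝ) - χ k x = 0
    rw [hχ1 k x hx, sub_self]
  have hs : ∀ ε k l, k ≤ l → ∀ x : Ω, (x : E n) ∈ V k → (s l ε).1 x = (s k ε).1 x := by
    intro ε k l hkl x hx
    simp only [s, Smooth.add_val, Smooth.sum_val]
    congr 1
    refine (Finset.sum_subset (Finset.range_mono hkl) fun j _ hj => ?_).symm
    rw [Smooth.mul_val, hη j x (hmono (by simpa using hj) hx), zero_mul]
  choose w hw using fun ε => exists_smooth_of_local hV
    (fun x => (hcov {x} isCompact_singleton).imp fun k hk => hk x rfl) (fun k => s k ε) (hs ε)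
  have hsM : ∀ M, ∃ h : IsModerate X.B Ω (s M), cls (s M) h = U M := by
    intro M
    induction M with
    | zero =>
      have e : s 0 = u 0 := by
        ext1 ε
        simp [s]
      rw [e]
      exact ⟨hu 0, hcls 0⟩
    | succ M ih =>
      obtain ⟨h, hU'⟩ := ih
      have hd : IsModerate X.B Ω (u (M + 1) - u M) :=
        (EM X Ω).sub_mem (hu (M + 1)) (hu M)
      have hcd : cls (u (M + 1) - u M) hd = U (M + 1) - U M := by
        rw [← hcls (M + 1), ← hcls M]
        rfl
      -- The support of `χ M` lies in `V (M + 1)`, where `U (M + 1)` and `U M` agree. Thus `η M`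
      -- annihilates the difference, and adding `t M` changes the class from `U M` to `U (M + 1)`.
      have hη0 := constEmb_mul_eq_zero (X := X) (hV (M + 1)) (isClosed_tsupport (χ M)) (hχs M)
        (η := η M) (fun x hx =>
          (image_eq_zero_of_notMem_tsupport (f := χ M) hx : χ M x = 0)) (D := U (M + 1) - U M)
        (by rw [map_sub, hU, sub_self])
      have hm : IsModerate X.B Ω (t M) := (isModerate_const X.isAG (1 - η M)).mul X.isAG hd
      have e : s (M + 1) = s M + t M := by
        ext1 ε
        simp [s, Finset.sum_range_succ, add_assoc]
      have ht : cls (t M) hm = U (M + 1) - U M := by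
        have h1 : cls (fun _ => 1 - η M) (isModerate_const X.isAG (1 - η M)) =
            1 - cls (fun _ => η M) (isModerate_const X.isAG (η M)) := rfl
        have h2 : cls (t M) hm = cls (fun _ => 1 - η M) (isModerate_const X.isAG (1 - η M)) *
            cls (u (M + 1) - u M) hd := rfl
        rw [h2, h1, hcd, sub_mul, hη0, one_mul, sub_zero]
      rw [e]
      refine ⟨h.add X.isAG hm, ?_⟩
      rw [← cls_add h hm, hU', ht, add_sub_cancel]
  have hwm : IsModerate X.B Ω w := isModerate_of_local fun K hK => by
    obtain ⟨k, hk⟩ := hcov K hK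
    refine ⟨V k, hV k, hk, ?_⟩
    simp only [hw]
    exact (hsM k).choose.res (hV k)
  refine ⟨cls w hwm, fun k => ?_⟩
  obtain ⟨h, hU'⟩ := hsM k
  rw [← hU', resG_cls, resG_cls]
  exact cls_congr fun ε => hw ε k

end Gluing

/-! ### Classes of regularizations -/

section RegG

variable {n : ℕ} (ρ : 𝓢(E n, ℝ)) (X : PAG.{u}) {Ω₀ Ω₁ : Opens (E n)}

theorem isModerate_regul (T : 𝓓'(Ω₀, ℝ)) (χ : 𝓓(Ω₀, ℝ)) (Ω : Opens (E n)) :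
    IsModerate X.B Ω fun ε => resC Ω (regul T χ ρ |X.b ε|) :=
  isModerate_of_pow_le fun K _ α => by
    obtain ⟨C, m, hC, h⟩ := exists_supOn_partialD_regul_le (Ω := Ω) T χ α ρ
    exact ⟨C, m, hC, fun ε hε => h _ hε K⟩

/-- The class in `𝓖(B, Ω)` of the net `x ↦ ⟨T, χ ρ_ε(x - ·)⟩`. -/
def regG (T : 𝓓'(Ω₀, ℝ)) (χ : 𝓓(Ω₀, ℝ)) (Ω : Opens (E n)) : GAlg X Ω :=
  cls (fun ε => resC Ω (regul T χ ρ |X.b ε|)) (isModerate_regul ρ X T χ Ω)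

variable {ρ X}

theorem resG_regG {Ω Ω' : Opens (E n)} (h : Ω' ≤ Ω) (T : 𝓓'(Ω₀, ℝ)) (χ : 𝓓(Ω₀, ℝ)) :
    resG X h (regG ρ X T χ Ω) = regG ρ X T χ Ω' := rfl

theorem regG_congr_pairL {T : 𝓓'(Ω₀, ℝ)} {χ : 𝓓(Ω₀, ℝ)} {T' : 𝓓'(Ω₁, ℝ)} {χ' : 𝓓(Ω₁, ℝ)}
    (h : pairL T χ = pairL T' χ') (Ω : Opens (E n)) : regG ρ X T χ Ω = regG ρ X T' χ' Ω :=
  cls_congr fun ε => Smooth.ext fun x => by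
    rw [resC_val, resC_val, regul_apply, regul_apply, h]

theorem regG_add_left (T T' : 𝓓'(Ω₀, ℝ)) (χ : 𝓓(Ω₀, ℝ)) (Ω : Opens (E n)) :
    regG ρ X (T + T') χ Ω = regG ρ X T χ Ω + regG ρ X T' χ Ω := rfl

theorem regG_smul_left (c : ℝ) (T : 𝓓'(Ω₀, ℝ)) (χ : 𝓓(Ω₀, ℝ)) (Ω : Opens (E n)) :
    regG ρ X (c • T) χ Ω = c • regG ρ X T χ Ω := rfl

theorem pairL_sub_right (T : 𝓓'(Ω₀, ℝ)) (χ χ' : 𝓓(Ω₀, ℝ)) (ψ : CInf n) :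
    pairL T (χ - χ') ψ = pairL T χ ψ - pairL T χ' ψ := by
  rw [pairL_apply, pairL_apply, pairL_apply, ← map_sub]
  congr 1
  ext y
  simp [mulTest_apply, sub_mul]

theorem regG_sub_right (T : 𝓓'(Ω₀, ℝ)) (χ χ' : 𝓓(Ω₀, ℝ)) (Ω : Opens (E n)) :
    regG ρ X T (χ - χ') Ω = regG ρ X T χ Ω - regG ρ X T χ' Ω := by
  refine Eq.trans (cls_congr fun ε => ?_) (rfl : cls ((fun ε => resC Ω (regul T χ ρ |X.b ε|)) -
    fun ε => resC Ω (regul T χ' ρ |X.b ε|))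
    ((EM X Ω).sub_mem (isModerate_regul ρ X T χ Ω) (isModerate_regul ρ X T χ' Ω)) = _)
  rw [Pi.sub_apply, ← map_sub]
  congr 1
  ext x
  exact pairL_sub_right T χ χ' _

theorem regG_eq_zero (T : 𝓓'(Ω₀, ℝ)) {χ : 𝓓(Ω₀, ℝ)} {Ω : Opens (E n)}
    (hχ : ∀ y ∈ Ω, χ y = 0) : regG ρ X T χ Ω = 0 :=
  cls_eq_zero.2 <| isNegligible_of_le_pow_inv fun _ hK α m => by
    obtain ⟨C, hC, h⟩ := exists_supOn_partialD_regul_le_of_eq_zero T χ hχ hK α ρ m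
    exact ⟨C, hC, fun ε hε => h _ hε⟩

/-- Locality of the regularization: the difference of the two cut-offs vanishes on `Ω` and
contributes a negligible net there. -/
theorem regG_congr_right (T : 𝓓'(Ω₀, ℝ)) {χ χ' : 𝓓(Ω₀, ℝ)} {Ω : Opens (E n)}
    (hχ : ∀ y ∈ Ω, χ y = χ' y) : regG ρ X T χ Ω = regG ρ X T χ' Ω := by
  rw [← sub_eq_zero, ← regG_sub_right]
  exact regG_eq_zero T fun y hy => sub_eq_zero.2 (hχ y hy)

theorem pairL_derivDistr (i : Fin n) (T : 𝓓'(Ω₀, ℝ)) (χ : 𝓓(Ω₀, ℝ)) (ψ : CInf n) :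
    pairL (derivDistr i T) χ ψ = - pairL T χ (dirD (basisVec i) ψ) -
      pairL T (TestFunction.lineDerivCLM ℝ (basisVec i) χ) ψ := by
  have h : TestFunction.lineDerivCLM ℝ (basisVec i) (mulTest χ ψ) =
      mulTest χ (dirD (basisVec i) ψ) +
        mulTest (TestFunction.lineDerivCLM ℝ (basisVec i) χ) ψ := by
    ext y
    have hχ : DifferentiableAt ℝ χ y := χ.contDiff.differentiable (by simp) y
    have hψ : DifferentiableAt ℝ ψ.1 y := (CInf.contDiff ψ).differentiable (by simp) y
    have e : (mulTest χ ψ : E n → ℝ) = χ * ψ.1 := rfl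
    rw [add_apply, mulTest_apply, mulTest_apply, TestFunction.lineDerivCLM_apply,
      TestFunction.lineDerivCLM_apply, if_pos (by simp), if_pos (by simp), e,
      (hχ.mul hψ).lineDeriv_eq_fderiv, hχ.lineDeriv_eq_fderiv, fderiv_mul hχ hψ]
    simp [dirD]
    ring
  have h1 : pairL (derivDistr i T) χ ψ =
      -T (TestFunction.lineDerivCLM ℝ (basisVec i) (mulTest χ ψ)) := rfl
  rw [h1, h, map_add, neg_add, sub_eq_add_neg]
  rfl

theorem dirD_tr (v : E n) (ψ : CInf n) (x : E n) : dirD v (tr ψ x) = - tr (dirD v ψ) x := by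
  ext y
  have h : HasFDerivAt (fun y : E n => x - y) (-ContinuousLinearMap.id ℝ (E n)) y :=
    (hasFDerivAt_id y).const_sub x
  have h1 := ((CInf.contDiff ψ).differentiable (by simp) (x - y)).hasFDerivAt.comp y h
  change fderiv ℝ (ψ.1 ∘ fun y => x - y) y v = -(fderiv ℝ ψ.1 (x - y) v)
  rw [h1.fderiv]
  simp

/-- The product rule: the second term is due to the derivative of the cut-off and disappears
wherever `χ` is locally constant. -/
theorem derivG_regG (i : Fin n) (T : 𝓓'(Ω₀, ℝ)) (χ : 𝓓(Ω₀, ℝ)) (Ω : Opens (E n)) :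
    derivG i (regG ρ X T χ Ω) = regG ρ X (derivDistr i T) χ Ω +
      regG ρ X T (TestFunction.lineDerivCLM ℝ (basisVec i) χ) Ω := by
  rw [regG, derivG_cls, regG, regG, cls_add]
  refine cls_congr fun ε => ?_
  rw [Pi.add_apply, pderiv_resC, ← map_add]
  congr 1
  ext x
  have h : (dirD (basisVec i) (regul T χ ρ |X.b ε|)).1 x =
      pairL T χ (tr (dirD (basisVec i) (scaledC ρ |X.b ε|)) x) :=
    fderiv_pairL_tr T χ (bddSmooth_scaledC ρ _) x _
  change (dirD (basisVec i) (regul T χ ρ |X.b ε|)).1 x = pairL (derivDistr i T) χ _ + pairL T _ _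
  rw [h, pairL_derivDistr, dirD_tr, map_neg, neg_neg, sub_add_cancel]

/-- The regularization of `f` is the mollification of the compactly supported smooth function `χ f`,
which differs from `χ f` by less than any power of `1 / r`, and `χ f = f` on `V`. -/
theorem regG_toDistr (hρ : IsColombeauMollifier ρ) (f : Smooth Ω₀) {χ : 𝓓(Ω₀, ℝ)}
    {V : Opens (E n)} (hV : V ≤ Ω₀) (hχ : ∀ y ∈ V, χ y = 1) :
    regG ρ X (toDistr f) χ V = cls (fun _ => resSmooth hV f) (isModerate_const X.isAG _) := by
  let g : CInf n := ⟨fun y => χ y * zeroExt f.1 y, contDiff_testFunction_mul_zeroExt χ f⟩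
  have hg : BddSmooth g.1 := BddSmooth.of_hasCompactSupport (CInf.contDiff g)
    χ.hasCompactSupport.mul_right
  refine cls_eq.2 (isNegligible_of_le_pow_inv fun K hK α m => ?_)
  obtain ⟨C, hC, h⟩ := exists_supOn_partialD_mollifyC_sub_le (Ω := V) hρ α m g hg
  refine ⟨C, hC, fun ε hε => ?_⟩
  convert h _ hε K using 3
  refine Smooth.ext fun x => ?_
  have hr := regul_toDistr χ f ρ (zero_lt_one.trans_le hε) x
  change (regul (toDistr f) χ ρ |X.b ε|).1 x - f.1 ⟨x, hV x.2⟩ =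
    mollify ρ (-|X.b ε|⁻¹) g.1 x - χ x * zeroExt f.1 x
  rw [hr, hχ x x.2, one_mul, ← zeroExt_mem f.1 ⟨x, hV x.2⟩]

/-- Extension of a test function by zero. -/
def extTest (h : Ω₁ ≤ Ω₀) (χ : 𝓓(Ω₁, ℝ)) : 𝓓(Ω₀, ℝ) :=
  ⟨χ, χ.contDiff, χ.hasCompactSupport, χ.tsupport_subset.trans h⟩

theorem pairL_resDistr (h : Ω₁ ≤ Ω₀) (T : 𝓓'(Ω₀, ℝ)) (χ : 𝓓(Ω₁, ℝ)) :
    pairL (resDistr h T) χ = pairL T (extTest h χ) := by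
  ext ψ
  exact resDistr_apply h T _

/-- The product of a distribution with a test function. -/
def mulDistr (χ : 𝓓(Ω₀, ℝ)) (T : 𝓓'(Ω₀, ℝ)) : 𝓓'(Ω₀, ℝ) :=
  T.comp <| TestFunction.limitCLM ℝ (fun φ => mulTest φ (testC χ))
    (fun _ hK => TestFunction.ofSupportedInCLM ℝ hK ∘L
      ContDiffMapSupportedIn.bilinLeftCLM (ContinuousLinearMap.mul ℝ ℝ) χ.contDiff)
    fun _ _ _ => rfl

theorem mulDistr_apply (χ : 𝓓(Ω₀, ℝ)) (T : 𝓓'(Ω₀, ℝ)) (φ : 𝓓(Ω₀, ℝ)) :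
    mulDistr χ T φ = T (mulTest φ (testC χ)) := rfl

end RegG

/-! ### The embedding of distributions -/

section Embedding

variable {n : ℕ} (ρ : 𝓢(E n, ℝ)) {X : PAG.{u}} {Ω : Opens (E n)}

theorem resG_resG {Ω' Ω'' : Opens (E n)} (h : Ω' ≤ Ω) (h' : Ω'' ≤ Ω') (U : GAlg X Ω) :
    resG X h' (resG X h U) = resG X (h'.trans h) U := by
  obtain ⟨u, hu, rfl⟩ := cls_surjective U
  rfl

/-- `U` is locally given by the regularization of cut-offs of `T`. -/
def IsRegularization (T : 𝓓'(Ω, ℝ)) (U : GAlg X Ω) : Prop :=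
  ∀ (V : Opens (E n)) (h : V ≤ Ω) (χ : 𝓓(Ω, ℝ)), (∀ y ∈ V, χ y = 1) →
    resG X h U = regG ρ X T χ V

variable {ρ}

theorem GAlg.eq_of_forall_test {U U' : GAlg X Ω} (h : ∀ (V : Opens (E n)) (hV : V ≤ Ω)
    (χ : 𝓓(Ω, ℝ)), (∀ y ∈ V, χ y = 1) → resG X hV U = resG X hV U') : U = U' := by
  refine GAlg.eq_of_local fun K hK => ?_
  obtain ⟨χ, V, hKV, hV, -, hχ⟩ := exists_testFunction_one_nhds (le_refl Ω)
    (hK.image continuous_subtype_val) (by rintro _ ⟨x, -, rfl⟩; exact x.2)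
  exact ⟨V, hV, fun x hx => hKV (Set.mem_image_of_mem _ hx), h V hV χ hχ⟩

/-- Every compact subset of `Ω` has a neighbourhood on which some cut-off is `1`, and elements that
agree on all such sets are equal. -/
theorem IsRegularization.eq {T : 𝓓'(Ω, ℝ)} {U U' : GAlg X Ω} (h : IsRegularization ρ T U)
    (h' : IsRegularization ρ T U') : U = U' :=
  GAlg.eq_of_forall_test fun V hV χ hχ => (h V hV χ hχ).trans (h' V hV χ hχ).symm

variable (ρ X) in
theorem exists_isRegularization (T : 𝓓'(Ω, ℝ)) : ∃ U : GAlg X Ω, IsRegularization ρ T U := by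
  obtain ⟨V, χ, hmono, hV, hcov, hχ1, hχs⟩ := exists_exhaustion Ω
  obtain ⟨U, hU⟩ := exists_glue (X := X) χ hmono hV hcov hχ1 hχs
    -- The shift to `χ (k + 1)` makes consecutive cut-offs both equal to `1` on `V (k + 1)`, as the
    -- gluing condition requires.
    (fun k => regG ρ X T (χ (k + 1)) Ω) fun k => by
      rw [resG_regG, resG_regG]
      refine regG_congr_right T fun y hy => ?_
      rw [hχ1 _ y hy, hχ1 _ y (hmono (Nat.le_succ _) hy)]
  refine ⟨U, fun W hW η hη => GAlg.eq_of_local fun K hK => ?_⟩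
  obtain ⟨k, hk⟩ := hcov (Set.inclusion hW '' K) (hK.image (continuous_inclusion hW))
  refine ⟨V k ⊓ W, inf_le_right, fun x hx => ⟨hk _ (Set.mem_image_of_mem _ hx), x.2⟩, ?_⟩
  rw [resG_resG, ← resG_resG (hV k) inf_le_left, hU, resG_regG, resG_regG, resG_regG]
  refine regG_congr_right T fun y hy => ?_
  rw [hη y hy.2, hχ1 _ y (hmono (Nat.le_succ _) hy.1)]

theorem IsRegularization.add {T T' : 𝓓'(Ω, ℝ)} {U U' : GAlg X Ω} (h : IsRegularization ρ T U)
    (h' : IsRegularization ρ T' U') : IsRegularization ρ (T + T') (U + U') := fun V hV χ hχ => by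
  rw [map_add, h V hV χ hχ, h' V hV χ hχ, regG_add_left]

theorem IsRegularization.smul (c : ℝ) {T : 𝓓'(Ω, ℝ)} {U : GAlg X Ω}
    (h : IsRegularization ρ T U) : IsRegularization ρ (c • T) (c • U) := fun V hV χ hχ => by
  rw [map_smul, h V hV χ hχ, regG_smul_left]

theorem IsRegularization.res {Ω' : Opens (E n)} (hΩ : Ω' ≤ Ω) {T : 𝓓'(Ω, ℝ)} {U : GAlg X Ω}
    (h : IsRegularization ρ T U) : IsRegularization ρ (resDistr hΩ T) (resG X hΩ U) :=
  fun V hV χ hχ => by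
    rw [resG_resG, h V (hV.trans hΩ) (extTest hΩ χ) hχ]
    exact (regG_congr_pairL (pairL_resDistr hΩ T χ) V).symm

theorem IsRegularization.deriv (i : Fin n) {T : 𝓓'(Ω, ℝ)} {U : GAlg X Ω}
    (h : IsRegularization ρ T U) : IsRegularization ρ (derivDistr i T) (derivG i U) :=
  fun V hV χ hχ => by
    have e : resG X hV (derivG i U) = derivG i (resG X hV U) := (resDAlg X hV).map_D i U
    rw [e, h V hV χ hχ, derivG_regG, regG_eq_zero T (χ := TestFunction.lineDerivCLM ℝ _ χ),
      add_zero]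
    intro y hy
    -- The cut-off is constant on the open set `V`, so its derivative, and with it the extra term,
    -- vanishes there.
    have h1 : χ =ᶠ[𝓝 y] fun _ => 1 :=
      Filter.eventually_of_mem (V.isOpen.mem_nhds hy) fun z hz => hχ z hz
    rw [TestFunction.lineDerivCLM_apply, if_pos (by simp),
      (χ.contDiff.differentiable (by simp) y).lineDeriv_eq_fderiv, h1.fderiv_eq]
    simp

theorem isRegularization_toDistr (hρ : IsColombeauMollifier ρ) (f : Smooth Ω) :
    IsRegularization ρ (toDistr f) (cls (X := X) (fun _ => f) (isModerate_const X.isAG f)) :=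
  fun V hV χ hχ => by
    rw [regG_toDistr hρ f hV hχ, resG_cls]

/-- A test function equal to `1` near the support of `T` may be used globally. -/
theorem isRegularization_regG (T : 𝓓'(Ω, ℝ)) {χ : 𝓓(Ω, ℝ)}
    (hχ : ∀ᶠ y in 𝓝ˢ (Distribution.dsupport T), χ y = 1) :
    IsRegularization ρ T (regG ρ X T χ Ω) := fun V hV η hη => by
  rw [resG_regG]
  -- The test function `η - χ η` vanishes near the support of `T`, so the cut-offs `η` and `χ η`
  -- give the same regularization; on `V`, where `η = 1`, the latter agrees with `χ`.
  have h : pairL T η = pairL T (mulTest χ (testC η)) := by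
    ext ψ
    rw [← sub_eq_zero, ← pairL_sub_right, pairL_apply]
    refine apply_eq_zero_of_disjoint_dsupport T _ (Set.disjoint_left.2 fun y hy hyT => ?_)
    refine notMem_tsupport_iff_eventuallyEq.2 ?_ hy
    filter_upwards [hχ.filter_mono (nhds_le_nhdsSet hyT)] with z hz
    change (η z - χ z * η z) * ψ.1 z = 0
    rw [hz, one_mul, sub_self, zero_mul]
  rw [regG_congr_pairL h]
  refine regG_congr_right T fun y hy => ?_
  rw [mulTest_apply]
  change χ y = χ y * η y
  rw [hη y hy, mul_one]

theorem pairL_mulDistr {T : 𝓓'(Ω, ℝ)} {χ χ' : 𝓓(Ω, ℝ)} (h : ∀ y ∈ tsupport χ, χ' y = 1) :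
    pairL (mulDistr χ T) χ' = pairL T χ := by
  ext ψ
  rw [pairL_apply, mulDistr_apply, pairL_apply]
  congr 1
  ext y
  change χ' y * ψ.1 y * χ y = χ y * ψ.1 y
  by_cases hy : y ∈ tsupport χ
  · rw [h y hy]
    ring
  · rw [image_eq_zero_of_notMem_tsupport hy]
    ring

theorem dsupport_mulDistr_subset (χ : 𝓓(Ω, ℝ)) (T : 𝓓'(Ω, ℝ)) :
    Distribution.dsupport (mulDistr χ T) ⊆ tsupport χ := by
  intro x hx
  rw [Distribution.mem_dsupport_iff] at hx
  refine hx _ (fun φ hφ => ?_) (isClosed_tsupport χ)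
  rw [mulDistr_apply]
  have h0 : mulTest φ (testC χ) = 0 := by
    ext y
    change φ y * χ y = 0
    by_cases hy : y ∈ tsupport χ
    · rw [image_eq_zero_of_notMem_tsupport fun hy' => hφ hy' hy, zero_mul]
    · rw [image_eq_zero_of_notMem_tsupport hy, mul_zero]
  rw [h0, map_zero]

theorem resDistr_mulDistr {V : Opens (E n)} (hV : V ≤ Ω) {χ : 𝓓(Ω, ℝ)} (hχ : ∀ y ∈ V, χ y = 1)
    (T : 𝓓'(Ω, ℝ)) : resDistr hV (mulDistr χ T) = resDistr hV T := by
  ext φ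
  rw [resDistr_apply, resDistr_apply, mulDistr_apply]
  congr 1
  ext y
  change φ y * χ y = φ y
  by_cases hy : y ∈ tsupport φ
  · rw [hχ y (φ.tsupport_subset hy), mul_one]
  · rw [image_eq_zero_of_notMem_tsupport hy, zero_mul]

/-- A regularization determines the distribution. -/
theorem IsRegularization.eq_zero (hρ : IsColombeauMollifier ρ) {T : 𝓓'(Ω, ℝ)}
    (h : IsRegularization ρ T (0 : GAlg X Ω)) : T = 0 := by
  ext φ
  obtain ⟨χ, V, hKV, hV, -, hχ⟩ := exists_testFunction_one_nhds (le_refl Ω) φ.hasCompactSupport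
    φ.tsupport_subset
  have h0 : regG ρ X T χ V = 0 := (h V hV χ hχ).symm.trans (map_zero _)
  have hneg : IsNegligible X.B V fun ε => resC V (regul T χ ρ |X.b ε|) := cls_eq_zero.1 h0
  have hT : pairL T χ (testC φ) = T φ := by
    rw [pairL_apply]
    congr 1
    ext y
    change χ y * φ y = φ y
    by_cases hy : y ∈ tsupport φ
    · rw [hχ y (hKV hy), one_mul]
    · rw [image_eq_zero_of_notMem_tsupport hy, mul_zero]
  obtain ⟨C, hC⟩ := exists_abs_integral_mul_regul_sub_le T χ hρ (testC φ) φ.hasCompactSupport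
  have hK : IsCompact ((↑) ⁻¹' tsupport φ : Set V) := by
    rw [Subtype.isCompact_iff]
    refine (congrArg IsCompact ?_).mpr φ.hasCompactSupport
    exact Subtype.image_preimage_coe (V : Set (E n)) _ |>.trans (Set.inter_eq_right.2 hKV)
  have hint : Integrable φ := φ.continuous.integrable_of_hasCompactSupport φ.hasCompactSupport
  change T φ = 0
  rw [← hT]
  by_contra hne
  set a := |pairL T χ (testC φ)| with ha
  have ha0 : 0 < a := abs_pos.2 hne
  set A := ∫ x, ‖φ x‖ with hA
  have hA0 : 0 ≤ A := integral_nonneg fun _ => norm_nonneg _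
  -- The constants make the error of weak convergence at most `a / 2` and the integral of `φ`
  -- against the regularization at most `a / 4`, which contradicts `a = |T φ|`. The maximum with `1`
  -- ensures `|b_ε| ≥ 1`, and `A + 1` avoids division by zero.
  obtain ⟨ε, hε, hs⟩ := hneg.exists_supOn_le hK (max 1 (2 * |C| / a)) (δ := a / (4 * (A + 1)))
    (by positivity)
  have hε1 : 1 ≤ |X.b ε| := (le_max_left _ _).trans hε.le
  have h1 := hC _ hε1
  have h2 : |∫ x, (testC φ).1 x * (regul T χ ρ |X.b ε|).1 x| ≤ A * (a / (4 * (A + 1))) := by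
    rw [hA, ← integral_mul_const, ← Real.norm_eq_abs]
    refine norm_integral_le_of_norm_le (hint.norm.mul_const _)
      (Filter.Eventually.of_forall fun x => ?_)
    rw [norm_mul]
    change ‖φ x‖ * _ ≤ _
    by_cases hx : x ∈ tsupport φ
    · gcongr
      exact (le_supOn hK _ (x := ⟨x, hKV hx⟩) hx).trans hs
    · rw [image_eq_zero_of_notMem_tsupport hx, norm_zero, zero_mul, zero_mul]
  have h3 : C * |X.b ε|⁻¹ ≤ a / 2 := by
    have h4 : 2 * |C| / a < |X.b ε| := (le_max_right _ _).trans_lt hε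
    rw [div_lt_iff₀ ha0] at h4
    rw [← div_eq_mul_inv, div_le_iff₀ (by linarith)]
    linarith [le_abs_self C]
  have h5 : A * (a / (4 * (A + 1))) ≤ a / 4 := by
    rw [mul_div_assoc', div_le_div_iff₀ (by positivity) (by positivity)]
    nlinarith
  have h6 := abs_sub_abs_le_abs_sub (pairL T χ (testC φ))
    (∫ x, (testC φ).1 x * (regul T χ ρ |X.b ε|).1 x)
  rw [abs_sub_comm] at h6
  linarith

theorem cls_const_injective (Ω : Opens (E n)) : Function.Injective fun f : Smooth Ω =>
    (cls (fun _ => f) (isModerate_const X.isAG f) : GAlg X Ω) := by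
  intro f g h
  have h : IsNegligible X.B Ω (fun _ => f - g) := cls_eq.1 h
  refine Smooth.ext fun x => ?_
  by_contra hne
  have h0 : 0 < |f.1 x - g.1 x| := abs_pos.2 (sub_ne_zero.2 hne)
  obtain ⟨ε, -, hs⟩ := h.exists_supOn_le (isCompact_singleton (x := x)) 0 (half_pos h0)
  have : |f.1 x - g.1 x| ≤ _ := (le_supOn isCompact_singleton (f - g) rfl).trans hs
  linarith

variable (ρ X Ω) in
/-- The linear map `T ↦ [T * ρ_ε]`, obtained by gluing. -/
def regEmbedding : 𝓓'(Ω, ℝ) →ₗ[ℝ] GAlg X Ω where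
  toFun T := (exists_isRegularization ρ X T).choose
  map_add' T T' := (exists_isRegularization ρ X (T + T')).choose_spec.eq
    ((exists_isRegularization ρ X T).choose_spec.add (exists_isRegularization ρ X T').choose_spec)
  map_smul' c T := (exists_isRegularization ρ X (c • T)).choose_spec.eq
    ((exists_isRegularization ρ X T).choose_spec.smul c)

theorem isRegularization_regEmbedding (T : 𝓓'(Ω, ℝ)) :
    IsRegularization ρ T (regEmbedding ρ X Ω T) :=
  (exists_isRegularization ρ X T).choose_spec

theorem IsRegularization.regEmbedding_eq {T : 𝓓'(Ω, ℝ)} {U : GAlg X Ω}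
    (h : IsRegularization ρ T U) : regEmbedding ρ X Ω T = U :=
  (isRegularization_regEmbedding T).eq h

variable (ρ X) in
theorem isMollifierEmbedding_regEmbedding :
    IsMollifierEmbedding ρ X fun Ω => regEmbedding (n := n) ρ X Ω where
  natural _ _ h T := ((isRegularization_regEmbedding T).res h).regEmbedding_eq.symm
  compact Ω T χ hχ := ⟨_, isModerate_regul ρ X T χ Ω, fun _ _ => rfl,
    (isRegularization_regG T hχ).regEmbedding_eq⟩

/-- The defining conditions prescribe `i` only on compactly supported distributions. For `χ = 1` on
`V`, the distribution `χ T` is one and has the same restriction to `V` as `T`, so naturality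
determines `i Ω T` on `V`. -/
theorem IsMollifierEmbedding.isRegularization
    {i : ∀ Ω : Opens (E n), 𝓓'(Ω, ℝ) →ₗ[ℝ] (colombeauPresheaf X n).obj (op Ω)}
    (hi : IsMollifierEmbedding ρ X i) (T : 𝓓'(Ω, ℝ)) :
    IsRegularization ρ T (i Ω T : GAlg X Ω) := fun V hV χ hχ => by
  obtain ⟨χ', W, hKW, -, -, hχ'⟩ := exists_testFunction_one_nhds (le_refl Ω) χ.hasCompactSupport
    χ.tsupport_subset
  obtain ⟨u, hu, hu', hcls⟩ := hi.compact Ω (mulDistr χ T) χ'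
    (Filter.eventually_of_mem (W.isOpen.mem_nhdsSet.2
      ((dsupport_mulDistr_subset χ T).trans hKW)) hχ')
  have h1 : i Ω (mulDistr χ T) = regG ρ X T χ Ω := by
    rw [hcls, ← regG_congr_pairL (pairL_mulDistr fun y hy => hχ' y (hKW hy)) Ω]
    exact cls_congr fun ε => Smooth.ext fun x => hu' ε x
  rw [hi.natural Ω V hV T, ← resDistr_mulDistr hV hχ T, ← hi.natural Ω V hV, h1, resG_regG]

theorem IsMollifierEmbedding.eq_regEmbedding
    {i : ∀ Ω : Opens (E n), 𝓓'(Ω, ℝ) →ₗ[ℝ] (colombeauPresheaf X n).obj (op Ω)}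
    (hi : IsMollifierEmbedding ρ X i) : i = fun Ω => regEmbedding ρ X Ω :=
  funext fun _ => LinearMap.ext fun T => (hi.isRegularization T).regEmbedding_eq.symm

variable (ρ X n) in
-- An embedding exists, so the chosen one satisfies the characterization, and uniqueness identifies
-- it.
theorem mollifierEmbedding_eq :
    mollifierEmbedding ρ X = fun Ω : Opens (E n) => regEmbedding ρ X Ω :=
  (Classical.epsilon_spec (p := IsMollifierEmbedding ρ X)
    ⟨_, isMollifierEmbedding_regEmbedding ρ X⟩).eq_regEmbedding

theorem isRegularization_mollifierEmbedding (T : 𝓓'(Ω, ℝ)) :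
    IsRegularization ρ T (mollifierEmbedding ρ X Ω T : GAlg X Ω) := by
  rw [mollifierEmbedding_eq]
  exact isRegularization_regEmbedding T

theorem isRegularization_multiDeriv (T : 𝓓'(Ω, ℝ)) {U : GAlg X Ω} (h : IsRegularization ρ T U)
    (α : Fin n → ℕ) : IsRegularization ρ (multiDeriv derivDistr α T)
      (multiDeriv (fun i => (derivG i : Derivation ℝ (GAlg X Ω) (GAlg X Ω)).toLinearMap) α U) := by
  unfold multiDeriv
  have hpow : ∀ (i : Fin n) (k : ℕ) {T : 𝓓'(Ω, ℝ)} {U : GAlg X Ω}, IsRegularization ρ T U →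
      IsRegularization ρ ((derivDistr i ^ k) T)
        (((derivG i : Derivation ℝ (GAlg X Ω) (GAlg X Ω)).toLinearMap ^ k) U) := by
    intro i k
    induction k with
    | zero => exact id
    | succ k ih =>
      intro T U h
      rw [pow_succ, pow_succ]
      exact ih (h.deriv i)
  rw [List.ofFn_eq_map, List.ofFn_eq_map]
  induction List.finRange n with
  | nil => exact h
  | cons i l ih =>
    rw [List.map_cons, List.map_cons, List.prod_cons, List.prod_cons]
    exact hpow i (α i) ih

variable (X) in
theorem isCol_mollifierEmbedding (hρ : IsColombeauMollifier ρ) :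
    IsCol (colombeauPresheaf X n) (constEmb X) (mollifierEmbedding ρ X) where
  natural Ω Ω' h T := ((isRegularization_mollifierEmbedding T).res h).eq
    (isRegularization_mollifierEmbedding _)
  ker_eq_bot Ω := LinearMap.ker_eq_bot'.2 fun T hT => by
    have h := isRegularization_mollifierEmbedding (ρ := ρ) (X := X) T
    rw [hT] at h
    exact h.eq_zero hρ
  incl_injective Ω := cls_const_injective Ω
  smooth Ω f := (isRegularization_mollifierEmbedding _).eq (isRegularization_toDistr hρ f)
  deriv Ω α T := (isRegularization_mollifierEmbedding _).eq
    (isRegularization_multiDeriv T (isRegularization_mollifierEmbedding T) α)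

end Embedding

/-! ### Change of the asymptotic gauge -/

section Functoriality

open IndexSet

variable {n : ℕ} {X Y : PAG.{u}} {Ω : Opens (E n)}

theorem IsModerate.comp_hom (f : PAG.Hom X Y) {u : X.J.I → Smooth Ω} (hu : IsModerate X.B Ω u) :
    IsModerate Y.B Ω fun ε => u (f.f ε) := by
  intro K hK α
  obtain ⟨c, hc, h⟩ := hu K hK α
  have hm : c ∘ f.f ∈ Y.J.moderateNets Y.B := by
    rw [← f.moderate]
    exact mem_moderateNets_of_mem ⟨c, hc, rfl⟩
  obtain ⟨d, hd, h'⟩ := hm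
  exact ⟨d, hd, (h.comp f.isMor).trans h'⟩

/-- A positive `z` in the target gauge is dominated by some `c ∘ f`, and `c` by a positive `s` in
the source gauge; negligibility against `s` pulls back to negligibility against `z`. -/
theorem IsNegligible.comp_hom (f : PAG.Hom X Y) {u : X.J.I → Smooth Ω}
    (hu : IsNegligible X.B Ω u) : IsNegligible Y.B Ω fun ε => u (f.f ε) := by
  intro K hK α z hz hpos
  have hm : z ∈ Y.J.moderateNets {x | ∃ c ∈ X.B, x = c ∘ f.f} := by
    rw [f.moderate]
    exact mem_moderateNets_of_mem hz
  obtain ⟨_, ⟨c, hc, rfl⟩, hzc⟩ := hm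
  obtain ⟨s, hs, hs0, hcs⟩ := X.isAG.add c hc c hc
  have hcs' : X.J.BigO c s := BigO.of_le (fun ε => by
    rw [Pi.add_apply, Pi.abs_apply]
    exact (le_add_of_nonneg_left (abs_nonneg _)).trans (le_abs_self _)) hcs
  have hzs := hzc.trans (hcs'.comp f.isMor)
  have h := (hu K hK α s hs hs0).comp f.isMor
  have h₁ : Loc (J := Y.J) fun H ε => |z ε| ≤ H * |s (f.f ε)| ∧ 0 < z ε :=
    hzs.loc.and hpos.loc fun H _ hH _ => ⟨H, hH, fun ε h h' => ⟨h, h'⟩⟩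
  refine BigO.trans h (h₁.mono fun H hH => ⟨H, hH, fun ε hε => ?_⟩)
  obtain ⟨hle, hz0⟩ := hε
  have hz0' : 0 < |z ε| := abs_pos.2 hz0.ne'
  -- That `s ∘ f` is nonzero follows here from its dominating `z > 0`, without pulling back the
  -- positivity of `s`.
  have hs' : 0 < |s (f.f ε)| := by
    by_contra! h0
    rw [le_antisymm h0 (abs_nonneg _), mul_zero] at hle
    linarith
  change |(s (f.f ε))⁻¹| ≤ _
  rw [abs_inv, abs_inv, ← div_eq_mul_inv, le_div_iff₀ hz0', inv_mul_le_iff₀ hs', mul_comm]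
  exact hle

variable (Ω) in
/-- The map `[u_ε] ↦ [u_{f ε}]`. -/
def mapG (f : PAG.Hom X Y) : GAlg X Ω →ₐ[ℝ] GAlg Y Ω :=
  Ideal.quotientMapₐ (negl Y Ω)
    { toFun := fun u : Moderate X Ω => (⟨fun ε => u.1 (f.f ε), u.2.comp_hom f⟩ : Moderate Y Ω)
      map_one' := rfl
      map_mul' := fun _ _ => rfl
      map_zero' := rfl
      map_add' := fun _ _ => rfl
      commutes' := fun _ => rfl }
    (fun u (hu : IsNegligible X.B Ω u.1) => hu.comp_hom f)

variable (n) in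
/-- The morphism of presheaves of differential algebras `[u_ε] ↦ [u_{f ε}]`. -/
def mapPresheaf (f : PAG.Hom X Y) : colombeauPresheaf X n ⟶ colombeauPresheaf Y n where
  app Ω := ⟨mapG Ω.unop f, fun i U => by
    obtain ⟨u, hu, rfl⟩ := cls_surjective (X := X) (Ω := Ω.unop) U
    rfl⟩
  naturality Ω Ω' h := by
    refine DAlg.Hom.ext (AlgHom.ext fun U => ?_)
    obtain ⟨u, hu, rfl⟩ := cls_surjective (X := X) (Ω := Ω.unop) U
    rfl

theorem IsRegularization.map {ρ : 𝓢(E n, ℝ)} (f : PAG.Hom X Y) {T : 𝓓'(Ω, ℝ)} {U : GAlg X Ω}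
    (h : IsRegularization ρ T U) : IsRegularization ρ T (mapG Ω f U) := fun V hV χ hχ => by
  have e : resG Y hV (mapG Ω f U) = mapG V f (resG X hV U) := by
    obtain ⟨u, hu, rfl⟩ := cls_surjective U
    rfl
  rw [e, h V hV χ hχ]
  refine cls_congr fun ε => ?_
  -- Since `b₁ ∘ f = b₂`, reindexing the regularizing net along `f` gives the net for `b₂` exactly,
  -- not merely up to negligible nets.
  rw [← f.generator]
  rfl

theorem mapPresheaf_mollifierEmbedding (ρ : 𝓢(E n, ℝ)) (f : PAG.Hom X Y) (T : 𝓓'(Ω, ℝ)) :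
    ((mapPresheaf n f).app (op Ω)).φ (mollifierEmbedding ρ X Ω T) = mollifierEmbedding ρ Y Ω T :=
  ((isRegularization_mollifierEmbedding T).map f).eq (isRegularization_mollifierEmbedding T)

end Functoriality

end Colombeau

end

/-! ### The functor from principal gauges to Colombeau algebras -/

theorem mainTheorem2 (n : ℕ) (hn : 0 < n) (ρ : 𝓢(E n, ℝ)) (hρ : IsColombeauMollifier ρ) :
    (∀ X : PAG.{u}, ∃! i, IsMollifierEmbedding ρ X i) ∧
    ∃ (hCol : ∀ X : PAG.{u},
        IsCol (colombeauPresheaf X n) (constEmb X) (mollifierEmbedding ρ X))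
      (M : ∀ {X Y : PAG.{u}}, (X ⟶ Y) →
        ((⟨colombeauPresheaf X n, constEmb X, mollifierEmbedding ρ X, hCol X⟩ : Col.{u} n) ⟶
          ⟨colombeauPresheaf Y n, constEmb Y, mollifierEmbedding ρ Y, hCol Y⟩)),
      (∀ {X Y : PAG.{u}} (f : X ⟶ Y) (Ω : Opens (E n)) (u : X.J.I → Smooth Ω)
        (hu : IsModerate X.B Ω u), ∃ hu' : IsModerate Y.B Ω (fun ε => u (f.f ε)),
        ((M f).φ.app (op Ω)).φ (cls u hu) = cls (fun ε => u (f.f ε)) hu') ∧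
      ∃ F : PAG.{u} ⥤ Col.{u} n,
        F.toPrefunctor =
          { obj := fun X =>
              ⟨colombeauPresheaf X n, constEmb X, mollifierEmbedding ρ X, hCol X⟩
            map := fun f => M f } := by
  refine ⟨fun X => ⟨_, isMollifierEmbedding_regEmbedding ρ X, fun i hi => hi.eq_regEmbedding⟩,
    fun X => isCol_mollifierEmbedding X hρ,
    fun f => ⟨mapPresheaf n f, fun Ω T => mapPresheaf_mollifierEmbedding ρ f T⟩,
    fun f Ω u hu => ⟨hu.comp_hom f, rfl⟩, ?_⟩
  refine ⟨{ obj := fun X => ⟨colombeauPresheaf X n, constEmb X, mollifierEmbedding ρ X,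
              isCol_mollifierEmbedding X hρ⟩
            map := fun f => ⟨mapPresheaf n f, fun Ω T => mapPresheaf_mollifierEmbedding ρ f T⟩
            map_id := fun X => ?_
            map_comp := fun {X Y Z} f g => ?_ }, rfl⟩
  -- Both functor laws compare reindexings, so they hold by definition on representatives.
  · refine Col.Hom.ext (NatTrans.ext (funext fun Ω => DAlg.Hom.ext (AlgHom.ext fun U => ?_)))
    obtain ⟨u, hu, rfl⟩ := cls_surjective (X := X) (Ω := Ω.unop) U
    rfl
  · refine Col.Hom.ext (NatTrans.ext (funext fun Ω => DAlg.Hom.ext (AlgHom.ext fun U => ?_)))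
    obtain ⟨u, hu, rfl⟩ := cls_surjective (X := X) (Ω := Ω.unop) U
    rfl
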